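/- **Setting.** Let $N\ge 2$, write $x=(x_1,X_2)\in\mathbb R\times\mathbb R^{N-1}$, let $\omega\subset\mathbb R^{N-1}$ be a bounded open set and $\Omega_\ell=(-\ell,\ell)\times\omega$ for $\ell>0$. Let $p>2$, $p'=\frac{p}{p-1}$, $s\in(\frac1{p'},1)$ and $T>0$. For $d\ge1$ and a bounded open set $\Omega\subset\mathbb R^d$ let $$[u]_{s,p,\mathbb R^d}^p=\iint_{\mathbb R^d\times\mathbb R^d}\frac{|u(x)-u(y)|^p}{|x-y|^{d+sp}}\,dx\,dy,$$ $$W_0^{s,p}(\Omega)=\{u\in L^p(\mathbb R^d):\ [u]_{s,p,\mathbb R^d}<\infty,\ u=0\text{ a.e. in }\mathbb R^d\setminus\Omega\},\qquad \|u\|=\big(\|u\|_{L^p(\Omega)}^p+[u]_{s,p,\mathbb R^d}^p\big)^{1/p},$$ $$W(a,b;W_0^{s,p}(\Omega))=\{u\in L^\infty(a,b;W_0^{s,p}(\Omega)):\ \partial_tu\in L^2(a,b;L^2(\Omega))\},$$ $$\varphi_p(r)=|r|^{p-2}r,\qquad C_{d,s,p}=\frac{sp\,2^{2s-1}\,\Gamma(\frac{d+ps}{2})}{2\pi^{\frac{d-1}{2}}\,\Gamma(1-s)\,\Gamma(\frac{p+1}{2})}.$$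 Given $g\in L^2(0,T;L^2(\Omega))$ and $w_0\in L^2(\Omega)$, a *weak solution* of $$\partial_tu+(-\Delta)_p^su=g\ \text{in }\Omega\times(0,T),\qquad u=0\ \text{in }(\mathbb R^d\setminus\Omega)\times(0,T),\qquad u(0)=w_0\ \text{in }\Omega$$ is a function $u\in C([0,T];L^2(\Omega))$ with $u(0)=w_0$ and $u\in W(\delta,T;W_0^{s,p}(\Omega))$ for every $\delta\in(0,T)$, such that for every $v\in W_0^{s,p}(\Omega)$ and a.e. $t\in(0,T)$ $$\int_\Omega\partial_tu(t)\,v\,dx+\frac{C_{d,s,p}}2\iint_{\mathbb R^d\times\mathbb R^d}\frac{\varphi_p(u(x,t)-u(y,t))\,(v(x)-v(y))}{|x-y|^{d+sp}}\,dx\,dy=\int_\Omega g(t)\,v\,dx.$$ (In particular every such $u\in W(0,T;W_0^{s,p}(\Omega))$, in its representative continuous into $L^2(\Omega)$, is a weak solution.) **Theorem 1.2.** Let $f\in L^2(0,T;L^2(\omega))$ and $u_0\in L^2(\omega)$, regarded also as functions $f(x,t)=f(X_2,t)$ and $u_0(x)=u_0(X_2)$ on $\Omega_\ell$ that do not depend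 on $x_1$. Let $u_\infty$ be the weak solution, for $d=N-1$, $\Omega=\omega$, with source $f$ and initial datum $u_0$, and for each $\ell>0$ let $u_\ell$ be the weak solution, for $d=N$, $\Omega=\Omega_\ell$, with source $f(X_2,t)$ and initial datum $u_0(X_2)$. Then for every fixed $\ell_0>0$ there is a constant $C>0$ independent of $\ell$ such that, for all sufficiently large $\ell$, $$\|u_\ell-u_\infty\|^2_{L^\infty(0,T;L^2(\Omega_{\ell_0}))}+\|u_\ell-u_\infty\|^p_{L^p(0,T;L^p(\Omega_{\ell_0}))}\le C\left(\frac1{\ell^{sp-1}}+\frac1{\ell^{\frac{sp}{p-1}-1}}\right),$$ where $u_\infty$ is regarded as the function $(x,t)\mapsto u_\infty(X_2,t)$. -/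

import Mathlib

open MeasureTheory Set Filter
open scoped ENNReal NNReal

noncomputable section

/-- The Euclidean space `ℝ^d`. -/
abbrev E (d : ℕ) : Type := EuclideanSpace ℝ (Fin d)

/-- The space `L²(ℝ^d)`. Functions in `L²(Ω)` are extended by zero outside `Ω`. -/
abbrev L2 (d : ℕ) : Type := Lp ℝ 2 (volume : Measure (E d))

/-- The normalizing constant `C_{d,s,p}` of the fractional `p`-Laplacian on `ℝ^d`. -/
def fracConst (d : ℕ) (s p : ℝ) : ℝ :=
  s * p * 2 ^ (2 * s - 1) * Real.Gamma (((d : ℝ) + p * s) / 2) /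
    (2 * Real.pi ^ (((d : ℝ) - 1) / 2) * Real.Gamma (1 - s) * Real.Gamma ((p + 1) / 2))

/-- The monotone function `φ_p(r) = |r|^{p-2} r`. -/
def phi (p r : ℝ) : ℝ := |r| ^ (p - 2) * r

/-- The `p`-th power `[u]^p_{s,p,ℝ^d}` of the Gagliardo seminorm, with values in `[0,∞]`. -/
def gagliardoPow {d : ℕ} (s p : ℝ) (u : E d → ℝ) : ℝ≥0∞ :=
  ∫⁻ z : E d × E d,
    ENNReal.ofReal (|u z.1 - u z.2| ^ p / ‖z.1 - z.2‖ ^ ((d : ℝ) + s * p))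

/-- Membership in `W₀^{s,p}(Ω)`: `u` is in `L^p`, has finite Gagliardo seminorm on the whole of
`ℝ^d`, and vanishes almost everywhere outside `Ω`. -/
structure MemW0 {d : ℕ} (s p : ℝ) (Ω : Set (E d)) (u : E d → ℝ) : Prop where
  memLp : MemLp u (ENNReal.ofReal p) volume
  gagliardo_lt_top : gagliardoPow s p u < ⊤
  zero_outside : ∀ᵐ x : E d, x ∉ Ω → u x = 0

/-- The norm `(‖u‖_{L^p(Ω)}^p + [u]^p_{s,p,ℝ^d})^{1/p}` of `W₀^{s,p}(Ω)`. -/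
def w0Norm {d : ℕ} (s p : ℝ) (Ω : Set (E d)) (u : E d → ℝ) : ℝ≥0∞ :=
  (eLpNorm u (ENNReal.ofReal p) (volume.restrict Ω) ^ p + gagliardoPow s p u) ^ (1 / p)

/-- The weak form of the fractional `p`-Laplacian on `ℝ^d`:
`(C_{d,s,p}/2) ∬ φ_p(u(x)-u(y)) (v(x)-v(y)) / |x-y|^{d+sp} dx dy`. -/
def fracForm {d : ℕ} (s p : ℝ) (u v : E d → ℝ) : ℝ :=
  fracConst d s p / 2 *
    ∫ z : E d × E d,
      phi p (u z.1 - u z.2) * (v z.1 - v z.2) / ‖z.1 - z.2‖ ^ ((d : ℝ) + s * p)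

/-- `u` belongs to the parabolic space `W(a, b; W₀^{s,p}(Ω))` and `∂ₜu = g`:
`u ∈ L^∞(a,b; W₀^{s,p}(Ω))`, `g ∈ L²(a,b; L²(Ω))`, and `u`, taken as its continuous
representative on `[a,b]`, is the indefinite Bochner integral of `g` in `L²`.
(Since `u` is continuous into `L²` and `W₀^{s,p}` is separable and reflexive, the measurability
of `u` as a `W₀^{s,p}`-valued map is automatic.) -/
structure MemParabolic {d : ℕ} (s p : ℝ) (Ω : Set (E d)) (a b : ℝ) (u g : ℝ → L2 d) : Prop where
  bounded : ∃ M : ℝ≥0, ∀ᵐ t ∂(volume.restrict (Ioo a b)),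
    MemW0 s p Ω (u t) ∧ w0Norm s p Ω (u t) ≤ M
  deriv_memLp : MemLp g 2 (volume.restrict (Ioo a b))
  eq_integral : ∀ t ∈ Icc a b, u t = u a + ∫ r in a..t, g r

/-- `u` is a weak solution of
`∂ₜu + (-Δ)_p^s u = f` in `Ω × (0,T)`, `u = 0` in `(ℝ^d \ Ω) × (0,T)`, `u(0) = u₀` in `Ω`.
Here `u ∈ C([0,T]; L²)` and `u ∈ W(δ, T; W₀^{s,p}(Ω))` for every `0 < δ < T`. Every
`u ∈ W(0, T; W₀^{s,p}(Ω))` is of this kind; the behaviour at `t = 0` is only prescribed in `L²`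
because the initial datum is only in `L²(Ω)`. The identity is required for each test function at
almost every time, the null set of times being allowed to depend on the test function. -/
def IsWeakSolution {d : ℕ} (s p T : ℝ) (Ω : Set (E d)) (f : ℝ → E d → ℝ) (u₀ : E d → ℝ)
    (u : ℝ → L2 d) : Prop :=
  ContinuousOn u (Icc 0 T) ∧
  (∀ᵐ x ∂(volume.restrict Ω), u 0 x = u₀ x) ∧
  ∃ g : ℝ → L2 d,
    (∀ δ ∈ Ioo 0 T, MemParabolic s p Ω δ T u g) ∧
    ∀ v : E d → ℝ, MemW0 s p Ω v →
      ∀ᵐ t ∂(volume.restrict (Ioo 0 T)),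
        (∫ x in Ω, g t x * v x) + fracForm s p (u t) v = ∫ x in Ω, f t x * v x

/-- The cross-section variable `X₂ = (x₂, …, x_N)` of `x = (x₁, X₂) ∈ ℝ^N`, `N = n + 1`. -/
def crossVar {n : ℕ} (x : E (n + 1)) : E n := WithLp.toLp 2 (fun i : Fin n => x i.succ)

/-- The cylinder `Ω_ℓ = (-ℓ, ℓ) × ω`. -/
def cylDomain {n : ℕ} (ω : Set (E n)) (l : ℝ) : Set (E (n + 1)) :=
  {x | x 0 ∈ Ioo (-l) l ∧ crossVar x ∈ ω}

/-- The norm of `L^q(0,T; L^r(Ω))`, with values in `[0,∞]`. -/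
def mixedNorm {d : ℕ} (q r : ℝ≥0∞) (T : ℝ) (Ω : Set (E d)) (w : ℝ → E d → ℝ) : ℝ≥0∞ :=
  eLpNorm (fun t => eLpNorm (w t) r (volume.restrict Ω)) q (volume.restrict (Ioo 0 T))

end

open scoped Topology

/-! Write n = N − 1, u for the solution on the cylinder of half-length ℓ, U for the cross-section
solution, and ζ for a cutoff in x₁ that is 1 on [−ℓ/2, ℓ/2] and 0 outside (−ℓ, ℓ). The proof is an
energy estimate for u − U tested with v = ζ²(u − U), which is admissible on the cylinder although
U(X₂) itself is not (`memW0_locDiff`).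

The equation of U lives in dimension n, so it is tested with V(X₂) = ∫ v dx₁, which lies in
W₀^{s,p}(ω). Integrating |x − y|^{−(n+1)−sp} over the axial difference gives a constant times |X −
Y|^{−n−sp}, and that constant is exactly C_{n,s,p} / C_{n+1,s,p} (`fracConst_succ_mul_sliceConst`).
Hence U satisfies the (n+1)-dimensional identity against v, the sources cancel on subtraction, and
`inner_cutoff_sub_eq` expresses the difference of the two forms by the time derivative of ‖ζ(u −
U)‖².

The difference of the forms is not monotone, because ζ varies. `phi_localized_monotone` bounds it
below by the localized energy of u − U, up to β^p (|Du| + |DU|)^p and β^{−p(p−2)} |m|^p |Dζ|^p,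
where D is the difference between two points, m the mean of u − U at them, and β > 0 is free. The
first error is β^p times energies over the slab. These are O(ℓ): for u by the energy estimate, since
the L² norms of the data grow like √ℓ, and for U by invariance along the axis. The second error is
an L^p norm, again O(ℓ) by a Poincaré inequality in a cross-sectional direction, times ∫ min(1,
|z|/R)^p |z|^{−d−sp} dz = O(R^{−sp}) with R = ℓ/2. The total is ℓ(β^p + β^{−p(p−2)} ℓ^{−sp}) up to
constants; β = ℓ^{−s/(p−1)} balances the two terms and yields ℓ^{1−sp/(p−1)}.

Integration in time bounds ‖ζ(u − U)‖ in L² at every time together with the time integral of the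
localized energy. On the shorter cylinder ζ = 1, and a local Poincaré inequality turns the energy
into the L^p norm. This already gives the second rate of the statement; the first rate is a
nonnegative addition. -/

/-! ### Pointwise inequalities for φ_p -/

lemma abs_phi {p : ℝ} (hp : 2 < p) (r : ℝ) : |phi p r| = |r| ^ (p - 1) := by
  unfold phi
  rw [abs_mul, abs_of_nonneg (Real.rpow_nonneg (abs_nonneg r) _)]
  rcases eq_or_ne r 0 with rfl | hr
  · rw [abs_zero, mul_zero, Real.zero_rpow (by linarith)]
  · rw [← Real.rpow_add_one (abs_ne_zero.2 hr)]
    congr 1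
    ring

lemma phi_mul_self {p : ℝ} (hp : 2 < p) (r : ℝ) : phi p r * r = |r| ^ p := by
  unfold phi
  rcases eq_or_ne r 0 with rfl | hr
  · rw [abs_zero, mul_zero, Real.zero_rpow (by linarith)]
  · rw [mul_assoc, ← abs_mul_abs_self, ← mul_assoc, ← Real.rpow_add_one (abs_ne_zero.2 hr),
      ← Real.rpow_add_one (abs_ne_zero.2 hr)]
    congr 1
    ring

lemma phi_neg (p r : ℝ) : phi p (-r) = -phi p r := by simp [phi]

lemma phi_of_nonneg {p : ℝ} (hp : 2 < p) {r : ℝ} (hr : 0 ≤ r) : phi p r = r ^ (p - 1) := by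
  have h := abs_phi hp r
  rwa [abs_of_nonneg hr, abs_of_nonneg] at h
  exact mul_nonneg (Real.rpow_nonneg (abs_nonneg r) _) hr

lemma continuous_phi {p : ℝ} (hp : 2 < p) : Continuous (phi p) := by
  unfold phi
  exact (continuous_abs.rpow_const fun x => Or.inr (by linarith)).mul continuous_id

/-- The two-sided control of `φ_p(a) - φ_p(b)` for `a ≥ |b|`. -/
lemma phi_sub_bounds {p : ℝ} (hp : 2 < p) {a b : ℝ} (hab : |b| ≤ a) :
    ((a - b) / 2) ^ (p - 1) ≤ phi p a - phi p b ∧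
      phi p a - phi p b ≤ (p - 1) * (a - b) * (a + |b|) ^ (p - 2) := by
  have ha : 0 ≤ a := (abs_nonneg b).trans hab
  rcases le_total 0 b with hb | hb
  · rw [abs_of_nonneg hb] at hab ⊢
    rw [phi_of_nonneg hp ha, phi_of_nonneg hp hb]
    constructor
    -- Superadditivity of t ↦ t^{p−1} on [0, ∞), which needs p − 1 ≥ 1.
    · have h := Real.add_rpow_le_rpow_add (sub_nonneg.2 hab) hb (show 1 ≤ p - 1 by linarith)
      rw [sub_add_cancel] at h
      have h2 : ((a - b) / 2) ^ (p - 1) ≤ (a - b) ^ (p - 1) :=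
        Real.rpow_le_rpow (by linarith) (by linarith) (by linarith)
      linarith
    · rcases ha.eq_or_lt with rfl | ha'
      · have : b = 0 := le_antisymm hab hb
        subst this
        simp
      -- Bernoulli at b/a replaces the mean value theorem for t ↦ t^{p−1}.
      · have hB := one_add_mul_self_le_rpow_one_add (s := b / a - 1)
          (by have := div_nonneg hb ha; linarith) (show 1 ≤ p - 1 by linarith)
        rw [add_sub_cancel, Real.div_rpow hb ha] at hB
        have hpos : 0 < a ^ (p - 1) := Real.rpow_pos_of_pos ha' _
        rw [le_div_iff₀ hpos] at hB
        have e : a ^ (p - 1) = a ^ (p - 2) * a := by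
          rw [← Real.rpow_add_one ha'.ne']
          congr 1
          ring
        have h3 : (1 + (p - 1) * (b / a - 1)) * a ^ (p - 1)
            = a ^ (p - 1) - (p - 1) * (a - b) * a ^ (p - 2) := by
          rw [e]
          field_simp
          ring
        have h4 : a ^ (p - 2) ≤ (a + b) ^ (p - 2) :=
          Real.rpow_le_rpow ha (by linarith) (by linarith)
        have h5 : (p - 1) * (a - b) * a ^ (p - 2) ≤ (p - 1) * (a - b) * (a + b) ^ (p - 2) :=
          mul_le_mul_of_nonneg_left h4 (mul_nonneg (by linarith) (by linarith))
        linarith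
  · have hb' : 0 ≤ -b := by linarith
    rw [abs_of_nonpos hb] at hab ⊢
    have e : phi p a - phi p b = a ^ (p - 1) + (-b) ^ (p - 1) := by
      rw [← phi_of_nonneg hp ha, ← phi_of_nonneg hp hb', phi_neg, sub_eq_add_neg]
    rw [e]
    constructor
    · have h1 : ((a - b) / 2) ^ (p - 1) ≤ a ^ (p - 1) :=
        Real.rpow_le_rpow (by linarith) (by linarith) (by linarith)
      have h2 := Real.rpow_nonneg hb' (p - 1)
      linarith
    · have h := Real.add_rpow_le_rpow_add ha hb' (show 1 ≤ p - 1 by linarith)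
      have h3 : (a + -b) ^ (p - 1) ≤ (a + -b) ^ (p - 2) * (a + -b) := by
        rcases (add_nonneg ha hb').eq_or_lt with h0 | h0
        · rw [← h0, Real.zero_rpow (by linarith), mul_zero]
        · rw [← Real.rpow_add_one h0.ne']
          exact le_of_eq (by congr 1; ring)
      have h4 : 0 ≤ (p - 2) * ((a + -b) ^ (p - 2) * (a + -b)) :=
        mul_nonneg (by linarith) (mul_nonneg (Real.rpow_nonneg (by linarith) _) (by linarith))
      calc a ^ (p - 1) + (-b) ^ (p - 1) ≤ (a + -b) ^ (p - 2) * (a + -b) := h.trans h3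
        _ ≤ (p - 1) * (a - b) * (a + -b) ^ (p - 2) := by linarith

/-- The lower bound supplies coercivity, the upper one controls the commutator with the cutoff. Both
are invariant under exchanging a and b and under a joint change of sign, which reduces them to |b| ≤
a. -/
lemma phi_sub_lower_upper {p : ℝ} (hp : 2 < p) (a b : ℝ) :
    |a - b| ^ p ≤ 2 ^ (p - 1) * ((phi p a - phi p b) * (a - b)) ∧
      |phi p a - phi p b| ≤ (p - 1) * |a - b| * (|a| + |b|) ^ (p - 2) := by
  wlog hab : |b| ≤ |a| generalizing a b with H
  · have h := H b a (le_of_not_ge hab)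
    rw [abs_sub_comm, abs_sub_comm (phi p a), add_comm |a|]
    refine ⟨h.1.trans (le_of_eq (by ring)), h.2⟩
  wlog ha : 0 ≤ a generalizing a b with H
  · have h := H (-a) (-b) (by simpa using hab) (by linarith)
    simp only [phi_neg, abs_neg] at h
    have e1 : -a - -b = -(a - b) := by ring
    have e2 : -phi p a - -phi p b = -(phi p a - phi p b) := by ring
    rw [e1, e2, abs_neg, abs_neg] at h
    exact ⟨h.1.trans (le_of_eq (by ring)), h.2⟩
  rw [abs_of_nonneg ha] at hab ⊢
  obtain ⟨h1, h2⟩ := phi_sub_bounds hp hab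
  have hba : 0 ≤ a - b := by linarith [le_abs_self b]
  have h0 : 0 ≤ phi p a - phi p b := (Real.rpow_nonneg (by linarith) _).trans h1
  rw [abs_of_nonneg hba, abs_of_nonneg h0]
  refine ⟨?_, h2⟩
  rw [Real.div_rpow hba (by norm_num), div_le_iff₀ (by positivity)] at h1
  calc (a - b) ^ p ≤ (a - b) ^ (p - 1) * (a - b) := by
        rcases hba.eq_or_lt with h | h
        · rw [← h, Real.zero_rpow (by linarith), mul_zero]
        · rw [← Real.rpow_add_one h.ne']
          exact le_of_eq (by congr 1; ring)
    _ ≤ (phi p a - phi p b) * 2 ^ (p - 1) * (a - b) := mul_le_mul_of_nonneg_right h1 hba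
    _ = _ := by ring

/-- A three-factor Young inequality without sharp constants: the exponents 1, p − 2, 1 add up to p,
so the product is at most the p-th power of the largest factor. -/
lemma mul_rpow_mul_le_add {p : ℝ} (hp : 2 < p) {x y z : ℝ} (hx : 0 ≤ x) (hy : 0 ≤ y)
    (hz : 0 ≤ z) : x * y ^ (p - 2) * z ≤ x ^ p + y ^ p + z ^ p := by
  set M := max x (max y z) with hM
  have hxM : x ≤ M := le_max_left _ _
  have hyM : y ≤ M := (le_max_left _ _).trans (le_max_right _ _)
  have hzM : z ≤ M := (le_max_right _ _).trans (le_max_right _ _)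
  have hM0 : 0 ≤ M := hx.trans hxM
  have hx' := Real.rpow_nonneg hx p
  have hy' := Real.rpow_nonneg hy p
  have hz' := Real.rpow_nonneg hz p
  have h1 : x * y ^ (p - 2) * z ≤ M ^ p := by
    calc x * y ^ (p - 2) * z ≤ M * M ^ (p - 2) * M := by
          have := Real.rpow_le_rpow hy hyM (show 0 ≤ p - 2 by linarith)
          gcongr
      _ = M ^ p := by
          rcases hM0.eq_or_lt with h | h
          · rw [← h, mul_zero, Real.zero_rpow (by linarith)]
          · rw [mul_comm M, ← Real.rpow_add_one h.ne', ← Real.rpow_add_one h.ne']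
            congr 1
            ring
  refine h1.trans ?_
  rcases max_choice x (max y z) with h | h
  · rw [hM, h]; linarith
  · rcases max_choice y z with h' | h'
    · rw [hM, h, h']; linarith
    · rw [hM, h, h']; linarith

/-- The localized monotonicity of `φ_p`: `a`, `b` stand for the differences of two functions,
`m` for the mean of their difference, and `x`, `y` for the values of a cutoff function. -/
lemma phi_localized_monotone {p : ℝ} (hp : 2 < p) {β : ℝ} (hβ : 0 < β) (a b m : ℝ) {x y : ℝ}
    (hx : x ∈ Icc (0 : ℝ) 1) (hy : y ∈ Icc (0 : ℝ) 1) :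
    2⁻¹ ^ p * ((x ^ 2 + y ^ 2) / 2 * |a - b| ^ p) ≤
      (phi p a - phi p b) * ((x ^ 2 + y ^ 2) / 2 * (a - b) + m * (x ^ 2 - y ^ 2)) +
        (β ^ p * (|a| + |b|) ^ p + (4 * (p - 1)) ^ p * (β⁻¹ ^ (p - 2)) ^ p *
          (|m| ^ p * |x - y| ^ p)) := by
  obtain ⟨h1, h2⟩ := phi_sub_lower_upper hp a b
  set r := (x ^ 2 + y ^ 2) / 2 with hr
  have hr0 : 0 ≤ r := by positivity
  have hr1 : r ≤ 1 := by
    have := pow_le_one₀ hx.1 hx.2 (n := 2)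
    have := pow_le_one₀ hy.1 hy.2 (n := 2)
    linarith
  -- The factor x + y of x² − y² must supply r^{1/p}, to pair with |a − b| in r |a − b|^p. The
  -- passage from r^{1/2} to r^{1/p} uses r ≤ 1 and p ≥ 2.
  have hσ : x + y ≤ 2 * r ^ (1 / p) := by
    have h3 : ((x + y) / 2) ^ 2 ≤ r := by
      rw [hr]; nlinarith [sq_nonneg (x - y)]
    have h4 : (x + y) / 2 ≤ r ^ (1 / 2 : ℝ) := by
      rw [← Real.sqrt_eq_rpow]
      exact Real.le_sqrt_of_sq_le h3
    have h5 : r ^ (1 / 2 : ℝ) ≤ r ^ (1 / p) :=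
      Real.rpow_le_rpow_of_exponent_ge' hr0 hr1 (by positivity)
        (one_div_le_one_div_of_le (by norm_num) hp.le)
    linarith
  have hrp : (r ^ (1 / p)) ^ p = r := by
    rw [← Real.rpow_mul hr0, one_div_mul_cancel (by linarith), Real.rpow_one]
  have hσ0 : 0 ≤ r ^ (1 / p) := Real.rpow_nonneg hr0 _
  -- The first factor carries 1/2 so that its p-th power is half of the coercive term in `h6` and
  -- can be absorbed; the weights β and β^{−(p−2)} cancel in the product.
  have hY := mul_rpow_mul_le_add hp (x := 2⁻¹ * (r ^ (1 / p) * |a - b|)) (y := β * (|a| + |b|))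
    (z := 4 * (p - 1) * β⁻¹ ^ (p - 2) * (|m| * |x - y|)) (by positivity) (by positivity)
    (mul_nonneg (mul_nonneg (by linarith) (by positivity)) (by positivity))
  have hββ : β ^ (p - 2) * β⁻¹ ^ (p - 2) = 1 := by
    rw [← Real.mul_rpow hβ.le (by positivity), mul_inv_cancel₀ hβ.ne', Real.one_rpow]
  have hL : 2⁻¹ * (r ^ (1 / p) * |a - b|) * (β * (|a| + |b|)) ^ (p - 2) *
      (4 * (p - 1) * β⁻¹ ^ (p - 2) * (|m| * |x - y|)) =
      (p - 1) * |a - b| * (|a| + |b|) ^ (p - 2) * (|m| * (|x - y| * (2 * r ^ (1 / p)))) := by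
    rw [Real.mul_rpow hβ.le (by positivity)]
    linear_combination (2 * (p - 1) * |a - b| * (|a| + |b|) ^ (p - 2) * |m| * |x - y|
      * r ^ (1 / p)) * hββ
  rw [hL, Real.mul_rpow (by norm_num) (by positivity), Real.mul_rpow hσ0 (abs_nonneg _), hrp,
    Real.mul_rpow hβ.le (by positivity),
    Real.mul_rpow (mul_nonneg (by linarith) (by positivity)) (by positivity),
    Real.mul_rpow (by linarith) (by positivity),
    Real.mul_rpow (abs_nonneg m) (abs_nonneg _)] at hY
  have hE : |(phi p a - phi p b) * (m * (x ^ 2 - y ^ 2))| ≤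
      (p - 1) * |a - b| * (|a| + |b|) ^ (p - 2) * (|m| * (|x - y| * (2 * r ^ (1 / p)))) := by
    rw [abs_mul, abs_mul, sq_sub_sq, mul_comm (x + y), abs_mul,
      abs_of_nonneg (add_nonneg hx.1 hy.1)]
    exact mul_le_mul h2 (by gcongr)
      (mul_nonneg (abs_nonneg _) (mul_nonneg (abs_nonneg _) (add_nonneg hx.1 hy.1)))
      ((abs_nonneg _).trans h2)
  have hE' := neg_le_of_abs_le hE
  have h6 : 2 * (2⁻¹ ^ p * (r * |a - b| ^ p)) ≤ (phi p a - phi p b) * (r * (a - b)) := by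
    have h7 : (2 : ℝ)⁻¹ ^ p * 2 ^ (p - 1) = 2⁻¹ := by
      rw [Real.inv_rpow (by norm_num), Real.rpow_sub_one (by norm_num)]
      field_simp
    calc 2 * (2⁻¹ ^ p * (r * |a - b| ^ p)) = 2 * 2⁻¹ ^ p * r * |a - b| ^ p := by ring
      _ ≤ 2 * 2⁻¹ ^ p * r * (2 ^ (p - 1) * ((phi p a - phi p b) * (a - b))) :=
          mul_le_mul_of_nonneg_left h1 (by positivity)
      _ = 2 * (2⁻¹ ^ p * 2 ^ (p - 1)) * ((phi p a - phi p b) * (r * (a - b))) := by ring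
      _ = _ := by rw [h7]; ring
  linarith

/-! ### Chain rule for the squared norm -/

lemma AbsolutelyContinuousOnInterval.of_dist_le {X Y : Type*} [PseudoMetricSpace X]
    [PseudoMetricSpace Y] {f : ℝ → X} {g : ℝ → Y} {a b : ℝ}
    (hg : AbsolutelyContinuousOnInterval g a b)
    (h : ∀ x ∈ uIcc a b, ∀ y ∈ uIcc a b, dist (f x) (f y) ≤ dist (g x) (g y)) :
    AbsolutelyContinuousOnInterval f a b := by
  rw [absolutelyContinuousOnInterval_iff] at hg ⊢
  intro ε hε
  obtain ⟨δ, hδ, H⟩ := hg ε hε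
  refine ⟨δ, hδ, fun E hE hE' => lt_of_le_of_lt (Finset.sum_le_sum fun i hi => ?_) (H E hE hE')⟩
  obtain ⟨h1, h2⟩ := hE.1 i hi
  exact h _ h1 _ h2

/-- The chain rule for the square of the norm along an absolutely continuous curve in a Hilbert
space. -/
lemma norm_sq_sub_norm_sq_eq_integral {H : Type*} [NormedAddCommGroup H] [InnerProductSpace ℝ H]
    [CompleteSpace H] {a b : ℝ} (hab : a ≤ b) {u g : ℝ → H}
    (hg : IntervalIntegrable g volume a b)
    (hu : ∀ t ∈ Icc a b, u t = u a + ∫ r in a..t, g r) :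
    IntervalIntegrable (fun t => 2 * inner ℝ (u t) (g t)) volume a b ∧
      ‖u b‖ ^ 2 - ‖u a‖ ^ 2 = ∫ t in a..b, 2 * inner ℝ (u t) (g t) := by
  set F : ℝ → H := fun t => u a + ∫ r in a..t, g r with hF
  have hcont : ContinuousOn F (uIcc a b) :=
    continuousOn_const.add (intervalIntegral.continuousOn_primitive_interval' hg left_mem_uIcc)
  obtain ⟨M, hM⟩ := isCompact_uIcc.exists_bound_of_continuousOn hcont
  have hM0 : 0 ≤ M := (norm_nonneg _).trans (hM a left_mem_uIcc)
  -- The squared norm is 2M-Lipschitz on the ball containing the curve, so its increments are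
  -- dominated by those of 2M ∫ ‖g‖.
  have hGac : AbsolutelyContinuousOnInterval (fun t => 2 * M * ∫ r in a..t, ‖g r‖) a b :=
    (hg.norm.absolutelyContinuousOnInterval_intervalIntegral left_mem_uIcc).const_mul _
  have hsub : ∀ x ∈ uIcc a b, IntervalIntegrable g volume a x := fun x hx =>
    hg.mono_set (uIcc_subset_uIcc_left hx)
  have hac : AbsolutelyContinuousOnInterval (fun t => ‖F t‖ ^ 2) a b := by
    refine hGac.of_dist_le fun x hx y hy => ?_
    have e1 : F x - F y = ∫ r in y..x, g r := by
      simp only [hF]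
      rw [add_sub_add_left_eq_sub, intervalIntegral.integral_interval_sub_left (hsub x hx)
        (hsub y hy)]
    have e2 : ‖F x - F y‖ ≤ |(∫ r in a..x, ‖g r‖) - ∫ r in a..y, ‖g r‖| := by
      rw [e1, intervalIntegral.integral_interval_sub_left (hsub x hx).norm (hsub y hy).norm]
      exact intervalIntegral.norm_integral_le_abs_integral_norm
    rw [Real.dist_eq, Real.dist_eq, ← mul_sub, abs_mul, abs_of_nonneg (by positivity : 0 ≤ 2 * M),
      sq_sub_sq, abs_mul]
    have h1 : |‖F x‖ + ‖F y‖| ≤ 2 * M := by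
      rw [abs_of_nonneg (by positivity)]
      linarith [hM x hx, hM y hy]
    exact mul_le_mul h1 ((abs_norm_sub_norm_le _ _).trans e2) (abs_nonneg _) (by positivity)
  have hder : ∀ᵐ t, t ∈ uIcc a b → deriv (fun t => ‖F t‖ ^ 2) t = 2 * inner ℝ (u t) (g t) := by
    filter_upwards [hg.ae_hasDerivAt_integral] with t ht htab
    have h1 : HasDerivAt F (g t) t := (ht htab a left_mem_uIcc).const_add _
    rw [uIcc_of_le hab] at htab
    rw [h1.norm_sq.deriv, hu t htab]
  have hint := hac.intervalIntegrable_deriv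
  have hder' : ∀ᵐ t, t ∈ uIoc a b →
      deriv (fun t => ‖F t‖ ^ 2) t = 2 * inner ℝ (u t) (g t) := by
    filter_upwards [hder] with t ht htab using ht (uIoc_subset_uIcc htab)
  refine ⟨hint.congr_ae ((ae_restrict_iff' measurableSet_uIoc).2 hder'), ?_⟩
  rw [← intervalIntegral.integral_congr_ae hder', hac.integral_deriv_eq_sub, hu b ⟨hab, le_rfl⟩]
  simp [hF]

/-! ### Integrals of the kernel -/

lemma lintegral_rpow_mul_exp_neg_mul_Ioi {a r : ℝ} (ha : 0 < a) (hr : 0 < r) :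
    ∫⁻ t in Ioi (0 : ℝ), ENNReal.ofReal (t ^ (a - 1) * Real.exp (-(r * t))) =
      ENNReal.ofReal ((1 / r) ^ a * Real.Gamma a) := by
  have h := Real.integral_rpow_mul_exp_neg_mul_Ioi ha hr
  have hne : (1 / r) ^ a * Real.Gamma a ≠ 0 := by
    have := Real.Gamma_pos_of_pos ha
    positivity
  rw [← h, ofReal_integral_eq_lintegral_ofReal]
  -- A nonzero Bochner integral forces integrability.
  · exact not_imp_comm.1 integral_undef (by rw [h]; exact hne)
  · filter_upwards [ae_restrict_mem measurableSet_Ioi] with t ht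
    exact mul_nonneg (Real.rpow_nonneg (le_of_lt ht) _) (Real.exp_nonneg _)

lemma lintegral_exp_neg_mul_sq {t : ℝ} (ht : 0 < t) :
    ∫⁻ h : ℝ, ENNReal.ofReal (Real.exp (-t * h ^ 2)) = ENNReal.ofReal √(Real.pi / t) := by
  rw [← integral_gaussian, ofReal_integral_eq_lintegral_ofReal (integrable_exp_neg_mul_sq ht)]
  exact Eventually.of_forall fun _ => (Real.exp_pos _).le

/-- Integrating the kernel `|x - y|^{-(b+1)}` in one variable. -/
lemma lintegral_one_div_sqrt_rpow {b r : ℝ} (hb : 0 < b) (hr : 0 < r) :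
    ∫⁻ h : ℝ, ENNReal.ofReal (1 / √(h ^ 2 + r ^ 2) ^ (b + 1)) =
      ENNReal.ofReal (√Real.pi * Real.Gamma (b / 2) / Real.Gamma ((b + 1) / 2)) *
        ENNReal.ofReal (1 / r ^ b) := by
  set A := (b + 1) / 2 with hA
  have hA0 : 0 < A := by positivity
  have hG := Real.Gamma_pos_of_pos hA0
  -- Subordination: q^{−A} = Γ(A)^{−1} ∫ t^{A−1} e^{−qt} dt makes the h-integral Gaussian; after
  -- Tonelli the t-integral is again a Gamma integral, with parameter A − 1/2 = b/2.
  have h1 : ∀ h : ℝ, ENNReal.ofReal (1 / √(h ^ 2 + r ^ 2) ^ (b + 1)) =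
      ENNReal.ofReal (1 / Real.Gamma A) * ∫⁻ t in Ioi (0 : ℝ),
        ENNReal.ofReal (t ^ (A - 1) * Real.exp (-((h ^ 2 + r ^ 2) * t))) := by
    intro h
    have hq : 0 < h ^ 2 + r ^ 2 := by positivity
    rw [lintegral_rpow_mul_exp_neg_mul_Ioi hA0 hq, ← ENNReal.ofReal_mul (by positivity)]
    congr 1
    rw [Real.sqrt_eq_rpow, ← Real.rpow_mul hq.le, Real.div_rpow zero_le_one hq.le, Real.one_rpow,
      show 1 / 2 * (b + 1) = A by rw [hA]; ring]
    field_simp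
  simp_rw [h1]
  rw [lintegral_const_mul' _ _ ENNReal.ofReal_ne_top, lintegral_lintegral_swap]
  · have h2 : ∀ t ∈ Ioi (0 : ℝ),
        ∫⁻ h : ℝ, ENNReal.ofReal (t ^ (A - 1) * Real.exp (-((h ^ 2 + r ^ 2) * t))) =
          ENNReal.ofReal √Real.pi *
            ENNReal.ofReal (t ^ (b / 2 - 1) * Real.exp (-(r ^ 2 * t))) := by
      intro t ht
      have ht0 : (0 : ℝ) < t := ht
      have h3 : ∀ h : ℝ, ENNReal.ofReal (t ^ (A - 1) * Real.exp (-((h ^ 2 + r ^ 2) * t))) =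
          ENNReal.ofReal (t ^ (A - 1) * Real.exp (-(r ^ 2 * t))) *
            ENNReal.ofReal (Real.exp (-t * h ^ 2)) := by
        intro h
        rw [← ENNReal.ofReal_mul (by positivity), mul_assoc, ← Real.exp_add]
        congr 3
        ring
      simp_rw [h3]
      rw [lintegral_const_mul' _ _ ENNReal.ofReal_ne_top, lintegral_exp_neg_mul_sq ht0,
        ← ENNReal.ofReal_mul (by positivity), ← ENNReal.ofReal_mul (by positivity)]
      congr 1
      rw [Real.sqrt_div Real.pi_pos.le, Real.sqrt_eq_rpow t,
        show b / 2 - 1 = (A - 1) - 1 / 2 by rw [hA]; ring, Real.rpow_sub ht0 (A - 1)]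
      ring
    rw [setLIntegral_congr_fun measurableSet_Ioi h2,
      lintegral_const_mul' _ _ ENNReal.ofReal_ne_top,
      lintegral_rpow_mul_exp_neg_mul_Ioi (half_pos hb) (by positivity : (0 : ℝ) < r ^ 2),
      ← ENNReal.ofReal_mul (by positivity), ← ENNReal.ofReal_mul (by positivity),
      ← ENNReal.ofReal_mul (by positivity)]
    congr 1
    rw [Real.div_rpow zero_le_one (by positivity), Real.one_rpow, ← Real.rpow_natCast_mul hr.le,
      show ((2 : ℕ) : ℝ) * (b / 2) = b by push_cast; ring]
    ring
  · apply Measurable.aemeasurable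
    apply ENNReal.measurable_ofReal.comp
    have : Measurable fun z : ℝ × ℝ => z.2 ^ (A - 1) := measurable_snd.pow_const _
    exact this.mul (by fun_prop)

/-- The kernel `|z|^{-d-sp}`, truncated by `min(1, |z|/R)^p` near the origin, has integral of order
`R^{-sp}`. -/
lemma exists_lintegral_truncated_kernel_le {d : ℕ} (hd : 1 ≤ d) {s p : ℝ} (hp : 0 < p)
    (hs : 0 < s) (hs1 : s < 1) :
    ∃ K : ℝ, 0 < K ∧ ∀ R : ℝ, 0 < R →
      ∫⁻ z : E d, ENNReal.ofReal (min 1 (‖z‖ / R) ^ p / ‖z‖ ^ ((d : ℝ) + s * p)) ≤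
        ENNReal.ofReal (K * (1 / R ^ (s * p))) := by
  have : Nontrivial (E d) := by
    have : Nonempty (Fin d) := ⟨⟨0, hd⟩⟩
    infer_instance
  have hsp : 0 < s * p := mul_pos hs hp
  set f : ℝ → ℝ := fun y => min 1 y ^ p / y ^ ((d : ℝ) + s * p) with hf
  have hf0 : ∀ y, 0 ≤ y → 0 ≤ f y := fun y hy =>
    div_nonneg (Real.rpow_nonneg (le_min zero_le_one hy) _) (Real.rpow_nonneg hy _)
  have hpow : ∀ y : ℝ, 0 < y → y ^ (d - 1) / y ^ ((d : ℝ) + s * p) = y ^ (-1 - s * p) := by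
    intro y hy
    rw [← Real.rpow_natCast, ← Real.rpow_sub hy, Nat.cast_sub hd]
    congr 1
    push_cast
    ring
  -- In polar coordinates the density is y^{p−1−sp} on (0, 1], integrable since s < 1, and y^{−1−sp}
  -- beyond 1, integrable since sp > 0.
  have hint : Integrable (fun z : E d => f ‖z‖) volume := by
    rw [integrable_fun_norm_addHaar, ← Ioc_union_Ioi_eq_Ioi (zero_le_one' ℝ)]
    apply IntegrableOn.union
    · have h1 : IntegrableOn (fun y : ℝ => y ^ (p - 1 - s * p)) (Ioc 0 1) := by
        rw [← intervalIntegrable_iff_integrableOn_Ioc_of_le zero_le_one]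
        exact intervalIntegral.intervalIntegrable_rpow' (by nlinarith)
      refine h1.congr_fun (fun y hy => ?_) measurableSet_Ioc
      simp only [finrank_euclideanSpace, Fintype.card_fin, smul_eq_mul, hf]
      rw [min_eq_right hy.2, mul_div_left_comm, hpow y hy.1, ← Real.rpow_add hy.1]
      congr 1
      ring
    · have h1 : IntegrableOn (fun y : ℝ => y ^ (-1 - s * p)) (Ioi 1) :=
        integrableOn_Ioi_rpow_of_lt (by linarith) zero_lt_one
      refine h1.congr_fun (fun y (hy : 1 < y) => ?_) measurableSet_Ioi
      simp only [finrank_euclideanSpace, Fintype.card_fin, smul_eq_mul, hf]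
      rw [min_eq_left hy.le, Real.one_rpow, mul_one_div, hpow y (by linarith)]
  have hI0 : 0 ≤ ∫ z : E d, f ‖z‖ := integral_nonneg fun z => hf0 _ (norm_nonneg z)
  refine ⟨(∫ z : E d, f ‖z‖) + 1, by linarith, fun R hR => ?_⟩
  have hsc : ∀ z : E d, min 1 (‖z‖ / R) ^ p / ‖z‖ ^ ((d : ℝ) + s * p) =
      (1 / R ^ ((d : ℝ) + s * p)) * f ‖R⁻¹ • z‖ := by
    intro z
    simp only [hf]
    rw [norm_smul, Real.norm_eq_abs, abs_of_pos (by positivity : 0 < R⁻¹),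
      Real.mul_rpow (by positivity) (norm_nonneg z), Real.inv_rpow hR.le, inv_mul_eq_div]
    have : R ^ ((d : ℝ) + s * p) ≠ 0 := (Real.rpow_pos_of_pos hR _).ne'
    field_simp
  simp_rw [hsc]
  have hint' : Integrable (fun z : E d => f ‖R⁻¹ • z‖) volume :=
    (integrable_comp_smul_iff volume (fun z : E d => f ‖z‖) (by positivity : R⁻¹ ≠ 0)).2 hint
  rw [← ofReal_integral_eq_lintegral_ofReal (hint'.const_mul _)]
  · apply ENNReal.ofReal_le_ofReal
    rw [integral_const_mul, Measure.integral_comp_inv_smul volume (fun z : E d => f ‖z‖) R,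
      finrank_euclideanSpace, Fintype.card_fin, abs_of_pos (by positivity), smul_eq_mul,
      Real.rpow_add hR, Real.rpow_natCast]
    have h2 : 1 / (R ^ d * R ^ (s * p)) * (R ^ d * ∫ z : E d, f ‖z‖) =
        (∫ z : E d, f ‖z‖) * (1 / R ^ (s * p)) := by
      have : R ^ (s * p) ≠ 0 := (Real.rpow_pos_of_pos hR _).ne'
      field_simp
    rw [h2]
    gcongr
    linarith
  · exact Eventually.of_forall fun z => mul_nonneg (by positivity) (hf0 _ (norm_nonneg _))

/-! ### The Gagliardo measure -/

/-- The measure `|x - y|^{-d-sp} dx dy` on `ℝ^d × ℝ^d`. -/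
noncomputable def gagliardoMeasure (d : ℕ) (s p : ℝ) : Measure (E d × E d) :=
  volume.withDensity fun z => ENNReal.ofReal (1 / ‖z.1 - z.2‖ ^ ((d : ℝ) + s * p))

/-- The difference `u(x) - u(y)`. -/
def pairDiff {d : ℕ} (u : E d → ℝ) (z : E d × E d) : ℝ := u z.1 - u z.2

section gagliardoMeasure

variable {d : ℕ} {s p : ℝ}

lemma measurable_kernel (d : ℕ) (s p : ℝ) : Measurable fun z : E d × E d =>
    ENNReal.ofReal (1 / ‖z.1 - z.2‖ ^ ((d : ℝ) + s * p)) := by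
  apply ENNReal.measurable_ofReal.comp
  have : Measurable fun z : E d × E d => ‖z.1 - z.2‖ := by fun_prop
  exact (this.pow_const _).const_div _

instance : SFinite (gagliardoMeasure d s p) := by
  unfold gagliardoMeasure
  infer_instance

lemma gagliardoMeasure_absolutelyContinuous : gagliardoMeasure d s p ≪ volume :=
  withDensity_absolutelyContinuous _ _

lemma lintegral_gagliardoMeasure (F : E d × E d → ℝ≥0∞) :
    ∫⁻ z, F z ∂(gagliardoMeasure d s p) =
      ∫⁻ z : E d × E d, ENNReal.ofReal (1 / ‖z.1 - z.2‖ ^ ((d : ℝ) + s * p)) * F z := by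
  unfold gagliardoMeasure
  rw [lintegral_withDensity_eq_lintegral_mul_non_measurable _ (measurable_kernel d s p)
    (Eventually.of_forall fun _ => ENNReal.ofReal_lt_top)]
  rfl

lemma gagliardoPow_eq (u : E d → ℝ) :
    gagliardoPow s p u = ∫⁻ z, ENNReal.ofReal (|pairDiff u z| ^ p) ∂(gagliardoMeasure d s p) := by
  rw [lintegral_gagliardoMeasure]
  unfold gagliardoPow pairDiff
  refine lintegral_congr fun z => ?_
  rw [← ENNReal.ofReal_mul (by positivity)]
  congr 1
  ring

lemma fracForm_eq (u v : E d → ℝ) :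
    fracForm s p u v = fracConst d s p / 2 *
      ∫ z, phi p (pairDiff u z) * pairDiff v z ∂(gagliardoMeasure d s p) := by
  unfold fracForm gagliardoMeasure
  rw [integral_withDensity_eq_integral_toReal_smul (measurable_kernel d s p)
    (Eventually.of_forall fun _ => ENNReal.ofReal_lt_top)]
  congr 1
  refine integral_congr_ae (Eventually.of_forall fun z => ?_)
  simp only [smul_eq_mul, pairDiff]
  rw [ENNReal.toReal_ofReal (by positivity)]
  ring

lemma aestronglyMeasurable_pairDiff {u : E d → ℝ} (hu : AEStronglyMeasurable u volume) :
    AEStronglyMeasurable (pairDiff u) (gagliardoMeasure d s p) := by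
  refine AEStronglyMeasurable.mono_ac gagliardoMeasure_absolutelyContinuous ?_
  exact (hu.comp_fst).sub (hu.comp_snd)

lemma map_swap_gagliardoMeasure :
    (gagliardoMeasure d s p).map Prod.swap = gagliardoMeasure d s p := by
  refine Measure.ext_of_lintegral _ fun F hF => ?_
  rw [lintegral_map hF measurable_swap, lintegral_gagliardoMeasure, lintegral_gagliardoMeasure,
    Measure.volume_eq_prod, ← lintegral_prod_swap]
  refine lintegral_congr fun z => ?_
  simp [norm_sub_rev]

lemma lintegral_gagliardoMeasure_swap {F : E d × E d → ℝ≥0∞}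
    (hF : AEMeasurable F (gagliardoMeasure d s p)) :
    ∫⁻ z, F z.swap ∂(gagliardoMeasure d s p) = ∫⁻ z, F z ∂(gagliardoMeasure d s p) := by
  conv_rhs => rw [← map_swap_gagliardoMeasure]
  rw [lintegral_map' _ measurable_swap.aemeasurable]
  rwa [map_swap_gagliardoMeasure]

end gagliardoMeasure

/-- Tonelli for a convolution-type integrand. -/
lemma lintegral_mul_sub {d : ℕ} {F q : E d → ℝ≥0∞} (hF : AEMeasurable F volume)
    (hq : Measurable q) :
    ∫⁻ z : E d × E d, F z.1 * q (z.1 - z.2) = (∫⁻ x, F x) * ∫⁻ z, q z := by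
  have hm : AEMeasurable (fun z : E d × E d => F z.1 * q (z.1 - z.2)) (volume.prod volume) :=
    (hF.comp_fst).mul (hq.comp (measurable_fst.sub measurable_snd)).aemeasurable
  rw [Measure.volume_eq_prod, lintegral_prod _ hm]
  have h1 : ∀ x : E d, ∫⁻ y, F x * q (x - y) = F x * ∫⁻ z, q z := by
    intro x
    have : Measurable fun y => q (x - y) := hq.comp (by fun_prop)
    rw [lintegral_const_mul _ this, lintegral_sub_left_eq_self q x]
  simp_rw [h1]
  rw [lintegral_mul_const'' _ hF]

/-! ### Coordinates adapted to the cylinder and compatibility of the constants -/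

section cylinder

variable {n : ℕ}

/-- The point `(a, X)` of `ℝ^{n+1}`. -/
def consE (a : ℝ) (X : E n) : E (n + 1) := WithLp.toLp 2 (Fin.cons a (fun i => X i))

@[simp] lemma consE_zero (a : ℝ) (X : E n) : consE a X 0 = a := rfl

@[simp] lemma crossVar_consE (a : ℝ) (X : E n) : crossVar (consE a X) = X := rfl

lemma measurable_crossVar : Measurable (crossVar : E (n + 1) → E n) := by
  unfold crossVar
  fun_prop

lemma norm_eq_sqrt_crossVar (x : E (n + 1)) : ‖x‖ = √(x 0 ^ 2 + ‖crossVar x‖ ^ 2) := by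
  rw [EuclideanSpace.norm_eq, EuclideanSpace.norm_sq_eq, Fin.sum_univ_succ]
  simp [crossVar]

lemma crossVar_sub (x y : E (n + 1)) : crossVar (x - y) = crossVar x - crossVar y := rfl

lemma norm_consE_sub (a h : ℝ) (X Y : E n) :
    ‖consE a X - consE (a + h) Y‖ = √(h ^ 2 + ‖X - Y‖ ^ 2) := by
  rw [norm_eq_sqrt_crossVar, crossVar_sub, crossVar_consE, crossVar_consE]
  congr 2
  simp

lemma measurePreserving_consE :
    MeasurePreserving (fun z : ℝ × E n => consE z.1 z.2) := by
  have h1 := (volume_preserving_piFinSuccAbove (fun _ : Fin (n + 1) => ℝ) 0).symm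
  have h2 : MeasurePreserving (fun z : ℝ × E n => (z.1, WithLp.ofLp z.2)) :=
    (MeasurePreserving.id volume).prod (PiLp.volume_preserving_ofLp (Fin n))
  convert! (PiLp.volume_preserving_toLp (Fin (n + 1))).comp (h1.comp h2) using 1
  funext z
  ext i
  refine Fin.cases ?_ (fun j => ?_) i <;> simp [consE]

lemma measurePreserving_consE_swap :
    MeasurePreserving (fun z : E n × ℝ => consE z.2 z.1) :=
  measurePreserving_consE.comp Measure.measurePreserving_swap

lemma lintegral_consE {F : E (n + 1) → ℝ≥0∞} (hF : AEMeasurable F volume) :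
    ∫⁻ x, F x = ∫⁻ X : E n, ∫⁻ a : ℝ, F (consE a X) := by
  have h := measurePreserving_consE_swap (n := n)
  rw [← h.map_eq, lintegral_map' (by rwa [h.map_eq]) h.measurable.aemeasurable,
    Measure.volume_eq_prod, lintegral_prod]
  exact hF.comp_quasiMeasurePreserving h.quasiMeasurePreserving

lemma integrable_comp_consE {F : E (n + 1) → ℝ} (hF : Integrable F volume) :
    Integrable (fun z : E n × ℝ => F (consE z.2 z.1)) (volume.prod volume) :=
  measurePreserving_consE_swap.integrable_comp_of_integrable hF

lemma integral_consE {F : E (n + 1) → ℝ} (hF : Integrable F volume) :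
    ∫ x, F x = ∫ X : E n, ∫ a : ℝ, F (consE a X) := by
  have h := measurePreserving_consE_swap (n := n)
  rw [← h.map_eq, integral_map h.measurable.aemeasurable (by rw [h.map_eq]; exact hF.1),
    Measure.volume_eq_prod, integral_prod _ (integrable_comp_consE hF)]

/-- Null sets pull back to null sets because every fibre over a point is a line and ∞ · 0 = 0. The
projection does not preserve measure, since preimages have infinite length along the axis. -/
lemma quasiMeasurePreserving_crossVar :
    Measure.QuasiMeasurePreserving (crossVar : E (n + 1) → E n) := by
  refine ⟨measurable_crossVar, Measure.AbsolutelyContinuous.mk fun A hA h0 => ?_⟩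
  rw [Measure.map_apply measurable_crossVar hA,
    ← lintegral_indicator_one (measurable_crossVar hA),
    lintegral_consE (measurable_one.indicator (measurable_crossVar hA)).aemeasurable]
  have h1 : ∀ X : E n, ∫⁻ a : ℝ, (crossVar ⁻¹' A).indicator (1 : E (n + 1) → ℝ≥0∞) (consE a X) =
      A.indicator (fun _ => ∞) X := by
    intro X
    by_cases hX : X ∈ A <;> simp [indicator, hX]
  simp_rw [h1]
  rw [lintegral_indicator_const hA, h0, mul_zero]

lemma measurePreserving_prod_prod_comm :
    MeasurePreserving (fun z : (E n × E n) × (ℝ × ℝ) => ((z.2.1, z.1.1), (z.2.2, z.1.2)))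
      volume volume := by
  have hm : Measurable fun z : (E n × E n) × (ℝ × ℝ) => ((z.2.1, z.1.1), (z.2.2, z.1.2)) := by
    fun_prop
  refine ⟨hm, Measure.ext_of_lintegral _ fun f hf => ?_⟩
  rw [lintegral_map hf hm]
  simp only [Measure.volume_eq_prod]
  have hfm : Measurable fun z : (E n × E n) × (ℝ × ℝ) => f ((z.2.1, z.1.1), (z.2.2, z.1.2)) :=
    hf.comp hm
  have e1 : ∫⁻ z : (E n × E n) × (ℝ × ℝ), f ((z.2.1, z.1.1), (z.2.2, z.1.2))
      ∂((volume.prod volume).prod (volume.prod volume)) =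
      ∫⁻ X : E n, ∫⁻ Y : E n, ∫⁻ a : ℝ, ∫⁻ b : ℝ, f ((a, X), (b, Y)) := by
    refine (lintegral_prod _ hfm.aemeasurable).trans ?_
    refine (lintegral_prod _ hfm.lintegral_prod_right'.aemeasurable).trans ?_
    refine lintegral_congr fun X => lintegral_congr fun Y => ?_
    exact lintegral_prod (fun c : ℝ × ℝ => f ((c.1, X), (c.2, Y)))
      (hf.comp (by fun_prop)).aemeasurable
  have e2 : ∫⁻ z, f z ∂((volume.prod volume).prod (volume.prod volume)) =
      ∫⁻ a : ℝ, ∫⁻ X : E n, ∫⁻ Y : E n, ∫⁻ b : ℝ, f ((a, X), (b, Y)) := by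
    refine (lintegral_prod _ hf.aemeasurable).trans ?_
    refine (lintegral_prod _ hf.lintegral_prod_right'.aemeasurable).trans ?_
    refine lintegral_congr fun a => lintegral_congr fun X => ?_
    exact lintegral_prod_symm (fun y : ℝ × E n => f ((a, X), y))
      (hf.comp (by fun_prop)).aemeasurable
  rw [e1, e2]
  have e3 : ∀ X : E n, ∫⁻ Y : E n, ∫⁻ a : ℝ, ∫⁻ b : ℝ, f ((a, X), (b, Y)) =
      ∫⁻ a : ℝ, ∫⁻ Y : E n, ∫⁻ b : ℝ, f ((a, X), (b, Y)) := fun X =>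
    lintegral_lintegral_swap (Measurable.aemeasurable
      (Measurable.lintegral_prod_right' (f := fun w : (E n × ℝ) × ℝ =>
        f ((w.1.2, X), (w.2, w.1.1))) (hf.comp (by fun_prop))))
  simp only [e3]
  refine lintegral_lintegral_swap (Measurable.aemeasurable ?_)
  exact Measurable.lintegral_prod_right' (f := fun w : (E n × ℝ) × E n =>
    ∫⁻ b : ℝ, f ((w.1.2, w.1.1), (b, w.2))) (Measurable.lintegral_prod_right'
      (f := fun w : ((E n × ℝ) × E n) × ℝ => f ((w.1.1.2, w.1.1.1), (w.2, w.1.2)))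
      (hf.comp (by fun_prop)))

/-- The parametrization `((X, Y), (h, a)) ↦ ((a, X), (a + h, Y))` of `ℝ^{n+1} × ℝ^{n+1}`. -/
def pairCons (w : (E n × E n) × (ℝ × ℝ)) : E (n + 1) × E (n + 1) :=
  (consE w.2.2 w.1.1, consE (w.2.2 + w.2.1) w.1.2)

lemma measurePreserving_pairCons :
    MeasurePreserving (pairCons (n := n)) volume volume := by
  have h1 : MeasurePreserving (fun w : (E n × E n) × (ℝ × ℝ) => (w.1, (w.2.2, w.2.2 + w.2.1)))
      volume volume :=
    (MeasurePreserving.id volume).prod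
      ((measurePreserving_prod_add (volume : Measure ℝ) volume).comp Measure.measurePreserving_swap)
  exact (measurePreserving_consE.prod measurePreserving_consE).comp
    (measurePreserving_prod_prod_comm.comp h1)

/-- The kernel of `ℝ^{n+1}` in the coordinates `pairCons`. -/
noncomputable def sliceKernel (n : ℕ) (s p h r : ℝ) : ℝ :=
  1 / √(h ^ 2 + r ^ 2) ^ (((n + 1 : ℕ) : ℝ) + s * p)

lemma sliceKernel_nonneg (n : ℕ) (s p h r : ℝ) : 0 ≤ sliceKernel n s p h r := by
  unfold sliceKernel
  positivity

lemma measurable_sliceKernel (n : ℕ) (s p : ℝ) :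
    Measurable fun z : ℝ × ℝ => sliceKernel n s p z.1 z.2 := by
  unfold sliceKernel
  have : Measurable fun z : ℝ × ℝ => √(z.1 ^ 2 + z.2 ^ 2) := by fun_prop
  exact (this.pow_const _).const_div _

lemma kernel_pairCons (s p : ℝ) (w : (E n × E n) × (ℝ × ℝ)) :
    1 / ‖(pairCons w).1 - (pairCons w).2‖ ^ (((n + 1 : ℕ) : ℝ) + s * p) =
      sliceKernel n s p w.2.1 ‖w.1.1 - w.1.2‖ := by
  simp only [pairCons, norm_consE_sub, sliceKernel]

/-- In the coordinates a, h, X, Y the kernel depends only on h and |X − Y|, so it comes out of the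
innermost integral over the axial position a. -/
lemma lintegral_gagliardoMeasure_succ {s p : ℝ} {F : E (n + 1) × E (n + 1) → ℝ≥0∞}
    (hF : AEMeasurable F volume) :
    ∫⁻ z, F z ∂(gagliardoMeasure (n + 1) s p) =
      ∫⁻ w : E n × E n, ∫⁻ h : ℝ, ENNReal.ofReal (sliceKernel n s p h ‖w.1 - w.2‖) *
        ∫⁻ a : ℝ, F (consE a w.1, consE (a + h) w.2) := by
  have hP := measurePreserving_pairCons (n := n)
  have hFm := (measurable_kernel (n + 1) s p).aemeasurable.mul hF
  have hFP := hFm.comp_quasiMeasurePreserving hP.quasiMeasurePreserving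
  rw [lintegral_gagliardoMeasure, ← hP.map_eq,
    lintegral_map' (by rw [hP.map_eq]; exact hFm) hP.measurable.aemeasurable,
    Measure.volume_eq_prod]
  refine (lintegral_prod _ hFP).trans (lintegral_congr_ae ?_)
  filter_upwards [hFP.aestronglyMeasurable.prodMk_left] with w hw
  refine (lintegral_prod _ hw.aemeasurable).trans (lintegral_congr fun h => ?_)
  simp only [Function.comp_apply, Pi.mul_apply, kernel_pairCons]
  simp only [pairCons]
  rw [lintegral_const_mul' _ _ ENNReal.ofReal_ne_top]

/-- The ratio of the kernels of consecutive dimensions. -/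
noncomputable def sliceConst (n : ℕ) (s p : ℝ) : ℝ :=
  √Real.pi * Real.Gamma (((n : ℝ) + s * p) / 2) / Real.Gamma (((n : ℝ) + s * p + 1) / 2)

lemma sliceConst_pos {s p : ℝ} (hsp : 0 < s * p) : 0 < sliceConst n s p := by
  unfold sliceConst
  have h1 := Real.Gamma_pos_of_pos (show 0 < ((n : ℝ) + s * p) / 2 by positivity)
  have h2 := Real.Gamma_pos_of_pos (show 0 < ((n : ℝ) + s * p + 1) / 2 by positivity)
  have := Real.sqrt_pos.2 Real.pi_pos
  positivity

lemma fracConst_pos {s p : ℝ} {d : ℕ} (hs : 0 < s) (hs1 : s < 1) (hp : 0 < p) :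
    0 < fracConst d s p := by
  unfold fracConst
  have h1 := Real.Gamma_pos_of_pos (show 0 < ((d : ℝ) + p * s) / 2 by positivity)
  have h2 := Real.Gamma_pos_of_pos (show 0 < 1 - s by linarith)
  have h3 := Real.Gamma_pos_of_pos (show 0 < (p + 1) / 2 by positivity)
  have := Real.pi_pos
  positivity

/-- The normalizing constants are compatible with the integration of the kernel over lines. -/
lemma fracConst_succ_mul_sliceConst {s p : ℝ} (hsp : 0 < s * p) :
    fracConst (n + 1) s p * sliceConst n s p = fracConst n s p := by
  unfold fracConst sliceConst
  have h2 := (Real.Gamma_pos_of_pos (show 0 < ((n : ℝ) + s * p + 1) / 2 by positivity)).ne'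
  rw [show (((n + 1 : ℕ) : ℝ) + p * s) / 2 = ((n : ℝ) + s * p + 1) / 2 by push_cast; ring,
    show ((n : ℝ) + p * s) / 2 = ((n : ℝ) + s * p) / 2 by ring,
    show (((n + 1 : ℕ) : ℝ) - 1) / 2 = ((n : ℝ) - 1) / 2 + 1 / 2 by push_cast; ring,
    Real.rpow_add Real.pi_pos, ← Real.sqrt_eq_rpow]
  have := (Real.sqrt_pos.2 Real.pi_pos).ne'
  field_simp

lemma lintegral_sliceKernel {s p r : ℝ} (hsp : 0 < s * p) (hr : 0 < r) :
    ∫⁻ h : ℝ, ENNReal.ofReal (sliceKernel n s p h r) =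
      ENNReal.ofReal (sliceConst n s p) * ENNReal.ofReal (1 / r ^ ((n : ℝ) + s * p)) := by
  rw [sliceConst, ← lintegral_one_div_sqrt_rpow (by positivity) hr]
  refine lintegral_congr fun h => ?_
  unfold sliceKernel
  have e : ((n + 1 : ℕ) : ℝ) + s * p = (n : ℝ) + s * p + 1 := by push_cast; ring
  rw [e]

lemma integral_sliceKernel {s p r : ℝ} (hsp : 0 < s * p) (hr : 0 < r) :
    ∫ h : ℝ, sliceKernel n s p h r = sliceConst n s p * (1 / r ^ ((n : ℝ) + s * p)) := by
  have hm : AEStronglyMeasurable (fun h => sliceKernel n s p h r) volume :=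
    (Measurable.of_uncurry_right (f := sliceKernel n s p)
      (measurable_sliceKernel n s p)).aestronglyMeasurable
  have h0 : 0 ≤ᵐ[volume] fun h => sliceKernel n s p h r :=
    Eventually.of_forall fun h => sliceKernel_nonneg n s p h r
  have h1 : (0 : ℝ) ≤ 1 / r ^ ((n : ℝ) + s * p) := by positivity
  rw [integral_eq_lintegral_of_nonneg_ae h0 hm, lintegral_sliceKernel hsp hr, ENNReal.toReal_mul,
    ENNReal.toReal_ofReal (sliceConst_pos hsp).le, ENNReal.toReal_ofReal h1]

end cylinder

/-! ### Duality, and one null set of times for all test functions -/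

lemma memLp_ofReal_iff {α : Type*} {m : MeasurableSpace α} {μ : Measure α} {p : ℝ} (hp : 0 < p)
    {f : α → ℝ} (hf : AEStronglyMeasurable f μ) :
    MemLp f (ENNReal.ofReal p) μ ↔ ∫⁻ x, ENNReal.ofReal (|f x| ^ p) ∂μ < ⊤ := by
  have h0 : ENNReal.ofReal p ≠ 0 := by simpa using hp
  rw [MemLp, and_iff_right hf, eLpNorm_lt_top_iff_lintegral_rpow_enorm_lt_top h0
    ENNReal.ofReal_ne_top, ENNReal.toReal_ofReal hp.le]
  simp_rw [Real.enorm_eq_ofReal_abs, ENNReal.ofReal_rpow_of_nonneg (abs_nonneg _) hp.le]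

lemma MeasureTheory.MemLp.integrable_abs_rpow {α : Type*} {m : MeasurableSpace α} {μ : Measure α}
    {p : ℝ} (hp : 0 < p) {f : α → ℝ} (hf : MemLp f (ENNReal.ofReal p) μ) :
    Integrable (fun x => |f x| ^ p) μ := by
  have := hf.integrable_norm_rpow (by simpa using hp) ENNReal.ofReal_ne_top
  simpa [ENNReal.toReal_ofReal hp.le] using this

lemma holderConjugate_ofReal {p : ℝ} (hp : 1 < p) :
    ENNReal.HolderConjugate (ENNReal.ofReal p) (ENNReal.ofReal (p / (p - 1))) :=
  (Real.HolderConjugate.conjExponent hp).ennrealOfReal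

lemma one_lt_conj {p : ℝ} (hp : 2 < p) : 1 < p / (p - 1) := by
  rw [one_lt_div (by linarith)]
  linarith

lemma conj_lt_two {p : ℝ} (hp : 2 < p) : p / (p - 1) < 2 := by
  rw [div_lt_iff₀ (by linarith)]
  linarith

lemma MeasureTheory.MemLp.phi {α : Type*} {m : MeasurableSpace α} {μ : Measure α} {p : ℝ}
    (hp : 2 < p) {f : α → ℝ} (hf : MemLp f (ENNReal.ofReal p) μ) :
    MemLp (fun x => phi p (f x)) (ENNReal.ofReal (p / (p - 1))) μ := by
  rw [memLp_ofReal_iff (by have := one_lt_conj hp; linarith)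
    ((continuous_phi hp).comp_aestronglyMeasurable hf.1)]
  refine lt_of_eq_of_lt (lintegral_congr fun x => ?_)
    ((memLp_ofReal_iff (by linarith) hf.1).1 hf)
  have h1 : p - 1 ≠ 0 := by linarith
  rw [abs_phi hp, ← Real.rpow_mul (abs_nonneg _), mul_div_cancel₀ _ h1]

lemma integrable_phi_mul {α : Type*} {m : MeasurableSpace α} {μ : Measure α} {p : ℝ}
    (hp : 2 < p) {f g : α → ℝ} (hf : MemLp f (ENNReal.ofReal p) μ)
    (hg : MemLp g (ENNReal.ofReal p) μ) : Integrable (fun x => phi p (f x) * g x) μ := by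
  have := (holderConjugate_ofReal (show 1 < p by linarith)).symm
  exact (hf.phi hp).integrable_mul hg

lemma MemW0.memLp_pairDiff {d : ℕ} {s p : ℝ} (hp : 0 < p) {Ω : Set (E d)} {u : E d → ℝ}
    (hu : MemW0 s p Ω u) : MemLp (pairDiff u) (ENNReal.ofReal p) (gagliardoMeasure d s p) := by
  rw [memLp_ofReal_iff hp (aestronglyMeasurable_pairDiff hu.memLp.1), ← gagliardoPow_eq]
  exact hu.gagliardo_lt_top

lemma memW0_of_memLp {d : ℕ} {s p : ℝ} (hp : 0 < p) {Ω : Set (E d)} {u : E d → ℝ}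
    (hu : MemLp u (ENNReal.ofReal p) volume)
    (hu' : MemLp (pairDiff u) (ENNReal.ofReal p) (gagliardoMeasure d s p))
    (h0 : ∀ᵐ x : E d, x ∉ Ω → u x = 0) : MemW0 s p Ω u := by
  refine ⟨hu, ?_, h0⟩
  rw [gagliardoPow_eq]
  exact (memLp_ofReal_iff hp hu'.1).1 hu'

/-- A bounded functional in the test function which vanishes on each `v` for almost every time
vanishes on all `v` simultaneously for almost every time. -/
lemma ae_forall_memW0_of_forall_ae {d : ℕ} {s p : ℝ} (hp : 2 < p) {Ω : Set (E d)}
    (hΩ : MeasurableSet Ω) (hΩfin : volume Ω < ⊤) {τ : Measure ℝ} {u g : ℝ → E d → ℝ}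
    {f : ℝ → E d → ℝ}
    (hu : ∀ᵐ t ∂τ, MemW0 s p Ω (u t)) (hg : ∀ t, MemLp (g t) 2 volume)
    (hf : ∀ᵐ t ∂τ, MemLp (f t) 2 (volume.restrict Ω))
    (h : ∀ v : E d → ℝ, MemW0 s p Ω v → ∀ᵐ t ∂τ,
      (∫ x in Ω, g t x * v x) + fracForm s p (u t) v = ∫ x in Ω, f t x * v x) :
    ∀ᵐ t ∂τ, ∀ v : E d → ℝ, MemW0 s p Ω v →
      (∫ x in Ω, g t x * v x) + fracForm s p (u t) v = ∫ x in Ω, f t x * v x := by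
  have hp0 : 0 < p := by linarith
  have hP : Fact (1 ≤ ENNReal.ofReal p) := ⟨by
    rw [← ENNReal.ofReal_one]; exact ENNReal.ofReal_le_ofReal (by linarith)⟩
  have hQ : Fact (1 ≤ ENNReal.ofReal (p / (p - 1))) := ⟨by
    rw [← ENNReal.ofReal_one]; exact ENNReal.ofReal_le_ofReal (one_lt_conj hp).le⟩
  have hPt : Fact (ENNReal.ofReal p ≠ ∞) := ⟨ENNReal.ofReal_ne_top⟩
  have hconj := (holderConjugate_ofReal (show 1 < p by linarith)).symm
  set μ := gagliardoMeasure d s p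
  have hμ : SecondCountableTopology (Lp ℝ (ENNReal.ofReal p) μ) := inferInstance
  let X := Lp ℝ (ENNReal.ofReal p) (volume : Measure (E d)) × Lp ℝ (ENNReal.ofReal p) μ
  have hXsep : TopologicalSpace.SeparableSpace X := inferInstanceAs (TopologicalSpace.SeparableSpace
    (Lp ℝ (ENNReal.ofReal p) (volume : Measure (E d)) × Lp ℝ (ENNReal.ofReal p) μ))
  -- The map v ↦ (v, Dv) embeds W₀^{s,p}(Ω) into a separable product of L^p spaces, which provides a
  -- countable dense family of test functions.
  let S : Set X := {x | ∃ v : E d → ℝ, MemW0 s p Ω v ∧ x.1 =ᵐ[volume] v ∧ x.2 =ᵐ[μ] pairDiff v}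
  have hS : TopologicalSpace.IsSeparable S := TopologicalSpace.IsSeparable.of_separableSpace S
  obtain ⟨c, hcS, hcc, hSc⟩ := hS.exists_countable_dense_subset
  -- Each point of `c` is an a.e. class; the identity is obtained for all its representatives, so
  -- that none has to be selected.
  have hc : ∀ᵐ t ∂τ, ∀ x ∈ c, ∀ v : E d → ℝ, MemW0 s p Ω v → x.1 =ᵐ[volume] v →
      (∫ x in Ω, g t x * v x) + fracForm s p (u t) v = ∫ x in Ω, f t x * v x := by
    rw [ae_ball_iff hcc]
    intro x hx
    obtain ⟨v, hv, hv1, hv2⟩ := hcS hx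
    filter_upwards [h v hv] with t ht w hw hw1
    have hvw : v =ᵐ[volume] w := hv1.symm.trans hw1
    have e1 : ∀ k : E d → ℝ, ∫ x in Ω, k x * w x = ∫ x in Ω, k x * v x := fun k => by
      refine integral_congr_ae (ae_restrict_of_ae ?_)
      filter_upwards [hvw] with y hy
      rw [hy]
    have e2 : fracForm s p (u t) w = fracForm s p (u t) v := by
      rw [fracForm_eq, fracForm_eq]
      congr 1
      refine integral_congr_ae (gagliardoMeasure_absolutelyContinuous.ae_le ?_)
      have h1 := Measure.quasiMeasurePreserving_fst (μ := (volume : Measure (E d)))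
        (ν := (volume : Measure (E d))) |>.ae_eq_comp hvw
      have h2 := Measure.quasiMeasurePreserving_snd (μ := (volume : Measure (E d)))
        (ν := (volume : Measure (E d))) |>.ae_eq_comp hvw
      filter_upwards [h1, h2] with z hz1 hz2
      simp only [Function.comp_apply] at hz1 hz2
      simp only [pairDiff, hz1, hz2]
    rw [e1, e1, e2, ht]
  filter_upwards [hu, hf, hc] with t htu htf htc
  have hfin : IsFiniteMeasure (volume.restrict Ω) := ⟨by simpa using hΩfin⟩
  have hle : ENNReal.ofReal (p / (p - 1)) ≤ 2 := by
    rw [← ENNReal.ofReal_ofNat 2]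
    exact ENNReal.ofReal_le_ofReal (conj_lt_two hp).le
  have hgf : MemLp (fun x => g t x - f t x) (ENNReal.ofReal (p / (p - 1))) (volume.restrict Ω) := by
    exact MemLp.mono_exponent (((hg t).restrict Ω).sub htf) hle
  have hh : MemLp (Ω.indicator fun x => g t x - f t x) (ENNReal.ofReal (p / (p - 1))) volume :=
    (memLp_indicator_iff_restrict hΩ).2 hgf
  have hφ := (htu.memLp_pairDiff hp0).phi hp
  let B := ContinuousLinearMap.mul ℝ ℝ
  -- The defect of the identity as a continuous functional on the whole product: g − f lies in
  -- L^{p'}(Ω) because p' < 2 and Ω has finite measure, and φ_p(Du) lies in L^{p'} of the Gagliardo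
  -- measure. Vanishing on `c` then extends to its closure.
  let Λ : X → ℝ := fun x =>
    B.lpPairing volume (ENNReal.ofReal (p / (p - 1))) (ENNReal.ofReal p) (hh.toLp _) x.1 +
      fracConst d s p / 2 *
        B.lpPairing μ (ENNReal.ofReal (p / (p - 1))) (ENNReal.ofReal p) (hφ.toLp _) x.2
  have hΛ : Continuous Λ := by
    refine Continuous.add ?_ (continuous_const.mul ?_)
    · exact (ContinuousLinearMap.continuous _).comp continuous_fst
    · exact (ContinuousLinearMap.continuous _).comp continuous_snd
  have hΛeq : ∀ (x : X) (v : E d → ℝ), MemW0 s p Ω v → x.1 =ᵐ[volume] v → x.2 =ᵐ[μ] pairDiff v →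
      Λ x = (∫ x in Ω, g t x * v x) + fracForm s p (u t) v - ∫ x in Ω, f t x * v x := by
    intro x v hv h1 h2
    have i1 : Integrable (fun x => g t x * v x) (volume.restrict Ω) :=
      (((hg t).restrict Ω).mono_exponent hle).integrable_mul (hv.memLp.restrict Ω)
    have i2 : Integrable (fun x => f t x * v x) (volume.restrict Ω) :=
      (htf.mono_exponent hle).integrable_mul (hv.memLp.restrict Ω)
    simp only [Λ, B, ContinuousLinearMap.lpPairing_eq_integral, ContinuousLinearMap.mul_apply']
    have e1 : ∫ y, (hh.toLp _ : E d → ℝ) y * x.1 y =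
        (∫ x in Ω, g t x * v x) - ∫ x in Ω, f t x * v x := by
      rw [← integral_sub i1 i2, ← integral_indicator hΩ]
      refine integral_congr_ae ?_
      filter_upwards [hh.coeFn_toLp, h1] with y hy1 hy2
      rw [hy1, hy2]
      by_cases hy : y ∈ Ω <;> simp [hy, sub_mul]
    have e2 : ∫ z, (hφ.toLp _ : E d × E d → ℝ) z * x.2 z ∂μ = ∫ z, phi p (pairDiff (u t) z) * pairDiff v z ∂μ := by
      refine integral_congr_ae ?_
      filter_upwards [hφ.coeFn_toLp, h2] with y hy1 hy2
      rw [hy1, hy2]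
    rw [e1, e2, fracForm_eq]
    ring
  have hzero : ∀ x ∈ c, Λ x = 0 := by
    intro x hx
    obtain ⟨v, hv, hv1, hv2⟩ := hcS hx
    rw [hΛeq x v hv hv1 hv2, htc x hx v hv hv1, sub_self]
  intro v hv
  let x : X := (hv.memLp.toLp v, (hv.memLp_pairDiff hp0).toLp _)
  have hxS : x ∈ S := ⟨v, hv, hv.memLp.coeFn_toLp, (hv.memLp_pairDiff hp0).coeFn_toLp⟩
  have hx0 : Λ x = 0 := by
    have : closure c ⊆ {x | Λ x = 0} :=
      closure_minimal hzero (isClosed_eq hΛ continuous_const)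
    exact this (hSc hxS)
  rw [hΛeq x v hv hv.memLp.coeFn_toLp (hv.memLp_pairDiff hp0).coeFn_toLp] at hx0
  linarith

/-! ### Weak solutions: derivative, support, energy estimate -/

/-- Transfers closed conditions from almost every time to every time of [0, T], endpoints included,
along a continuous curve. -/
lemma Icc_subset_closure_of_ae {T : ℝ} (hT : 0 < T) {P : ℝ → Prop}
    (h : ∀ᵐ t ∂(volume.restrict (Ioo 0 T)), P t) :
    Icc 0 T ⊆ closure {t | t ∈ Ioo 0 T ∧ P t} := by
  rw [ae_restrict_iff' measurableSet_Ioo] at h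
  have hd : Dense {t | t ∈ Ioo 0 T → P t} := Measure.dense_of_ae h
  have h1 := hd.open_subset_closure_inter (isOpen_Ioo (a := 0) (b := T))
  rw [← closure_Ioo hT.ne]
  refine closure_minimal (h1.trans (closure_mono ?_)) isClosed_closure
  rintro t ⟨ht, ht'⟩
  exact ⟨ht, ht' ht⟩

/-- The set is the kernel of the continuous restriction map to L² of the complement of Ω. -/
lemma isClosed_zero_outside {d : ℕ} {Ω : Set (E d)} (hΩ : MeasurableSet Ω) :
    IsClosed {w : L2 d | ∀ᵐ x, x ∉ Ω → w x = 0} := by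
  have h : {w : L2 d | ∀ᵐ x, x ∉ Ω → w x = 0} =
      {w | LpToLpRestrictCLM (E d) ℝ ℝ volume 2 Ωᶜ w = 0} := by
    ext w
    change (∀ᵐ x, x ∉ Ω → w x = 0) ↔ LpToLpRestrictCLM (E d) ℝ ℝ volume 2 Ωᶜ w = 0
    rw [Lp.eq_zero_iff_ae_eq_zero]
    have h1 := LpToLpRestrictCLM_coeFn ℝ Ωᶜ w
    have h2 : (∀ᵐ x, x ∉ Ω → w x = 0) ↔ w =ᵐ[volume.restrict Ωᶜ] 0 :=
      (ae_restrict_iff' hΩ.compl).symm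
    rw [h2]
    exact ⟨fun h => h1.trans h, fun h => h1.symm.trans h⟩
  rw [h]
  exact isClosed_eq (ContinuousLinearMap.continuous _) continuous_const

lemma setIntegral_eq_integral_of_zero_outside {d : ℕ} {Ω : Set (E d)} {k v : E d → ℝ}
    (hv : ∀ᵐ x, x ∉ Ω → v x = 0) : ∫ x in Ω, k x * v x = ∫ x, k x * v x := by
  refine setIntegral_eq_integral_of_ae_compl_eq_zero ?_
  filter_upwards [hv] with x hx hxΩ
  rw [hx hxΩ, mul_zero]

lemma inner_L2_eq_integral {α : Type*} {m : MeasurableSpace α} {μ : Measure α} (f g : Lp ℝ 2 μ) :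
    inner ℝ f g = ∫ x, g x * f x ∂μ := by
  rw [L2.inner_def]
  rfl

lemma abs_integral_mul_le_of_eLpNorm_le {α : Type*} {m : MeasurableSpace α} {μ : Measure α}
    {f g : α → ℝ} (hf : MemLp f 2 μ) (hg : MemLp g 2 μ) {a b : ℝ} (ha : 0 ≤ a) (hb : 0 ≤ b)
    (hfa : eLpNorm f 2 μ ≤ ENNReal.ofReal a) (hgb : eLpNorm g 2 μ ≤ ENNReal.ofReal b) :
    |∫ x, f x * g x ∂μ| ≤ a * b := by
  have e : ∫ x, f x * g x ∂μ = inner ℝ (hg.toLp g) (hf.toLp f) := by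
    rw [inner_L2_eq_integral]
    refine integral_congr_ae ?_
    filter_upwards [hf.coeFn_toLp, hg.coeFn_toLp] with x h1 h2
    rw [h1, h2]
  rw [e, mul_comm]
  refine (abs_real_inner_le_norm _ _).trans ?_
  rw [Lp.norm_toLp, Lp.norm_toLp]
  exact mul_le_mul (ENNReal.toReal_le_of_le_ofReal hb hgb) (ENNReal.toReal_le_of_le_ofReal ha hfa)
    ENNReal.toReal_nonneg hb

section weak

variable {d : ℕ} {s p T : ℝ} {Ω : Set (E d)} {f : ℝ → E d → ℝ} {u₀ : E d → ℝ} {u : ℝ → L2 d}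

/-- The time derivative of a weak solution, with the identity holding at almost every time for all
test functions simultaneously. -/
lemma IsWeakSolution.exists_deriv (hp : 2 < p) (hΩ : MeasurableSet Ω)
    (hΩfin : volume Ω < ⊤) (hT : 0 < T)
    (hf : ∀ᵐ t ∂(volume.restrict (Ioo 0 T)), MemLp (f t) 2 (volume.restrict Ω))
    (hu : IsWeakSolution s p T Ω f u₀ u) :
    ∃ g : ℝ → L2 d,
      (∀ a b, 0 < a → a ≤ b → b ≤ T → IntervalIntegrable g volume a b ∧
        u b = u a + ∫ r in a..b, g r) ∧
      ∀ᵐ t ∂(volume.restrict (Ioo 0 T)), MemW0 s p Ω (u t) ∧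
        ∀ v : E d → ℝ, MemW0 s p Ω v →
          (∫ x, g t x * v x) + fracForm s p (u t) v = ∫ x, Ω.indicator (f t) x * v x := by
  obtain ⟨-, -, g, hpar, heq⟩ := hu
  have hgint : ∀ a b, 0 < a → a ≤ b → b ≤ T → IntervalIntegrable g volume a b := by
    intro a b ha hab hb
    rcases hab.eq_or_lt with rfl | hab'
    · exact IntervalIntegrable.refl
    · have h1 := (hpar a ⟨ha, hab'.trans_le hb⟩).deriv_memLp.integrable one_le_two
      rw [intervalIntegrable_iff_integrableOn_Ioo_of_le hab]
      exact IntegrableOn.mono_set h1 (Ioo_subset_Ioo_right hb)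
  have hmem : ∀ᵐ t ∂(volume.restrict (Ioo 0 T)), MemW0 s p Ω (u t) := by
    -- The denominator k + 2 keeps every left endpoint strictly between 0 and T.
    have hU : Ioo 0 T ⊆ ⋃ k : ℕ, Ioo (T / (k + 2)) T := by
      rintro t ⟨h0, h1⟩
      obtain ⟨k, hk⟩ := exists_nat_gt (T / t)
      refine mem_iUnion.2 ⟨k, ?_, h1⟩
      rw [div_lt_iff₀ h0] at hk
      rw [div_lt_iff₀ (by positivity)]
      nlinarith
    refine ae_mono (Measure.restrict_mono hU le_rfl) ((ae_restrict_iUnion_iff _ _).2 fun k => ?_)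
    have hk : T / ((k : ℝ) + 2) ∈ Ioo 0 T := by
      have : (0 : ℝ) ≤ k := k.cast_nonneg
      refine ⟨by positivity, ?_⟩
      rw [div_lt_iff₀ (by positivity)]
      nlinarith
    obtain ⟨M, hM⟩ := (hpar _ hk).bounded
    filter_upwards [hM] with t ht using ht.1
  refine ⟨g, fun a b ha hab hb => ⟨hgint a b ha hab hb, ?_⟩, ?_⟩
  · rcases hab.eq_or_lt with rfl | hab'
    · simp
    · exact (hpar a ⟨ha, hab'.trans_le hb⟩).eq_integral b ⟨hab, hb⟩
  · have := ae_forall_memW0_of_forall_ae hp hΩ hΩfin hmem (fun t => Lp.memLp (g t)) hf heq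
    filter_upwards [hmem, this] with t ht1 ht2
    refine ⟨ht1, fun v hv => ?_⟩
    have h := ht2 v hv
    rw [setIntegral_eq_integral_of_zero_outside hv.zero_outside] at h
    rw [h, ← integral_indicator hΩ]
    refine integral_congr_ae (Eventually.of_forall fun x => ?_)
    by_cases hx : x ∈ Ω <;> simp [hx]

/-- Membership in W₀^{s,p}(Ω) is known only for almost every t, but vanishing outside Ω is closed in
L² and u is continuous into L². Time 0 is needed as well: the initial condition concerns Ω only. -/
lemma IsWeakSolution.zero_outside (hΩ : MeasurableSet Ω) (hT : 0 < T)
    (hu : IsWeakSolution s p T Ω f u₀ u)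
    (hmem : ∀ᵐ t ∂(volume.restrict (Ioo 0 T)), MemW0 s p Ω (u t)) :
    ∀ t ∈ Icc 0 T, ∀ᵐ x, x ∉ Ω → u t x = 0 := by
  intro t ht
  have h1 := Icc_subset_closure_of_ae hT hmem
  have h2 : ContinuousWithinAt u {t | t ∈ Ioo 0 T ∧ MemW0 s p Ω (u t)} t :=
    (hu.1 t ht).mono fun r hr => Ioo_subset_Icc_self hr.1
  have h3 := h2.mem_closure (h1 ht) (t := {w : L2 d | ∀ᵐ x, x ∉ Ω → w x = 0})
    (fun r hr => hr.2.zero_outside)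
  rwa [(isClosed_zero_outside hΩ).closure_eq] at h3

lemma tendsto_nhdsWithin_Ioi_of_continuousOn_Icc {X : Type*} [TopologicalSpace X] {w : ℝ → X}
    (hT : 0 < T) (hw : ContinuousOn w (Icc 0 T)) : Tendsto w (𝓝[>] 0) (𝓝 (w 0)) := by
  have h := (hw 0 ⟨le_rfl, hT.le⟩).mono (Ioo_subset_Icc_self)
  rwa [ContinuousWithinAt, nhdsWithin_Ioo_eq_nhdsGT hT] at h

/-- The energy estimate for weak solutions. -/
lemma IsWeakSolution.exists_energy_bound (hp : 2 < p) (hs : 0 < s) (hs1 : s < 1)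
    (hΩ : MeasurableSet Ω) (hΩfin : volume Ω < ⊤) (hT : 0 < T) {F : ℝ → ℝ} (hF0 : ∀ t, 0 ≤ F t)
    (hF : IntegrableOn F (Ioo 0 T))
    (hf : ∀ᵐ t ∂(volume.restrict (Ioo 0 T)), MemLp (f t) 2 (volume.restrict Ω) ∧
      eLpNorm (f t) 2 (volume.restrict Ω) ≤ ENNReal.ofReal (F t))
    {A : ℝ} (hA : 0 ≤ A) (hu₀ : eLpNorm u₀ 2 (volume.restrict Ω) ≤ ENNReal.ofReal A)
    (hu : IsWeakSolution s p T Ω f u₀ u) :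
    ∃ e : ℝ → ℝ,
      (∀ᵐ t ∂(volume.restrict (Ioo 0 T)), 0 ≤ e t ∧
        gagliardoPow s p (u t) ≤ ENNReal.ofReal (e t)) ∧
      ∀ a, 0 < a → a ≤ T → IntervalIntegrable e volume a T ∧
        ∫ t in a..T, e t ≤ 2 / fracConst d s p * (A + 2 * ∫ t in Ioo 0 T, F t) ^ 2 := by
  obtain ⟨g, hg, hae⟩ := hu.exists_deriv hp hΩ hΩfin hT (hf.mono fun t ht => ht.1)
  have hC : 0 < fracConst d s p := fracConst_pos hs hs1 (by linarith)
  have hp0 : 0 < p := by linarith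
  set B := ∫ t in Ioo 0 T, F t with hB
  have hB0 : 0 ≤ B := integral_nonneg hF0
  have hmem := hae.mono fun t ht => ht.1
  have hcont := hu.1
  -- The maximum S of ‖u(t)‖ bounds the work of the source by S F(t); S is then estimated from the
  -- inequality it produces.
  obtain ⟨tm, htm, hmax⟩ := isCompact_Icc.exists_isMaxOn (nonempty_Icc.2 hT.le) hcont.norm
  set S := ‖u tm‖ with hS
  have hS0 : 0 ≤ S := norm_nonneg _
  have hle : ∀ t ∈ Icc 0 T, ‖u t‖ ≤ S := fun t ht => hmax ht
  -- the pointwise energy inequality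
  have hpt : ∀ᵐ t ∂(volume.restrict (Ioo 0 T)), MemW0 s p Ω (u t) ∧
      fracConst d s p / 2 * (gagliardoPow s p (u t)).toReal ≤
        S * F t - inner ℝ (u t) (g t) := by
    filter_upwards [hae, hf, ae_restrict_mem measurableSet_Ioo] with t ht hft htT
    refine ⟨ht.1, ?_⟩
    have h1 := ht.2 (u t) ht.1
    have h2 : fracForm s p (u t) (u t) =
        fracConst d s p / 2 * (gagliardoPow s p (u t)).toReal := by
      rw [fracForm_eq, gagliardoPow_eq]
      congr 1
      rw [← integral_toReal]
      · refine integral_congr_ae (Eventually.of_forall fun z => ?_)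
        simp only
        rw [phi_mul_self hp, ENNReal.toReal_ofReal (by positivity)]
      · exact ((ht.1.memLp_pairDiff hp0).integrable_abs_rpow hp0).1.aemeasurable.ennreal_ofReal
      · exact Eventually.of_forall fun _ => ENNReal.ofReal_lt_top
    have h3 : ∫ x, Ω.indicator (f t) x * u t x = ∫ x in Ω, f t x * u t x := by
      rw [← integral_indicator hΩ]
      refine integral_congr_ae (Eventually.of_forall fun x => ?_)
      by_cases hx : x ∈ Ω <;> simp [hx]
    have h4 : |∫ x in Ω, f t x * u t x| ≤ F t * S := by
      refine abs_integral_mul_le_of_eLpNorm_le hft.1 ((Lp.memLp (u t)).restrict Ω) (hF0 t) hS0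
        hft.2 ((eLpNorm_mono_measure _ Measure.restrict_le_self).trans ?_)
      rw [← ENNReal.ofReal_toReal (Lp.eLpNorm_ne_top (u t)), ← Lp.norm_def]
      exact ENNReal.ofReal_le_ofReal (hle t (Ioo_subset_Icc_self htT))
    have h5 : inner ℝ (u t) (g t) = ∫ x, g t x * u t x := inner_L2_eq_integral _ _
    rw [h2, h3, ← h5] at h1
    have := le_of_abs_le h4
    linarith
  have hFint : ∀ a b, 0 ≤ a → a ≤ b → b ≤ T → IntervalIntegrable F volume a b := by
    intro a b ha hab hb
    rw [intervalIntegrable_iff_integrableOn_Ioo_of_le hab]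
    exact hF.mono_set (Ioo_subset_Ioo ha hb)
  have hFB : ∀ a b, 0 ≤ a → a ≤ b → b ≤ T → ∫ t in a..b, F t ≤ B := by
    intro a b ha hab hb
    rw [intervalIntegral.integral_of_le hab, integral_Ioc_eq_integral_Ioo]
    exact setIntegral_mono_set hF (Eventually.of_forall hF0)
      (Ioo_subset_Ioo ha hb).eventuallyLE
  have hchain : ∀ a b, 0 < a → a ≤ b → b ≤ T →
      IntervalIntegrable (fun t => S * F t - inner ℝ (u t) (g t)) volume a b ∧
      ∫ t in a..b, (S * F t - inner ℝ (u t) (g t)) =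
        S * (∫ t in a..b, F t) - (‖u b‖ ^ 2 - ‖u a‖ ^ 2) / 2 := by
    intro a b ha hab hb
    obtain ⟨h1, h2⟩ := norm_sq_sub_norm_sq_eq_integral hab (hg a b ha hab hb).1
      (fun t ht => (hg a t ha ht.1 (ht.2.trans hb)).2)
    have h3 : IntervalIntegrable (fun t => inner ℝ (u t) (g t)) volume a b := by
      simpa using h1.const_mul (1 / 2)
    have h4 := (hFint a b ha.le hab hb).const_mul S
    refine ⟨h4.sub h3, ?_⟩
    rw [intervalIntegral.integral_sub h4 h3, intervalIntegral.integral_const_mul, h2,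
      intervalIntegral.integral_const_mul]
    ring
  have hnonneg : ∀ a b, 0 < a → a ≤ b → b ≤ T →
      0 ≤ ∫ t in a..b, (S * F t - inner ℝ (u t) (g t)) := by
    intro a b ha hab hb
    rw [intervalIntegral.integral_of_le hab, integral_Ioc_eq_integral_Ioo]
    refine integral_nonneg_of_ae ?_
    filter_upwards [ae_mono (Measure.restrict_mono (Ioo_subset_Ioo ha.le hb) le_rfl) hpt] with t ht
    exact le_trans (by positivity) ht.2
  have hu0 : ‖u 0‖ ≤ A := by
    have hz := hu.zero_outside hΩ hT hmem 0 ⟨le_rfl, hT.le⟩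
    have h1 : eLpNorm (u 0) 2 volume ≤ ENNReal.ofReal A := by
      have e1 : u 0 =ᵐ[volume] Ω.indicator (u 0) := by
        filter_upwards [hz] with x hx
        by_cases hxΩ : x ∈ Ω
        · simp [hxΩ]
        · simp [hxΩ, hx hxΩ]
      rw [eLpNorm_congr_ae e1, eLpNorm_indicator_eq_eLpNorm_restrict hΩ,
        eLpNorm_congr_ae hu.2.1]
      exact hu₀
    rw [Lp.norm_def]
    exact ENNReal.toReal_le_of_le_ofReal hA h1
  -- Integration runs from a > 0 to the maximizing time, since integrability of the derivative is
  -- known only away from 0; continuity into L² gives the limit a → 0.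
  have hSsq : S ^ 2 ≤ A ^ 2 + 2 * S * B := by
    rcases htm.1.eq_or_lt with h0 | h0
    · have : S ≤ A := by rw [hS, ← h0]; exact hu0
      nlinarith
    · have hlim : Tendsto (fun a => ‖u a‖ ^ 2 + 2 * S * B) (𝓝[>] 0)
          (𝓝 (‖u 0‖ ^ 2 + 2 * S * B)) :=
        ((tendsto_nhdsWithin_Ioi_of_continuousOn_Icc hT hcont).norm.pow 2).add_const _
      have hev : ∀ᶠ a in 𝓝[>] (0 : ℝ), S ^ 2 ≤ ‖u a‖ ^ 2 + 2 * S * B := by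
        filter_upwards [Ioo_mem_nhdsGT h0] with a ha
        have h1 := hnonneg a tm ha.1 ha.2.le htm.2
        rw [(hchain a tm ha.1 ha.2.le htm.2).2] at h1
        have h2 := mul_le_mul_of_nonneg_left (hFB a tm ha.1.le ha.2.le htm.2) hS0
        linarith
      have := ge_of_tendsto hlim hev
      have h3 : ‖u 0‖ ^ 2 ≤ A ^ 2 := pow_le_pow_left₀ (norm_nonneg _) hu0 2
      linarith
  have hSAB : S ≤ A + 2 * B := by
    by_contra! hlt
    nlinarith
  -- The majorant is the right side of the pointwise energy inequality, not the energy itself: its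
  -- time integral is explicit, and measurability of t ↦ [u(t)]^p never enters.
  refine ⟨fun t => 2 / fracConst d s p * (S * F t - inner ℝ (u t) (g t)), ?_, ?_⟩
  · filter_upwards [hpt] with t ht
    have h1 : (gagliardoPow s p (u t)).toReal ≤
        2 / fracConst d s p * (S * F t - inner ℝ (u t) (g t)) := by
      rw [div_mul_eq_mul_div, le_div_iff₀ hC]
      linarith [ht.2]
    refine ⟨ENNReal.toReal_nonneg.trans h1, ?_⟩
    rw [← ENNReal.ofReal_toReal ht.1.gagliardo_lt_top.ne]
    exact ENNReal.ofReal_le_ofReal h1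
  · intro a ha haT
    obtain ⟨h1, h2⟩ := hchain a T ha haT le_rfl
    refine ⟨h1.const_mul _, ?_⟩
    rw [intervalIntegral.integral_const_mul, h2]
    refine mul_le_mul_of_nonneg_left ?_ (by positivity)
    have h3 := mul_le_mul_of_nonneg_left (hFB a T ha.le haT le_rfl) hS0
    have h4 : ‖u a‖ ^ 2 ≤ S ^ 2 := pow_le_pow_left₀ (norm_nonneg _) (hle a ⟨ha.le, haT⟩) 2
    have h5 : 0 ≤ ‖u T‖ ^ 2 := by positivity
    nlinarith
end weak

/-! ### Functions of the cross-section over a slab -/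

/-- The formula for the kernel integrated along the axis requires |X − Y| > 0, so the diagonal has
to be negligible. -/
lemma ae_prod_fst_ne_snd {n : ℕ} (hn : 1 ≤ n) : ∀ᵐ w : E n × E n, w.1 ≠ w.2 := by
  have : Nontrivial (E n) := by
    have : Nonempty (Fin n) := ⟨⟨0, hn⟩⟩
    infer_instance
  have hm : MeasurableSet {w : E n × E n | w.1 = w.2} :=
    measurableSet_eq_fun measurable_fst measurable_snd
  rw [ae_iff]
  simp only [ne_eq, not_not]
  rw [Measure.volume_eq_prod, Measure.measure_prod_null hm]
  refine Eventually.of_forall fun x => ?_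
  change volume (Prod.mk x ⁻¹' {w : E n × E n | w.1 = w.2}) = 0
  have : Prod.mk x ⁻¹' {w : E n × E n | w.1 = w.2} = {x} := by
    ext y
    simp [eq_comm]
  rw [this]
  simp

/-- Jensen's inequality for a function supported in a set of bounded measure. -/
lemma ofReal_abs_integral_rpow_le {α : Type*} {m : MeasurableSpace α} {μ : Measure α} {p : ℝ}
    (hp : 1 < p) {f : α → ℝ} (hf : AEStronglyMeasurable f μ) {S : Set α} (hS : MeasurableSet S)
    (hfS : ∀ x ∉ S, f x = 0) :
    ENNReal.ofReal (|∫ x, f x ∂μ| ^ p) ≤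
      μ S ^ (p - 1) * ∫⁻ x, ENNReal.ofReal (|f x| ^ p) ∂μ := by
  have hp0 : 0 < p := by linarith
  have hpq := Real.HolderConjugate.conjExponent hp
  have h1 : ENNReal.ofReal |∫ x, f x ∂μ| ≤ ∫⁻ x, ENNReal.ofReal |f x| ∂μ := by
    have := enorm_integral_le_lintegral_enorm (μ := μ) f
    simpa only [Real.enorm_eq_ofReal_abs] using this
  have hm : AEMeasurable (fun x => ENNReal.ofReal |f x|) μ :=
    (continuous_abs.comp_aestronglyMeasurable hf).aemeasurable.ennreal_ofReal
  have h2 : ∫⁻ x, ENNReal.ofReal |f x| ∂μ ≤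
      (∫⁻ x, ENNReal.ofReal |f x| ^ p ∂μ) ^ (1 / p) *
        (∫⁻ x, S.indicator 1 x ^ (Real.conjExponent p) ∂μ) ^ (1 / Real.conjExponent p) := by
    refine le_trans (le_of_eq (lintegral_congr fun x => ?_))
      (ENNReal.lintegral_mul_le_Lp_mul_Lq μ hpq hm
        (measurable_one.indicator hS).aemeasurable)
    by_cases hx : x ∈ S <;> simp [hx, hfS x]
  have h3 : ∫⁻ x, S.indicator (1 : α → ℝ≥0∞) x ^ (Real.conjExponent p) ∂μ = μ S := by
    rw [← lintegral_indicator_one hS]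
    refine lintegral_congr fun x => ?_
    by_cases hx : x ∈ S
    · simp [hx]
    · simp [hx, hpq.symm.pos]
  rw [h3] at h2
  have h4 := ENNReal.rpow_le_rpow (h1.trans h2) hp0.le
  rw [ENNReal.mul_rpow_of_nonneg _ _ hp0.le, ← ENNReal.rpow_mul, ← ENNReal.rpow_mul,
    one_div_mul_cancel hp0.ne', ENNReal.rpow_one,
    ENNReal.ofReal_rpow_of_nonneg (abs_nonneg _) hp0.le,
    show 1 / Real.conjExponent p * p = p - 1 by
      unfold Real.conjExponent
      have : p - 1 ≠ 0 := by linarith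
      field_simp] at h4
  rw [mul_comm]
  refine h4.trans (le_of_eq ?_)
  congr 1
  refine lintegral_congr fun x => ?_
  rw [ENNReal.ofReal_rpow_of_nonneg (abs_nonneg _) hp0.le]

section slab

variable {n : ℕ} {s p : ℝ}

/-- The slab `(-L, L) × ℝ^n`. -/
def slab (n : ℕ) (L : ℝ) : Set (E (n + 1)) := {x | x 0 ∈ Ioo (-L) L}

lemma measurableSet_slab (L : ℝ) : MeasurableSet (slab n L) :=
  (measurableSet_Ioo (a := -L) (b := L)).preimage
    (by fun_prop : Measurable fun x : E (n + 1) => x 0)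

lemma quasiMeasurePreserving_prodMap_crossVar : Measure.QuasiMeasurePreserving
    (fun z : E (n + 1) × E (n + 1) => (crossVar z.1, crossVar z.2)) volume volume :=
  MeasureTheory.QuasiMeasurePreserving.prodMap quasiMeasurePreserving_crossVar
    quasiMeasurePreserving_crossVar

/-- The Gagliardo energy of a function of the cross-section over a slab. -/
lemma lintegral_slab_crossVar (hn : 1 ≤ n) (hsp : 0 < s * p) {L : ℝ} {G : E n × E n → ℝ≥0∞}
    (hG : AEMeasurable G volume) :
    ∫⁻ z, (slab n L).indicator 1 z.1 * G (crossVar z.1, crossVar z.2)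
        ∂(gagliardoMeasure (n + 1) s p) =
      ENNReal.ofReal (2 * L) * ENNReal.ofReal (sliceConst n s p) *
        ∫⁻ w, G w ∂(gagliardoMeasure n s p) := by
  have hq : Measure.QuasiMeasurePreserving
      (fun z : E (n + 1) × E (n + 1) => (crossVar z.1, crossVar z.2)) volume volume :=
    quasiMeasurePreserving_prodMap_crossVar
  have hm : AEMeasurable (fun z : E (n + 1) × E (n + 1) =>
      (slab n L).indicator 1 z.1 * G (crossVar z.1, crossVar z.2)) volume :=
    (((measurable_one.indicator (measurableSet_slab L)).comp measurable_fst).aemeasurable).mul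
      (hG.comp_quasiMeasurePreserving hq)
  have hkG : AEMeasurable (fun w : E n × E n =>
      ENNReal.ofReal (1 / ‖w.1 - w.2‖ ^ ((n : ℝ) + s * p)) * G w) volume :=
    (measurable_kernel n s p).aemeasurable.mul hG
  rw [lintegral_gagliardoMeasure_succ hm, lintegral_gagliardoMeasure,
    ← lintegral_const_mul'' _ hkG]
  refine lintegral_congr_ae ?_
  filter_upwards [ae_prod_fst_ne_snd hn] with w hw
  have hr : 0 < ‖w.1 - w.2‖ := norm_pos_iff.2 (sub_ne_zero.2 hw)
  have h1 : ∀ h : ℝ, ∫⁻ a : ℝ, (slab n L).indicator (1 : E (n + 1) → ℝ≥0∞) (consE a w.1) *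
      G (crossVar (consE a w.1), crossVar (consE (a + h) w.2)) =
      ENNReal.ofReal (2 * L) * G w := by
    intro h
    have e : ∀ a : ℝ, (slab n L).indicator (1 : E (n + 1) → ℝ≥0∞) (consE a w.1) *
        G (crossVar (consE a w.1), crossVar (consE (a + h) w.2)) =
        (Ioo (-L) L).indicator (fun _ => G w) a := by
      intro a
      by_cases ha : a ∈ Ioo (-L) L
      · have : consE a w.1 ∈ slab n L := ha
        simp [ha, this]
      · have : consE a w.1 ∉ slab n L := ha
        simp [ha, this]
    simp_rw [e]
    rw [lintegral_indicator_const measurableSet_Ioo, Real.volume_Ioo, mul_comm]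
    congr 2
    ring
  simp_rw [h1]
  rw [lintegral_mul_const'' _
    (Measurable.of_uncurry_right (f := sliceKernel n s p)
      (measurable_sliceKernel n s p)).ennreal_ofReal.aemeasurable,
    lintegral_sliceKernel hsp hr]
  ring

/-- The pairs of points at least one of which lies in the slab. -/
def slabPairs (n : ℕ) (L : ℝ) : Set (E (n + 1) × E (n + 1)) :=
  {z | z.1 ∈ slab n L ∨ z.2 ∈ slab n L}

lemma measurableSet_slabPairs (L : ℝ) : MeasurableSet (slabPairs n L) :=
  ((measurableSet_slab L).preimage measurable_fst).union
    ((measurableSet_slab L).preimage measurable_snd)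

lemma aestronglyMeasurable_comp_crossVar {U : E n → ℝ} (hU : AEStronglyMeasurable U volume) :
    AEStronglyMeasurable (fun x : E (n + 1) => U (crossVar x)) volume :=
  hU.comp_quasiMeasurePreserving quasiMeasurePreserving_crossVar

/-- A pair in the set has its first or its second point in the slab; the two contributions agree by
symmetry of the measure, whence the factor 2. -/
lemma lintegral_slabPairs_crossVar_le (hn : 1 ≤ n) (hsp : 0 < s * p) (hp : 0 < p) {L : ℝ}
    {U : E n → ℝ} (hU : AEStronglyMeasurable U volume) :
    ∫⁻ z, ENNReal.ofReal (|(slabPairs n L).indicator (pairDiff fun x => U (crossVar x)) z| ^ p)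
        ∂(gagliardoMeasure (n + 1) s p) ≤
      2 * (ENNReal.ofReal (2 * L) * ENNReal.ofReal (sliceConst n s p) * gagliardoPow s p U) := by
  have hUm : AEStronglyMeasurable (pairDiff U) volume := hU.comp_fst.sub hU.comp_snd
  set G : E n × E n → ℝ≥0∞ := fun w => ENNReal.ofReal (|pairDiff U w| ^ p) with hGdef
  have hG : AEMeasurable G volume :=
    ((continuous_abs.comp_aestronglyMeasurable hUm).aemeasurable.pow_const p).ennreal_ofReal
  have hq : Measure.QuasiMeasurePreserving
      (fun z : E (n + 1) × E (n + 1) => (crossVar z.1, crossVar z.2)) volume volume :=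
    quasiMeasurePreserving_prodMap_crossVar
  set H : E (n + 1) × E (n + 1) → ℝ≥0∞ := fun z =>
    (slab n L).indicator 1 z.1 * G (crossVar z.1, crossVar z.2) with hH
  have hm : AEMeasurable H (gagliardoMeasure (n + 1) s p) := by
    refine AEMeasurable.mono_ac ?_ gagliardoMeasure_absolutelyContinuous
    exact (((measurable_one.indicator (measurableSet_slab L)).comp measurable_fst).aemeasurable).mul
      (hG.comp_quasiMeasurePreserving hq)
  have hHint := lintegral_slab_crossVar (L := L) hn hsp hG
  rw [← gagliardoPow_eq] at hHint
  rw [two_mul, ← hHint]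
  nth_rewrite 2 [← lintegral_gagliardoMeasure_swap hm]
  rw [← lintegral_add_left' hm]
  refine lintegral_mono fun z => ?_
  simp only [hH, hGdef]
  by_cases hz : z ∈ slabPairs n L
  · rw [indicator_of_mem hz]
    rcases hz with hz | hz
    · refine le_trans (le_of_eq ?_) le_self_add
      simp [hz, pairDiff]
    · refine le_trans (le_of_eq ?_) le_add_self
      simp [hz, pairDiff, abs_sub_comm]
  · rw [indicator_of_notMem hz, abs_zero, Real.zero_rpow hp.ne']
    simp

/-- Stands in for finite energy of U(X₂) on the whole space, which fails in general by invariance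
along the axis. It suffices because the test functions have differences supported on these pairs. -/
lemma memLp_slabPairs_crossVar (hn : 1 ≤ n) (hsp : 0 < s * p) (hp : 0 < p) {L : ℝ}
    {U : E n → ℝ} (hU : AEStronglyMeasurable U volume) (hU' : gagliardoPow s p U < ⊤) :
    MemLp ((slabPairs n L).indicator (pairDiff fun x => U (crossVar x))) (ENNReal.ofReal p)
      (gagliardoMeasure (n + 1) s p) := by
  rw [memLp_ofReal_iff hp ((aestronglyMeasurable_pairDiff
    (aestronglyMeasurable_comp_crossVar hU)).indicator (measurableSet_slabPairs L))]
  refine (lintegral_slabPairs_crossVar_le hn hsp hp hU).trans_lt ?_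
  exact ENNReal.mul_lt_top (by simp) (ENNReal.mul_lt_top
    (ENNReal.mul_lt_top ENNReal.ofReal_lt_top ENNReal.ofReal_lt_top) hU')

end slab

/-! ### Integration along the axis -/

section lineIntegral

variable {n : ℕ} {s p : ℝ}

/-- The integral of `v` along the axis of the cylinder. -/
noncomputable def lineIntegral (v : E (n + 1) → ℝ) (X : E n) : ℝ := ∫ a : ℝ, v (consE a X)

lemma lintegral_cylDomain_comp_crossVar {ω : Set (E n)} (hω : MeasurableSet ω) (L : ℝ)
    {G : E n → ℝ≥0∞} (hG : AEMeasurable G (volume.restrict ω)) :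
    ∫⁻ x in cylDomain ω L, G (crossVar x) = ENNReal.ofReal (2 * L) * ∫⁻ X in ω, G X := by
  have hcyl : MeasurableSet (cylDomain ω L) :=
    (measurableSet_slab L).inter (measurable_crossVar hω)
  have hG' : AEMeasurable (ω.indicator G) volume := (aemeasurable_indicator_iff hω).2 hG
  have e : (cylDomain ω L).indicator (fun x => G (crossVar x)) =
      fun x => (slab n L).indicator 1 x * ω.indicator G (crossVar x) := by
    funext x
    by_cases h1 : x ∈ slab n L
    · by_cases h2 : crossVar x ∈ ω
      · have : x ∈ cylDomain ω L := ⟨h1, h2⟩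
        simp [h1, h2, this]
      · have : x ∉ cylDomain ω L := fun h => h2 h.2
        simp [h2, this]
    · have : x ∉ cylDomain ω L := fun h => h1 h.1
      simp [h1, this]
  have hm : AEMeasurable (fun x : E (n + 1) =>
      (slab n L).indicator 1 x * ω.indicator G (crossVar x)) volume :=
    (measurable_one.indicator (measurableSet_slab L)).aemeasurable.mul
      (hG'.comp_quasiMeasurePreserving quasiMeasurePreserving_crossVar)
  rw [← lintegral_indicator hcyl, ← lintegral_indicator hω, e, lintegral_consE hm,
    ← lintegral_const_mul'' _ hG']
  refine lintegral_congr fun X => ?_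
  have e2 : ∀ a : ℝ, (slab n L).indicator (1 : E (n + 1) → ℝ≥0∞) (consE a X) *
      ω.indicator G (crossVar (consE a X)) = (Ioo (-L) L).indicator (fun _ => ω.indicator G X) a := by
    intro a
    by_cases ha : a ∈ Ioo (-L) L
    · have : consE a X ∈ slab n L := ha
      simp [ha, this]
    · have : consE a X ∉ slab n L := ha
      simp [ha, this]
  simp_rw [e2]
  rw [lintegral_indicator_const measurableSet_Ioo, Real.volume_Ioo, mul_comm]
  congr 2
  ring

lemma volume_cylDomain {ω : Set (E n)} (hω : MeasurableSet ω) (L : ℝ) :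
    volume (cylDomain ω L) = ENNReal.ofReal (2 * L) * volume ω := by
  have := lintegral_cylDomain_comp_crossVar hω L (G := fun _ => 1) aemeasurable_const
  simpa using this

lemma MemW0.integrable {d : ℕ} (hp : 1 ≤ p) {Ω : Set (E d)} (hΩ : volume Ω < ⊤) {v : E d → ℝ}
    (hv : MemW0 s p Ω v) : Integrable v volume := by
  have : IsFiniteMeasure (volume.restrict Ω) := ⟨by simpa using hΩ⟩
  have h1 : IntegrableOn v Ω volume := (hv.memLp.restrict Ω).integrable (by
    rw [← ENNReal.ofReal_one]
    exact ENNReal.ofReal_le_ofReal hp)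
  exact h1.integrable_of_ae_notMem_eq_zero hv.zero_outside

lemma aestronglyMeasurable_lineIntegral {v : E (n + 1) → ℝ} (hv : AEStronglyMeasurable v volume) :
    AEStronglyMeasurable (lineIntegral v) volume :=
  (hv.comp_quasiMeasurePreserving
    measurePreserving_consE_swap.quasiMeasurePreserving).integral_prod_right'

lemma ae_integrable_slice {v : E (n + 1) → ℝ} (hv : Integrable v volume) :
    ∀ᵐ X : E n, Integrable (fun a : ℝ => v (consE a X)) volume :=
  (integrable_comp_consE hv).prod_right_ae

/-- The shift h disappears by translation invariance. This is why the remaining h-integral acts on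
the kernel alone. -/
lemma lineIntegral_sub_eq {v : E (n + 1) → ℝ} (h : ℝ) {X Y : E n}
    (hX : Integrable (fun a : ℝ => v (consE a X)) volume)
    (hY : Integrable (fun a : ℝ => v (consE a Y)) volume) :
    ∫ a : ℝ, (v (consE a X) - v (consE (a + h) Y)) = lineIntegral v X - lineIntegral v Y := by
  rw [integral_sub hX (hY.comp_add_right h),
    integral_add_right_eq_self (fun a => v (consE a Y)) h]
  rfl

/-- The integral along the axis of an element of `W₀^{s,p}` of the cylinder belongs to `W₀^{s,p}` of
the cross-section. -/
lemma MemW0.lineIntegral (hn : 1 ≤ n) (hp : 2 < p) (hs : 0 < s) {ω : Set (E n)}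
    (hω : MeasurableSet ω) (hωfin : volume ω < ⊤) {L : ℝ} (hL : 0 < L) {v : E (n + 1) → ℝ}
    (hv : MemW0 s p (cylDomain ω L) v) (hv0 : ∀ x, x 0 ∉ Ioo (-L) L → v x = 0) :
    MemW0 s p ω (lineIntegral v) := by
  have hp0 : 0 < p := by linarith
  have hsp : 0 < s * p := mul_pos hs hp0
  have hcfin : volume (cylDomain ω L) < ⊤ := by
    rw [volume_cylDomain hω]
    exact ENNReal.mul_lt_top ENNReal.ofReal_lt_top hωfin
  have hvi := hv.integrable (by linarith) hcfin
  have hVm := aestronglyMeasurable_lineIntegral hvi.1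
  have hvm : AEMeasurable (fun x => ENNReal.ofReal (|v x| ^ p)) volume :=
    ((continuous_abs.comp_aestronglyMeasurable hvi.1).aemeasurable.pow_const p).ennreal_ofReal
  have hsl := ae_integrable_slice hvi
  refine memW0_of_memLp hp0 ?_ ?_ ?_
  · rw [memLp_ofReal_iff hp0 hVm]
    have hle : ∫⁻ X : E n, ENNReal.ofReal (|_root_.lineIntegral v X| ^ p) ≤
        volume (Ioo (-L) L) ^ (p - 1) * ∫⁻ x, ENNReal.ofReal (|v x| ^ p) := by
      rw [lintegral_consE hvm, ← lintegral_const_mul' _ _ (by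
        rw [Real.volume_Ioo]
        exact ENNReal.rpow_ne_top_of_nonneg (by linarith) ENNReal.ofReal_ne_top)]
      refine lintegral_mono_ae ?_
      filter_upwards [hsl] with X hX
      exact ofReal_abs_integral_rpow_le (by linarith) hX.1 measurableSet_Ioo
        (fun a ha => hv0 _ ha)
    refine hle.trans_lt (ENNReal.mul_lt_top ?_ ((memLp_ofReal_iff hp0 hvi.1).1 hv.memLp))
    rw [Real.volume_Ioo]
    exact ENNReal.rpow_lt_top_of_nonneg (by linarith) ENNReal.ofReal_ne_top
  · rw [memLp_ofReal_iff hp0 (aestronglyMeasurable_pairDiff hVm)]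
    have hDm : AEMeasurable (fun z => ENNReal.ofReal (|pairDiff v z| ^ p)) volume := by
      have : AEStronglyMeasurable (pairDiff v) volume := hvi.1.comp_fst.sub hvi.1.comp_snd
      exact ((continuous_abs.comp_aestronglyMeasurable this).aemeasurable.pow_const p).ennreal_ofReal
    have hfin := (memLp_ofReal_iff hp0 (hv.memLp_pairDiff hp0).1).1 (hv.memLp_pairDiff hp0)
    rw [lintegral_gagliardoMeasure_succ hDm] at hfin
    -- For fixed h, X, Y the difference a ↦ v(a, X) − v(a + h, Y) is supported in two intervals of
    -- length 2L, so Jensen costs (4L)^{p−1} uniformly in h.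
    set c : ℝ≥0∞ := ENNReal.ofReal (4 * L) ^ (p - 1) with hc
    have hctop : c ≠ ⊤ := ENNReal.rpow_ne_top_of_nonneg (by linarith) ENNReal.ofReal_ne_top
    have hκ := sliceConst_pos (n := n) hsp
    have hle : ENNReal.ofReal (sliceConst n s p) *
        ∫⁻ w, ENNReal.ofReal (|pairDiff (_root_.lineIntegral v) w| ^ p) ∂(gagliardoMeasure n s p) ≤
        c * ∫⁻ w : E n × E n, ∫⁻ h : ℝ, ENNReal.ofReal (sliceKernel n s p h ‖w.1 - w.2‖) *
          ∫⁻ a : ℝ, ENNReal.ofReal (|pairDiff v (consE a w.1, consE (a + h) w.2)| ^ p) := by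
      rw [lintegral_gagliardoMeasure, ← lintegral_const_mul' _ _ ENNReal.ofReal_ne_top,
        ← lintegral_const_mul' _ _ hctop]
      refine lintegral_mono_ae ?_
      have hq1 := Measure.quasiMeasurePreserving_fst (μ := (volume : Measure (E n)))
        (ν := (volume : Measure (E n))) |>.ae hsl
      have hq2 := Measure.quasiMeasurePreserving_snd (μ := (volume : Measure (E n)))
        (ν := (volume : Measure (E n))) |>.ae hsl
      filter_upwards [ae_prod_fst_ne_snd hn, hq1, hq2] with w hw hw1 hw2
      have hr : 0 < ‖w.1 - w.2‖ := norm_pos_iff.2 (sub_ne_zero.2 hw)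
      -- The n-dimensional kernel is written back as an h-integral, so that the two sides are
      -- compared for each h.
      rw [← mul_assoc, ← lintegral_sliceKernel hsp hr, ← lintegral_mul_const' _ _
        ENNReal.ofReal_ne_top, ← lintegral_const_mul' _ _ hctop]
      refine lintegral_mono fun h => ?_
      rw [mul_left_comm c]
      refine mul_le_mul_right ?_ _
      have hJ := ofReal_abs_integral_rpow_le (μ := volume) (p := p) (by linarith)
        (hw1.sub (hw2.comp_add_right h)).1
        (measurableSet_Ioo.union measurableSet_Ioo) (S := Ioo (-L) L ∪ Ioo (-L - h) (L - h)) (by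
          intro a ha
          rw [mem_union, not_or] at ha
          have h1 : v (consE a w.1) = 0 := hv0 _ ha.1
          have h2 : v (consE (a + h) w.2) = 0 := hv0 _ (fun h' => ha.2 ⟨by
            have := h'.1; simp only [consE_zero] at this; linarith, by
            have := h'.2; simp only [consE_zero] at this; linarith⟩)
          simp [h1, h2])
      simp only [Pi.sub_apply] at hJ
      rw [lineIntegral_sub_eq h hw1 hw2] at hJ
      refine hJ.trans (mul_le_mul_left ?_ _)
      refine ENNReal.rpow_le_rpow ((measure_union_le _ _).trans (le_of_eq ?_)) (by linarith)
      rw [Real.volume_Ioo, Real.volume_Ioo, ← ENNReal.ofReal_add (by linarith) (by linarith)]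
      congr 1
      ring
    have h1 := hle.trans_lt (ENNReal.mul_lt_top hctop.lt_top hfin)
    exact ENNReal.lt_top_of_mul_ne_top_right h1.ne (by simpa using hκ)
  · have h1 := measurePreserving_consE_swap.quasiMeasurePreserving.ae hv.zero_outside
    rw [Measure.volume_eq_prod] at h1
    filter_upwards [Measure.ae_ae_of_ae_prod h1] with X hX hXω
    unfold _root_.lineIntegral
    refine integral_eq_zero_of_ae ?_
    filter_upwards [hX] with a ha
    exact ha (fun h => hXω h.2)

/-- The weak form for a function of the cross-section, tested with a function on the cylinder. -/
lemma integral_phi_crossVar_mul (hn : 1 ≤ n) (hsp : 0 < s * p) {U : E n → ℝ}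
    {v : E (n + 1) → ℝ} (hv : Integrable v volume)
    (hi : Integrable (fun z => phi p (pairDiff (fun x => U (crossVar x)) z) * pairDiff v z)
      (gagliardoMeasure (n + 1) s p)) :
    ∫ z, phi p (pairDiff (fun x => U (crossVar x)) z) * pairDiff v z
        ∂(gagliardoMeasure (n + 1) s p) =
      sliceConst n s p * ∫ w, phi p (pairDiff U w) * pairDiff (lineIntegral v) w
        ∂(gagliardoMeasure n s p) := by
  unfold gagliardoMeasure at hi ⊢
  rw [integral_withDensity_eq_integral_toReal_smul (measurable_kernel _ s p)
    (Eventually.of_forall fun _ => ENNReal.ofReal_lt_top),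
    integral_withDensity_eq_integral_toReal_smul (measurable_kernel _ s p)
    (Eventually.of_forall fun _ => ENNReal.ofReal_lt_top)]
  rw [integrable_withDensity_iff_integrable_smul' (measurable_kernel _ s p)
    (Eventually.of_forall fun _ => ENNReal.ofReal_lt_top)] at hi
  have hP := measurePreserving_pairCons (n := n)
  have hiP := hP.integrable_comp_of_integrable hi
  conv_lhs => rw [← hP.map_eq]
  rw [integral_map hP.measurable.aemeasurable (by rw [hP.map_eq]; exact hi.1),
    Measure.volume_eq_prod]
  refine (integral_prod _ hiP).trans ?_
  rw [← integral_const_mul]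
  refine integral_congr_ae ?_
  have hsl := ae_integrable_slice hv
  have hq1 := Measure.quasiMeasurePreserving_fst (μ := (volume : Measure (E n)))
    (ν := (volume : Measure (E n))) |>.ae hsl
  have hq2 := Measure.quasiMeasurePreserving_snd (μ := (volume : Measure (E n)))
    (ν := (volume : Measure (E n))) |>.ae hsl
  filter_upwards [ae_prod_fst_ne_snd hn, hq1, hq2, hiP.prod_right_ae] with w hw hw1 hw2 hwi
  have hr : 0 < ‖w.1 - w.2‖ := norm_pos_iff.2 (sub_ne_zero.2 hw)
  refine (integral_prod _ hwi).trans ?_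
  -- The difference of U is independent of a and h; integrating in a turns v into its axial
  -- integral, and what remains factors as the kernel in h times a function of (X, Y).
  have h1 : ∀ h : ℝ, ∫ a : ℝ, (fun z : E (n + 1) × E (n + 1) =>
      (ENNReal.ofReal (1 / ‖z.1 - z.2‖ ^ (((n + 1 : ℕ) : ℝ) + s * p))).toReal •
        (phi p (pairDiff (fun x => U (crossVar x)) z) * pairDiff v z)) (pairCons (w, (h, a))) =
      sliceKernel n s p h ‖w.1 - w.2‖ *
        (phi p (pairDiff U w) * pairDiff (lineIntegral v) w) := by
    intro h
    have e : ∀ a : ℝ, (fun z : E (n + 1) × E (n + 1) =>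
      (ENNReal.ofReal (1 / ‖z.1 - z.2‖ ^ (((n + 1 : ℕ) : ℝ) + s * p))).toReal •
        (phi p (pairDiff (fun x => U (crossVar x)) z) * pairDiff v z)) (pairCons (w, (h, a))) =
        (sliceKernel n s p h ‖w.1 - w.2‖ * phi p (pairDiff U w)) *
          (v (consE a w.1) - v (consE (a + h) w.2)) := by
      intro a
      simp only
      rw [kernel_pairCons, ENNReal.toReal_ofReal (sliceKernel_nonneg _ _ _ _ _), smul_eq_mul,
        mul_assoc]
      rfl
    simp_rw [e]
    rw [integral_const_mul, lineIntegral_sub_eq h hw1 hw2, mul_assoc]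
    rfl
  refine (integral_congr_ae (Eventually.of_forall h1)).trans ?_
  rw [integral_mul_const, integral_sliceKernel hsp hr,
    ENNReal.toReal_ofReal (by positivity), smul_eq_mul]
  ring

lemma integral_mul_lineIntegral {k : E n → ℝ} {v : E (n + 1) → ℝ}
    (h : Integrable (fun x => k (crossVar x) * v x) volume) :
    ∫ X, k X * lineIntegral v X = ∫ x, k (crossVar x) * v x := by
  rw [integral_consE h]
  refine integral_congr_ae (Eventually.of_forall fun X => ?_)
  simp only [crossVar_consE]
  rw [integral_const_mul]
  rfl

end lineIntegral

/-! ### The axial cutoff -/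

section cutoff

/-- The piecewise affine cutoff, equal to `1` on `[-R, R]` and to `0` outside `(-2R, 2R)`. -/
noncomputable def cutoff (R t : ℝ) : ℝ := max 0 (min 1 (2 - |t| / R))

lemma cutoff_mem (R t : ℝ) : cutoff R t ∈ Icc (0 : ℝ) 1 :=
  ⟨le_max_left _ _, max_le zero_le_one (min_le_left _ _)⟩

lemma cutoff_eq_one {R t : ℝ} (hR : 0 < R) (ht : |t| ≤ R) : cutoff R t = 1 := by
  have : |t| / R ≤ 1 := (div_le_one hR).2 ht
  unfold cutoff
  rw [min_eq_left (by linarith), max_eq_right zero_le_one]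

lemma cutoff_eq_zero {R t : ℝ} (hR : 0 < R) (ht : 2 * R ≤ |t|) : cutoff R t = 0 := by
  have : 2 ≤ |t| / R := (le_div_iff₀ hR).2 ht
  unfold cutoff
  rw [max_eq_left ((min_le_right _ _).trans (by linarith))]

lemma continuous_cutoff (R : ℝ) : Continuous (cutoff R) := by
  unfold cutoff
  fun_prop

lemma abs_cutoff_sub_le {R : ℝ} (hR : 0 < R) (t r : ℝ) :
    |cutoff R t - cutoff R r| ≤ min 1 (|t - r| / R) := by
  refine le_min ?_ ?_
  · have h1 := cutoff_mem R t
    have h2 := cutoff_mem R r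
    rw [abs_le]
    constructor <;> linarith [h1.1, h1.2, h2.1, h2.2]
  · unfold cutoff
    rw [max_comm 0, max_comm 0, min_comm 1, min_comm 1]
    refine (abs_max_sub_max_le_abs _ _ _).trans ?_
    refine (abs_inf_sub_inf_le_abs _ _ _).trans ?_
    rw [sub_sub_sub_cancel_left, ← sub_div, abs_div, abs_of_pos hR]
    have h := abs_abs_sub_abs_le r t
    rw [abs_sub_comm r t] at h
    exact div_le_div_of_nonneg_right h hR.le

variable {n : ℕ}

/-- The cutoff in the axial variable. -/
noncomputable def axialCutoff (R : ℝ) (x : E (n + 1)) : ℝ := cutoff R (x 0)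

lemma continuous_axialCutoff (R : ℝ) : Continuous (axialCutoff R : E (n + 1) → ℝ) :=
  (continuous_cutoff R).comp (by fun_prop)

lemma axialCutoff_mem (R : ℝ) (x : E (n + 1)) : axialCutoff R x ∈ Icc (0 : ℝ) 1 := cutoff_mem _ _

lemma axialCutoff_eq_zero {R L : ℝ} (hL : L = 2 * R) (hR : 0 < R) {x : E (n + 1)}
    (hx : x ∉ slab n L) : axialCutoff R x = 0 := by
  refine cutoff_eq_zero hR ?_
  by_contra! h
  rw [abs_lt, ← hL] at h
  exact hx h

lemma abs_pairDiff_axialCutoff_le {R : ℝ} (hR : 0 < R) (z : E (n + 1) × E (n + 1)) :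
    |pairDiff (axialCutoff R) z| ≤ min 1 (‖z.1 - z.2‖ / R) := by
  refine (abs_cutoff_sub_le hR _ _).trans (min_le_min le_rfl ?_)
  gcongr
  have := PiLp.norm_apply_le (z.1 - z.2) 0
  simpa using this

lemma pairDiff_axialCutoff_eq_zero {R L : ℝ} (hL : L = 2 * R) (hR : 0 < R)
    {z : E (n + 1) × E (n + 1)} (hz : z ∉ slabPairs n L) : pairDiff (axialCutoff R) z = 0 := by
  unfold slabPairs at hz
  rw [Set.mem_ofPred_eq, not_or] at hz
  simp [pairDiff, axialCutoff_eq_zero hL hR hz.1, axialCutoff_eq_zero hL hR hz.2]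

end cutoff

/-! ### Commutator terms: values of a function times differences of the cutoff -/

section truncated

variable {d n : ℕ} {s p : ℝ}

/-- The factor by which the cutoff truncates the kernel. -/
noncomputable def truncFactor {d : ℕ} (p R : ℝ) (z : E d) : ℝ≥0∞ :=
  ENNReal.ofReal (min 1 (‖z‖ / R) ^ p)

lemma measurable_truncFactor (p R : ℝ) : Measurable (truncFactor p R : E d → ℝ≥0∞) := by
  unfold truncFactor
  have : Measurable fun z : E d => min 1 (‖z‖ / R) := by fun_prop
  exact (this.pow_const p).ennreal_ofReal

/-- The integral of the truncated kernel. -/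
noncomputable def truncMass (d : ℕ) (s p R : ℝ) : ℝ≥0∞ :=
  ∫⁻ z : E d, ENNReal.ofReal (min 1 (‖z‖ / R) ^ p / ‖z‖ ^ ((d : ℝ) + s * p))

lemma lintegral_mul_truncFactor {R : ℝ} (_hR : 0 < R) {F : E d → ℝ≥0∞}
    (hF : AEMeasurable F volume) :
    ∫⁻ z, F z.1 * truncFactor p R (z.1 - z.2) ∂(gagliardoMeasure d s p) =
      (∫⁻ x, F x) * truncMass d s p R := by
  have hq : Measurable fun z : E d =>
      ENNReal.ofReal (min 1 (‖z‖ / R) ^ p / ‖z‖ ^ ((d : ℝ) + s * p)) := by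
    have h1 : Measurable fun z : E d => min 1 (‖z‖ / R) := by fun_prop
    have h2 : Measurable fun z : E d => ‖z‖ := by fun_prop
    exact ((h1.pow_const p).div (h2.pow_const _)).ennreal_ofReal
  rw [lintegral_gagliardoMeasure, truncMass, ← lintegral_mul_sub hF hq]
  refine lintegral_congr fun z => ?_
  rw [truncFactor, mul_left_comm, ← ENNReal.ofReal_mul (by positivity)]
  congr 2
  ring

lemma aemeasurable_abs_rpow {α : Type*} {m : MeasurableSpace α} {μ : Measure α} {f : α → ℝ}
    (hf : AEStronglyMeasurable f μ) (p : ℝ) :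
    AEMeasurable (fun x => ENNReal.ofReal (|f x| ^ p)) μ :=
  ((continuous_abs.comp_aestronglyMeasurable hf).aemeasurable.pow_const p).ennreal_ofReal

lemma ofReal_abs_mul_rpow (p a b : ℝ) :
    ENNReal.ofReal (|a * b| ^ p) = ENNReal.ofReal (|a| ^ p) * ENNReal.ofReal (|b| ^ p) := by
  rw [abs_mul, Real.mul_rpow (abs_nonneg _) (abs_nonneg _), ENNReal.ofReal_mul (by positivity)]

lemma ofReal_abs_pairDiff_axialCutoff_le (hp : 0 < p) {R : ℝ} (hR : 0 < R)
    (z : E (n + 1) × E (n + 1)) :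
    ENNReal.ofReal (|pairDiff (axialCutoff R) z| ^ p) ≤ truncFactor p R (z.1 - z.2) :=
  ENNReal.ofReal_le_ofReal
    (Real.rpow_le_rpow (abs_nonneg _) (abs_pairDiff_axialCutoff_le hR z) hp.le)

/-- |Dζ| ≤ min(1, |x − y|/R) depends on x − y only, so the y-integral gives the truncated mass,
uniformly in x. -/
lemma lintegral_fst_mul_cutoff_le (hp : 0 < p) {R : ℝ} (hR : 0 < R) {u : E (n + 1) → ℝ}
    (hu : AEStronglyMeasurable u volume) :
    ∫⁻ z, ENNReal.ofReal (|u z.1 * pairDiff (axialCutoff R) z| ^ p)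
        ∂(gagliardoMeasure (n + 1) s p) ≤
      (∫⁻ x, ENNReal.ofReal (|u x| ^ p)) * truncMass (n + 1) s p R := by
  rw [← lintegral_mul_truncFactor hR (aemeasurable_abs_rpow hu p)]
  refine lintegral_mono fun z => ?_
  simp only
  rw [ofReal_abs_mul_rpow]
  gcongr
  exact ofReal_abs_pairDiff_axialCutoff_le hp hR z

/-- Integrands which are invariant along the axis may be localized in either variable. -/
lemma lintegral_slab_snd_eq_fst {L : ℝ} {H : E (n + 1) × E (n + 1) → ℝ≥0∞}
    (hH : AEMeasurable H volume)
    (hinv : ∀ (a b h : ℝ) (X Y : E n),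
      H (consE a X, consE (a + h) Y) = H (consE b X, consE (b + h) Y)) :
    ∫⁻ z, (slab n L).indicator 1 z.2 * H z ∂(gagliardoMeasure (n + 1) s p) =
      ∫⁻ z, (slab n L).indicator 1 z.1 * H z ∂(gagliardoMeasure (n + 1) s p) := by
  have h1 : Measurable ((slab n L).indicator (1 : E (n + 1) → ℝ≥0∞)) :=
    measurable_one.indicator (measurableSet_slab L)
  have m2 : AEMeasurable (fun z : E (n + 1) × E (n + 1) => (slab n L).indicator 1 z.2 * H z)
      volume := (h1.comp measurable_snd).aemeasurable.mul hH
  have m1 : AEMeasurable (fun z : E (n + 1) × E (n + 1) => (slab n L).indicator 1 z.1 * H z)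
      volume := (h1.comp measurable_fst).aemeasurable.mul hH
  rw [lintegral_gagliardoMeasure_succ m2, lintegral_gagliardoMeasure_succ m1]
  refine lintegral_congr fun w => lintegral_congr fun h => ?_
  congr 1
  have e1 : ∀ (a : ℝ) (X Y : E n), (slab n L).indicator (1 : E (n + 1) → ℝ≥0∞) (consE a X) =
      (slab n L).indicator 1 (consE a Y) := by
    intro a X Y
    by_cases ha : a ∈ Ioo (-L) L
    · have h1 : consE a X ∈ slab n L := ha
      have h2 : consE a Y ∈ slab n L := ha
      simp [h1, h2]
    · have h1 : consE a X ∉ slab n L := ha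
      have h2 : consE a Y ∉ slab n L := ha
      simp [h1, h2]
  simp only
  have e2 : ∀ a, H (consE a w.1, consE (a + h) w.2) = H (consE 0 w.1, consE (0 + h) w.2) :=
    fun a => hinv _ _ _ _ _
  simp_rw [e2, fun a => e1 a w.2 w.1]
  exact lintegral_add_right_eq_self (fun a =>
    (slab n L).indicator (1 : E (n + 1) → ℝ≥0∞) (consE a w.1) *
      H (consE 0 w.1, consE (0 + h) w.2)) h

lemma lintegral_slab_abs_rpow_crossVar {L : ℝ} {U : E n → ℝ}
    (hU : AEStronglyMeasurable U volume) :
    ∫⁻ x, (slab n L).indicator 1 x * ENNReal.ofReal (|U (crossVar x)| ^ p) =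
      ENNReal.ofReal (2 * L) * ∫⁻ X, ENNReal.ofReal (|U X| ^ p) := by
  have h := lintegral_cylDomain_comp_crossVar (ω := (univ : Set (E n))) MeasurableSet.univ L
    (G := fun X => ENNReal.ofReal (|U X| ^ p)) (by
      rw [Measure.restrict_univ]; exact aemeasurable_abs_rpow hU p)
  rw [Measure.restrict_univ] at h
  have hm : MeasurableSet (cylDomain (univ : Set (E n)) L) :=
    (measurableSet_slab L).inter (measurable_crossVar MeasurableSet.univ)
  rw [← h, ← lintegral_indicator hm]
  refine lintegral_congr fun x => ?_
  by_cases hx : x ∈ slab n L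
  · have : x ∈ cylDomain (univ : Set (E n)) L := ⟨hx, mem_univ _⟩
    simp [hx, this]
  · have : x ∉ cylDomain (univ : Set (E n)) L := fun h => hx h.1
    simp [hx, this]

/-- U(X₂) need not be p-integrable on ℝ^{n+1}, so the previous estimate does not apply. But Dζ
vanishes unless one point lies in the slab, and a condition on the second point can be moved to the
first by a shift along the axis. -/
lemma lintegral_fst_crossVar_mul_cutoff_le (hp : 0 < p) {R L : ℝ} (hL : L = 2 * R) (hR : 0 < R)
    {U : E n → ℝ} (hU : AEStronglyMeasurable U volume) :
    ∫⁻ z, ENNReal.ofReal (|U (crossVar z.1) * pairDiff (axialCutoff R) z| ^ p)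
        ∂(gagliardoMeasure (n + 1) s p) ≤
      2 * (ENNReal.ofReal (2 * L) * (∫⁻ X, ENNReal.ofReal (|U X| ^ p)) *
        truncMass (n + 1) s p R) := by
  have hUc := aestronglyMeasurable_comp_crossVar hU
  set H : E (n + 1) × E (n + 1) → ℝ≥0∞ := fun z =>
    ENNReal.ofReal (|U (crossVar z.1)| ^ p) * truncFactor p R (z.1 - z.2) with hHdef
  have hH : AEMeasurable H volume := (aemeasurable_abs_rpow hUc p).comp_fst.mul
    ((measurable_truncFactor p R).comp (measurable_fst.sub measurable_snd)).aemeasurable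
  have h1 : Measurable ((slab n L).indicator (1 : E (n + 1) → ℝ≥0∞)) :=
    measurable_one.indicator (measurableSet_slab L)
  have hinv : ∀ (a b h : ℝ) (X Y : E n),
      H (consE a X, consE (a + h) Y) = H (consE b X, consE (b + h) Y) := by
    intro a b h X Y
    simp only [hHdef, truncFactor, norm_consE_sub, crossVar_consE]
  have hfst : ∫⁻ z, (slab n L).indicator 1 z.1 * H z ∂(gagliardoMeasure (n + 1) s p) =
      ENNReal.ofReal (2 * L) * (∫⁻ X, ENNReal.ofReal (|U X| ^ p)) * truncMass (n + 1) s p R := by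
    have hm : AEMeasurable (fun x : E (n + 1) =>
        (slab n L).indicator 1 x * ENNReal.ofReal (|U (crossVar x)| ^ p)) volume :=
      h1.aemeasurable.mul (aemeasurable_abs_rpow hUc p)
    rw [← lintegral_slab_abs_rpow_crossVar hU, ← lintegral_mul_truncFactor hR hm]
    refine lintegral_congr fun z => ?_
    simp only [hHdef]
    rw [mul_assoc]
  have hm : AEMeasurable (fun z : E (n + 1) × E (n + 1) => (slab n L).indicator 1 z.1 * H z)
      (gagliardoMeasure (n + 1) s p) :=
    ((h1.comp measurable_fst).aemeasurable.mul hH).mono_ac gagliardoMeasure_absolutelyContinuous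
  rw [two_mul, ← hfst]
  nth_rewrite 2 [← lintegral_slab_snd_eq_fst hH hinv]
  rw [← lintegral_add_left' hm]
  refine lintegral_mono fun z => ?_
  simp only
  rw [← add_mul]
  by_cases hz : z ∈ slabPairs n L
  · have hH' : ENNReal.ofReal (|U (crossVar z.1) * pairDiff (axialCutoff R) z| ^ p) ≤ H z := by
      rw [ofReal_abs_mul_rpow]
      exact mul_le_mul_right (ofReal_abs_pairDiff_axialCutoff_le hp hR z) _
    refine hH'.trans (le_mul_of_one_le_left' ?_)
    rcases hz with hz | hz
    · refine le_trans (le_of_eq ?_) le_self_add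
      simp [hz]
    · refine le_trans (le_of_eq ?_) le_add_self
      simp [hz]
  · rw [pairDiff_axialCutoff_eq_zero hL hR hz, mul_zero, abs_zero, Real.zero_rpow hp.ne']
    simp

/-- Exchanging the two variables in a product with a difference of cutoffs. -/
lemma lintegral_snd_mul_cutoff_eq {R : ℝ} {u : E (n + 1) → ℝ}
    (hu : AEStronglyMeasurable u volume) :
    ∫⁻ z, ENNReal.ofReal (|u z.2 * pairDiff (axialCutoff R) z| ^ p)
        ∂(gagliardoMeasure (n + 1) s p) =
      ∫⁻ z, ENNReal.ofReal (|u z.1 * pairDiff (axialCutoff R) z| ^ p)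
        ∂(gagliardoMeasure (n + 1) s p) := by
  have hm : AEStronglyMeasurable (fun z : E (n + 1) × E (n + 1) =>
      u z.1 * pairDiff (axialCutoff R) z) (gagliardoMeasure (n + 1) s p) :=
    (AEStronglyMeasurable.mono_ac gagliardoMeasure_absolutelyContinuous hu.comp_fst).mul
      (aestronglyMeasurable_pairDiff (continuous_axialCutoff R).aestronglyMeasurable)
  rw [← lintegral_gagliardoMeasure_swap (aemeasurable_abs_rpow hm p)]
  refine lintegral_congr fun z => ?_
  rw [ofReal_abs_mul_rpow, ofReal_abs_mul_rpow]
  congr 3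
  simp [pairDiff, abs_sub_comm]

end truncated

/-! ### Poincaré inequalities -/

section poincare

variable {d : ℕ} {s p : ℝ}

/-- A local Poincaré inequality for functions vanishing outside a set which is bounded in one
direction. -/
lemma exists_poincare (i : Fin d) {R₀ : ℝ} (hR₀ : 0 < R₀) (hp : 0 < p) (hs : 0 < s) :
    ∃ c : ℝ, 0 < c ∧ ∀ (Ω A : Set (E d)) (w : E d → ℝ), (∀ x ∈ Ω, |x i| < R₀) →
      MeasurableSet A → A ⊆ Ω → AEStronglyMeasurable w volume →
      (∀ᵐ x, x ∉ Ω → w x = 0) →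
      ∫⁻ x in A, ENNReal.ofReal (|w x| ^ p) ≤ ENNReal.ofReal c *
        ∫⁻ z, A.indicator 1 z.1 * ENNReal.ofReal (|pairDiff w z| ^ p)
          ∂(gagliardoMeasure d s p) := by
  -- The ball of radius R₀ about x + e misses the strip |xᵢ| < R₀ and stays within 4R₀ of x. There w
  -- = 0 almost everywhere, so Dw(x, y) = w(x), while the kernel is at least k.
  set e : E d := EuclideanSpace.single i (3 * R₀) with he
  set V := volume (Metric.ball (0 : E d) R₀) with hV
  have hV0 : V ≠ 0 := (Metric.measure_ball_pos volume 0 hR₀).ne'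
  have hVt : V ≠ ⊤ := measure_ball_lt_top.ne
  set k : ℝ := 1 / (4 * R₀) ^ ((d : ℝ) + s * p) with hk
  have hk0 : 0 < k := by positivity
  have hVr : 0 < V.toReal := ENNReal.toReal_pos hV0 hVt
  refine ⟨1 / (k * V.toReal), by positivity, ?_⟩
  intro Ω A w hΩ hA hAΩ hw hw0
  have hDw : AEStronglyMeasurable (pairDiff w) (volume : Measure (E d × E d)) :=
    hw.comp_fst.sub hw.comp_snd
  have hm : AEMeasurable (fun z : E d × E d =>
      ENNReal.ofReal (1 / ‖z.1 - z.2‖ ^ ((d : ℝ) + s * p)) *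
        (A.indicator 1 z.1 * ENNReal.ofReal (|pairDiff w z| ^ p))) (volume.prod volume) :=
    (measurable_kernel d s p).aemeasurable.mul
      (((measurable_one.indicator hA).comp measurable_fst).aemeasurable.mul
        (aemeasurable_abs_rpow hDw p))
  have hmain : ∫⁻ x in A, ENNReal.ofReal (k * V.toReal) * ENNReal.ofReal (|w x| ^ p) ≤
      ∫⁻ z, A.indicator 1 z.1 * ENNReal.ofReal (|pairDiff w z| ^ p)
        ∂(gagliardoMeasure d s p) := by
    rw [lintegral_gagliardoMeasure, Measure.volume_eq_prod, lintegral_prod _ hm,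
      ← lintegral_indicator hA]
    refine lintegral_mono fun x => ?_
    by_cases hx : x ∈ A
    · rw [indicator_of_mem hx]
      have h1 : ∀ᵐ y, y ∈ Metric.ball (x + e) R₀ →
          ENNReal.ofReal k * ENNReal.ofReal (|w x| ^ p) ≤
          ENNReal.ofReal (1 / ‖x - y‖ ^ ((d : ℝ) + s * p)) *
            (A.indicator 1 x * ENNReal.ofReal (|pairDiff w (x, y)| ^ p)) := by
        filter_upwards [hw0] with y hy hyb
        rw [Metric.mem_ball, dist_eq_norm] at hyb
        have hxi := abs_lt.1 (hΩ x (hAΩ hx))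
        have hyi : |y i - (x i + 3 * R₀)| < R₀ := by
          refine lt_of_le_of_lt ?_ hyb
          have := PiLp.norm_apply_le (y - (x + e)) i
          simpa [he] using this
        have hyi' := abs_lt.1 hyi
        have hyΩ : y ∉ Ω := fun h => by
          have := (abs_lt.1 (hΩ y h)).2
          linarith [hyi'.1]
        have hne : x - y ≠ 0 := by
          intro h
          have h2 : x i = y i := by rw [sub_eq_zero.1 h]
          linarith [hyi'.1]
        have hnorm : ‖x - y‖ ≤ 4 * R₀ := by
          have e1 : x - y = -(y - (x + e)) - e := by abel
          have e2 : ‖e‖ = 3 * R₀ := by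
            rw [he, PiLp.norm_single, Real.norm_eq_abs, abs_of_pos (by positivity)]
          rw [e1]
          refine (norm_sub_le _ _).trans ?_
          rw [norm_neg, e2]
          linarith
        have hpos : 0 < ‖x - y‖ := norm_pos_iff.2 hne
        simp only [indicator_of_mem hx, Pi.one_apply, one_mul, pairDiff, hy hyΩ, sub_zero]
        gcongr
        rw [hk]
        gcongr
      calc ENNReal.ofReal (k * V.toReal) * ENNReal.ofReal (|w x| ^ p)
          = ∫⁻ _ in Metric.ball (x + e) R₀, ENNReal.ofReal k * ENNReal.ofReal (|w x| ^ p) := by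
            rw [setLIntegral_const, Measure.addHaar_ball_center, ENNReal.ofReal_mul hk0.le,
              ENNReal.ofReal_toReal hVt]
            ring
        _ ≤ ∫⁻ y in Metric.ball (x + e) R₀,
              ENNReal.ofReal (1 / ‖x - y‖ ^ ((d : ℝ) + s * p)) *
                (A.indicator 1 x * ENNReal.ofReal (|pairDiff w (x, y)| ^ p)) :=
            lintegral_mono_ae ((ae_restrict_iff' Metric.isOpen_ball.measurableSet).2 h1)
        _ ≤ _ := setLIntegral_le_lintegral _ _
    · rw [indicator_of_notMem hx]
      exact zero_le
  rw [lintegral_const_mul' _ _ ENNReal.ofReal_ne_top] at hmain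
  refine le_trans (le_of_eq ?_) (mul_le_mul_right hmain _)
  rw [← mul_assoc, ← ENNReal.ofReal_mul (by positivity), one_div_mul_cancel (by positivity),
    ENNReal.ofReal_one, one_mul]

/-- The Poincaré inequality in `W₀^{s,p}`. -/
lemma exists_poincare_memW0 (i : Fin d) {R₀ : ℝ} (hR₀ : 0 < R₀) (hp : 0 < p) (hs : 0 < s) :
    ∃ c : ℝ, 0 < c ∧ ∀ (Ω : Set (E d)) (w : E d → ℝ), (∀ x ∈ Ω, |x i| < R₀) →
      MeasurableSet Ω → MemW0 s p Ω w →
      ∫⁻ x, ENNReal.ofReal (|w x| ^ p) ≤ ENNReal.ofReal c * gagliardoPow s p w := by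
  obtain ⟨c, hc, H⟩ := exists_poincare (s := s) (p := p) i hR₀ hp hs
  refine ⟨c, hc, fun Ω w hΩ hΩm hw => ?_⟩
  have h1 := H Ω Ω w hΩ hΩm Subset.rfl hw.memLp.1 hw.zero_outside
  have h2 : ∫⁻ x, ENNReal.ofReal (|w x| ^ p) = ∫⁻ x in Ω, ENNReal.ofReal (|w x| ^ p) := by
    rw [← lintegral_indicator hΩm]
    refine lintegral_congr_ae ?_
    filter_upwards [hw.zero_outside] with x hx
    by_cases hxΩ : x ∈ Ω
    · simp [hxΩ]
    · simp [hxΩ, hx hxΩ, Real.zero_rpow hp.ne']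
  rw [h2, gagliardoPow_eq]
  refine h1.trans (mul_le_mul_right (lintegral_mono fun z => ?_) _)
  by_cases hz : z.1 ∈ Ω <;> simp [hz]

end poincare

/-! ### The localized energy inequality -/

lemma half_add_rpow_le {p x y : ℝ} (hp : 0 ≤ p) (hx : 0 ≤ x) (hy : 0 ≤ y) :
    ((x + y) / 2) ^ p ≤ x ^ p + y ^ p := by
  have hx' := Real.rpow_nonneg hx p
  have hy' := Real.rpow_nonneg hy p
  rcases le_total x y with h | h
  · have := Real.rpow_le_rpow (by positivity) (show (x + y) / 2 ≤ y by linarith) hp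
    linarith
  · have := Real.rpow_le_rpow (by positivity) (show (x + y) / 2 ≤ x by linarith) hp
    linarith

lemma add_rpow_le_two_rpow {p x y : ℝ} (hp : 0 ≤ p) (hx : 0 ≤ x) (hy : 0 ≤ y) :
    (x + y) ^ p ≤ 2 ^ p * (x ^ p + y ^ p) := by
  have h := half_add_rpow_le hp hx hy
  have e : x + y = 2 * ((x + y) / 2) := by ring
  rw [e, Real.mul_rpow (by norm_num) (by positivity)]
  gcongr

lemma abs_half_sum_rpow_le {p : ℝ} (hp : 0 ≤ p) (a b c d : ℝ) :
    |(a + b - c - d) / 2| ^ p ≤ 2 ^ p * (|a| ^ p + |b| ^ p + |c| ^ p + |d| ^ p) := by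
  have h1 : |(a + b - c - d) / 2| ≤ (|a| + |b|) / 2 + (|c| + |d|) / 2 := by
    rw [abs_div, abs_of_pos (zero_lt_two' ℝ), ← add_div]
    gcongr
    calc |a + b - c - d| ≤ |a + b - c| + |d| := abs_sub _ _
      _ ≤ |a + b| + |c| + |d| := by gcongr; exact abs_sub _ _
      _ ≤ |a| + |b| + |c| + |d| := by gcongr; exact abs_add_le _ _
      _ = _ := by ring
  calc |(a + b - c - d) / 2| ^ p ≤ ((|a| + |b|) / 2 + (|c| + |d|) / 2) ^ p :=
        Real.rpow_le_rpow (abs_nonneg _) h1 hp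
    _ ≤ 2 ^ p * (((|a| + |b|) / 2) ^ p + ((|c| + |d|) / 2) ^ p) :=
        add_rpow_le_two_rpow hp (by positivity) (by positivity)
    _ ≤ 2 ^ p * ((|a| ^ p + |b| ^ p) + (|c| ^ p + |d| ^ p)) := by
        gcongr <;> exact half_add_rpow_le hp (abs_nonneg _) (abs_nonneg _)
    _ = _ := by ring

lemma integral_abs_rpow_le {α : Type*} {m : MeasurableSpace α} {μ : Measure α} {p b : ℝ}
    {f : α → ℝ} (hf : AEStronglyMeasurable f μ) (hb : 0 ≤ b)
    (h : ∫⁻ x, ENNReal.ofReal (|f x| ^ p) ∂μ ≤ ENNReal.ofReal b) : ∫ x, |f x| ^ p ∂μ ≤ b := by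
  rw [integral_eq_lintegral_of_nonneg_ae (Eventually.of_forall fun x => by positivity)
    ((continuous_abs.comp_aestronglyMeasurable hf).aemeasurable.pow_const p).aestronglyMeasurable]
  exact ENNReal.toReal_le_of_le_ofReal hb h

section localized

variable {n : ℕ} {s p R L : ℝ} {ω : Set (E n)} {u : E (n + 1) → ℝ} {U : E n → ℝ}

/-- The localized difference `ζ² (u - U)`. -/
noncomputable def locDiff (R : ℝ) (u : E (n + 1) → ℝ) (U : E n → ℝ) (x : E (n + 1)) : ℝ :=
  axialCutoff R x ^ 2 * (u x - U (crossVar x))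

/-- The mean of `ζ²` at two points. -/
noncomputable def meanCutoff (R : ℝ) (z : E (n + 1) × E (n + 1)) : ℝ :=
  (axialCutoff R z.1 ^ 2 + axialCutoff R z.2 ^ 2) / 2

lemma locDiff_eq_zero (hL : L = 2 * R) (hR : 0 < R) {x : E (n + 1)} (hx : x ∉ slab n L) :
    locDiff R u U x = 0 := by
  rw [locDiff, axialCutoff_eq_zero hL hR hx]
  ring

/-- The symmetrized product rule: the mean of ζ² times the difference of u − U, plus the mean of u −
U times the difference of ζ². This is the shape in which `phi_localized_monotone` is stated. -/
lemma pairDiff_locDiff (z : E (n + 1) × E (n + 1)) :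
    pairDiff (locDiff R u U) z =
      meanCutoff R z * (pairDiff u z - pairDiff (fun x => U (crossVar x)) z) +
        (u z.1 + u z.2 - U (crossVar z.1) - U (crossVar z.2)) / 2 *
          (axialCutoff R z.1 ^ 2 - axialCutoff R z.2 ^ 2) := by
  simp only [pairDiff, locDiff, meanCutoff]
  ring

lemma meanCutoff_nonneg (z : E (n + 1) × E (n + 1)) : 0 ≤ meanCutoff R z := by
  unfold meanCutoff
  positivity

lemma meanCutoff_le_one (z : E (n + 1) × E (n + 1)) : meanCutoff R z ≤ 1 := by
  have h1 := pow_le_one₀ (axialCutoff_mem R z.1).1 (axialCutoff_mem R z.1).2 (n := 2)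
  have h2 := pow_le_one₀ (axialCutoff_mem R z.2).1 (axialCutoff_mem R z.2).2 (n := 2)
  unfold meanCutoff
  linarith

lemma meanCutoff_eq_zero (hL : L = 2 * R) (hR : 0 < R) {z : E (n + 1) × E (n + 1)}
    (hz : z ∉ slabPairs n L) : meanCutoff R z = 0 := by
  unfold slabPairs at hz
  rw [Set.mem_ofPred_eq, not_or] at hz
  simp [meanCutoff, axialCutoff_eq_zero hL hR hz.1, axialCutoff_eq_zero hL hR hz.2]

lemma pairDiff_locDiff_eq_zero (hL : L = 2 * R) (hR : 0 < R) {z : E (n + 1) × E (n + 1)}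
    (hz : z ∉ slabPairs n L) : pairDiff (locDiff R u U) z = 0 := by
  unfold slabPairs at hz
  rw [Set.mem_ofPred_eq, not_or] at hz
  simp [pairDiff, locDiff_eq_zero hL hR hz.1, locDiff_eq_zero hL hR hz.2]

lemma aestronglyMeasurable_fst_mul_cutoff {w : E (n + 1) → ℝ}
    (hw : AEStronglyMeasurable w volume) :
    AEStronglyMeasurable (fun z : E (n + 1) × E (n + 1) => w z.1 * pairDiff (axialCutoff R) z)
      (gagliardoMeasure (n + 1) s p) :=
  (AEStronglyMeasurable.mono_ac gagliardoMeasure_absolutelyContinuous hw.comp_fst).mul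
    (aestronglyMeasurable_pairDiff (continuous_axialCutoff R).aestronglyMeasurable)

lemma aestronglyMeasurable_snd_mul_cutoff {w : E (n + 1) → ℝ}
    (hw : AEStronglyMeasurable w volume) :
    AEStronglyMeasurable (fun z : E (n + 1) × E (n + 1) => w z.2 * pairDiff (axialCutoff R) z)
      (gagliardoMeasure (n + 1) s p) :=
  (AEStronglyMeasurable.mono_ac gagliardoMeasure_absolutelyContinuous hw.comp_snd).mul
    (aestronglyMeasurable_pairDiff (continuous_axialCutoff R).aestronglyMeasurable)

lemma memLp_mul_cutoff (hp : 0 < p) (hR : 0 < R) (hJ : truncMass (n + 1) s p R < ⊤)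
    (hu : MemLp u (ENNReal.ofReal p) volume) :
    MemLp (fun z : E (n + 1) × E (n + 1) => u z.1 * pairDiff (axialCutoff R) z)
        (ENNReal.ofReal p) (gagliardoMeasure (n + 1) s p) ∧
      MemLp (fun z : E (n + 1) × E (n + 1) => u z.2 * pairDiff (axialCutoff R) z)
        (ENNReal.ofReal p) (gagliardoMeasure (n + 1) s p) := by
  have h : ∫⁻ z, ENNReal.ofReal (|u z.1 * pairDiff (axialCutoff R) z| ^ p)
      ∂(gagliardoMeasure (n + 1) s p) < ⊤ :=
    (lintegral_fst_mul_cutoff_le hp hR hu.1).trans_lt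
      (ENNReal.mul_lt_top ((memLp_ofReal_iff hp hu.1).1 hu) hJ)
  rw [memLp_ofReal_iff hp (aestronglyMeasurable_fst_mul_cutoff hu.1),
    memLp_ofReal_iff hp (aestronglyMeasurable_snd_mul_cutoff hu.1), lintegral_snd_mul_cutoff_eq hu.1]
  exact ⟨h, h⟩

lemma memLp_crossVar_mul_cutoff (hp : 0 < p) (hL : L = 2 * R) (hR : 0 < R)
    (hJ : truncMass (n + 1) s p R < ⊤) (hU : MemLp U (ENNReal.ofReal p) volume) :
    MemLp (fun z : E (n + 1) × E (n + 1) => U (crossVar z.1) * pairDiff (axialCutoff R) z)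
        (ENNReal.ofReal p) (gagliardoMeasure (n + 1) s p) ∧
      MemLp (fun z : E (n + 1) × E (n + 1) => U (crossVar z.2) * pairDiff (axialCutoff R) z)
        (ENNReal.ofReal p) (gagliardoMeasure (n + 1) s p) := by
  have hUc := aestronglyMeasurable_comp_crossVar hU.1
  have h : ∫⁻ z, ENNReal.ofReal (|U (crossVar z.1) * pairDiff (axialCutoff R) z| ^ p)
      ∂(gagliardoMeasure (n + 1) s p) < ⊤ :=
    (lintegral_fst_crossVar_mul_cutoff_le hp hL hR hU.1).trans_lt
      (ENNReal.mul_lt_top (by simp) (ENNReal.mul_lt_top (ENNReal.mul_lt_top ENNReal.ofReal_lt_top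
        ((memLp_ofReal_iff hp hU.1).1 hU)) hJ))
  rw [memLp_ofReal_iff hp (aestronglyMeasurable_fst_mul_cutoff hUc),
    memLp_ofReal_iff hp (aestronglyMeasurable_snd_mul_cutoff hUc), lintegral_snd_mul_cutoff_eq hUc]
  exact ⟨h, h⟩

/-- The localized difference is an admissible test function. -/
lemma memW0_locDiff (hn : 1 ≤ n) (hp : 2 < p) (hs : 0 < s) (hL : L = 2 * R) (hR : 0 < R)
    (hJ : truncMass (n + 1) s p R < ⊤) (hu : MemW0 s p (cylDomain ω L) u) (hU : MemW0 s p ω U) :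
    MemW0 s p (cylDomain ω L) (locDiff R u U) := by
  have hp0 : 0 < p := by linarith
  have hsp : 0 < s * p := mul_pos hs hp0
  have hUc := aestronglyMeasurable_comp_crossVar hU.memLp.1
  have hζ : AEStronglyMeasurable (axialCutoff R : E (n + 1) → ℝ) volume :=
    (continuous_axialCutoff R).aestronglyMeasurable
  refine memW0_of_memLp hp0 ?_ ?_ ?_
  -- Since ζ vanishes off the slab, U(X₂) may be replaced by its restriction to the slab, which is
  -- p-integrable.
  · have h1 : MemLp ((slab n L).indicator fun x => U (crossVar x)) (ENNReal.ofReal p) volume := by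
      rw [memLp_ofReal_iff hp0 (hUc.indicator (measurableSet_slab L))]
      have h2 : ∫⁻ x, ENNReal.ofReal (|(slab n L).indicator (fun x => U (crossVar x)) x| ^ p) =
          ∫⁻ x, (slab n L).indicator 1 x * ENNReal.ofReal (|U (crossVar x)| ^ p) := by
        refine lintegral_congr fun x => ?_
        by_cases hx : x ∈ slab n L <;> simp [hx, Real.zero_rpow hp0.ne']
      rw [h2, lintegral_slab_abs_rpow_crossVar hU.memLp.1]
      exact ENNReal.mul_lt_top ENNReal.ofReal_lt_top ((memLp_ofReal_iff hp0 hU.memLp.1).1 hU.memLp)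
    refine (hu.memLp.sub h1).mono ((hζ.pow 2).mul (hu.memLp.1.sub hUc))
      (Eventually.of_forall fun x => ?_)
    by_cases hx : x ∈ slab n L
    · rw [Pi.sub_apply, indicator_of_mem hx, locDiff, norm_mul]
      refine mul_le_of_le_one_left (norm_nonneg _) ?_
      rw [Real.norm_eq_abs, abs_of_nonneg (by positivity)]
      exact pow_le_one₀ (axialCutoff_mem R x).1 (axialCutoff_mem R x).2
    · rw [locDiff_eq_zero hL hR hx, norm_zero]
      exact norm_nonneg _
  -- Dζ² is factored as (ζ(x) + ζ(y)) Dζ and the differences of U are cut to the pairs meeting the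
  -- slab; each term is then a bounded factor times an L^p function.
  · have e : pairDiff (locDiff R u U) = fun z =>
        meanCutoff R z * (pairDiff u z -
          (slabPairs n L).indicator (pairDiff fun x => U (crossVar x)) z) +
        (axialCutoff R z.1 + axialCutoff R z.2) *
          ((u z.1 * pairDiff (axialCutoff R) z + u z.2 * pairDiff (axialCutoff R) z -
            U (crossVar z.1) * pairDiff (axialCutoff R) z -
            U (crossVar z.2) * pairDiff (axialCutoff R) z) * (1 / 2)) := by
      funext z
      by_cases hz : z ∈ slabPairs n L
      · rw [pairDiff_locDiff, indicator_of_mem hz]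
        simp only [pairDiff]
        ring
      · rw [pairDiff_locDiff_eq_zero hL hR hz, meanCutoff_eq_zero hL hR hz,
          pairDiff_axialCutoff_eq_zero hL hR hz]
        ring
    rw [e]
    have hζc : Continuous (axialCutoff R : E (n + 1) → ℝ) := continuous_axialCutoff R
    have hmc : Continuous (meanCutoff R : E (n + 1) × E (n + 1) → ℝ) := by
      unfold meanCutoff
      fun_prop
    refine MemLp.add ?_ ?_
    · have h1 := (hu.memLp_pairDiff hp0).sub (memLp_slabPairs_crossVar (L := L) hn hsp hp0
        hU.memLp.1 hU.gagliardo_lt_top)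
      refine h1.mono (hmc.aestronglyMeasurable.mul h1.1) (Eventually.of_forall fun z => ?_)
      rw [norm_mul]
      refine mul_le_of_le_one_left (norm_nonneg _) ?_
      rw [Real.norm_eq_abs, abs_of_nonneg (meanCutoff_nonneg z)]
      exact meanCutoff_le_one z
    · obtain ⟨a1, a2⟩ := memLp_mul_cutoff (s := s) hp0 hR hJ hu.memLp
      obtain ⟨b1, b2⟩ := memLp_crossVar_mul_cutoff (s := s) hp0 hL hR hJ hU.memLp
      have h1 := ((a1.add a2).sub b1).sub b2
      refine h1.mono ((Continuous.aestronglyMeasurable (by fun_prop)).mul (h1.1.mul_const _))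
        (Eventually.of_forall fun z => ?_)
      simp only [Pi.add_apply, Pi.sub_apply]
      rw [norm_mul, norm_mul, Real.norm_eq_abs (axialCutoff R z.1 + _),
        abs_of_nonneg (add_nonneg (axialCutoff_mem R z.1).1 (axialCutoff_mem R z.2).1)]
      have h2 : axialCutoff R z.1 + axialCutoff R z.2 ≤ 2 := by
        linarith [(axialCutoff_mem R z.1).2, (axialCutoff_mem R z.2).2]
      rw [mul_comm, mul_assoc]
      refine mul_le_of_le_one_right (norm_nonneg _) ?_
      rw [Real.norm_eq_abs, abs_of_pos (by norm_num)]
      linarith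
  · have h1 := quasiMeasurePreserving_crossVar.ae hU.zero_outside
    filter_upwards [hu.zero_outside, h1] with x hx1 hx2 hx
    by_cases hxs : x ∈ slab n L
    · have hxω : crossVar x ∉ ω := fun h => hx ⟨hxs, h⟩
      rw [locDiff, hx1 hx, hx2 hxω, sub_zero, mul_zero]
    · exact locDiff_eq_zero hL hR hxs

/-- The differences of the test function vanish on pairs missing the slab, so only the part of DU
where it is p-integrable contributes. -/
lemma integrable_phi_crossVar_mul_locDiff (hn : 1 ≤ n) (hp : 2 < p) (hs : 0 < s) (hL : L = 2 * R)
    (hR : 0 < R) (hJ : truncMass (n + 1) s p R < ⊤) (hu : MemW0 s p (cylDomain ω L) u)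
    (hU : MemW0 s p ω U) :
    Integrable (fun z => phi p (pairDiff (fun x => U (crossVar x)) z) *
      pairDiff (locDiff R u U) z) (gagliardoMeasure (n + 1) s p) := by
  have hp0 : 0 < p := by linarith
  have hb := memLp_slabPairs_crossVar (L := L) hn (mul_pos hs hp0) hp0 hU.memLp.1
    hU.gagliardo_lt_top
  have hv := (memW0_locDiff hn hp hs hL hR hJ hu hU).memLp_pairDiff hp0
  refine (integrable_phi_mul hp hb hv).congr (Eventually.of_forall fun z => ?_)
  by_cases hz : z ∈ slabPairs n L
  · simp only [indicator_of_mem hz]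
  · simp only [pairDiff_locDiff_eq_zero hL hR hz, mul_zero]

/-- The localized energy of the difference is controlled by the difference of the weak forms tested
with `ζ² (u - U)`, up to an error controlled by the energies. -/
lemma localized_energy_le (hn : 1 ≤ n) (hp : 2 < p) (hs : 0 < s) (hL : L = 2 * R) (hR : 0 < R)
    (hu : MemW0 s p (cylDomain ω L) u) (hU : MemW0 s p ω U) {β j eu eU nu nU : ℝ} (hβ : 0 < β)
    (hj : 0 ≤ j) (heu : 0 ≤ eu) (heU : 0 ≤ eU) (hnu : 0 ≤ nu) (hnU : 0 ≤ nU)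
    (hJ : truncMass (n + 1) s p R ≤ ENNReal.ofReal j)
    (hgu : gagliardoPow s p u ≤ ENNReal.ofReal eu) (hgU : gagliardoPow s p U ≤ ENNReal.ofReal eU)
    (hlu : ∫⁻ x, ENNReal.ofReal (|u x| ^ p) ≤ ENNReal.ofReal nu)
    (hlU : ∫⁻ X, ENNReal.ofReal (|U X| ^ p) ≤ ENNReal.ofReal nU) :
    let I := (∫ z, phi p (pairDiff u z) * pairDiff (locDiff R u U) z
        ∂(gagliardoMeasure (n + 1) s p)) -
      ∫ z, phi p (pairDiff (fun x => U (crossVar x)) z) * pairDiff (locDiff R u U) z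
        ∂(gagliardoMeasure (n + 1) s p)
    let B := β ^ p * (2 ^ p * (eu + 2 * (2 * L * sliceConst n s p * eU))) +
      (4 * (p - 1)) ^ p * (β⁻¹ ^ (p - 2)) ^ p *
        (2 ^ p * (2 * (nu * j) + 2 * (2 * (2 * L * nU * j))))
    0 ≤ I + B ∧
      ∫⁻ z, ENNReal.ofReal (2⁻¹ ^ p * (meanCutoff R z *
          |pairDiff (fun x => u x - U (crossVar x)) z| ^ p)) ∂(gagliardoMeasure (n + 1) s p) ≤
        ENNReal.ofReal (I + B) := by
  intro I B
  have hp0 : 0 < p := by linarith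
  have hsp : 0 < s * p := mul_pos hs hp0
  have hL0 : 0 < L := by linarith
  have hκ := (sliceConst_pos (n := n) hsp).le
  have hJt : truncMass (n + 1) s p R < ⊤ := hJ.trans_lt ENNReal.ofReal_lt_top
  set χb := (slabPairs n L).indicator (pairDiff fun x => U (crossVar x)) with hχb
  set v := locDiff R u U with hv
  have ha := hu.memLp_pairDiff hp0
  have hb : MemLp χb (ENNReal.ofReal p) (gagliardoMeasure (n + 1) s p) :=
    memLp_slabPairs_crossVar (L := L) hn hsp hp0 hU.memLp.1 hU.gagliardo_lt_top
  have hvL := (memW0_locDiff hn hp hs hL hR hJt hu hU).memLp_pairDiff hp0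
  obtain ⟨a1, a2⟩ := memLp_mul_cutoff (s := s) hp0 hR hJt hu.memLp
  obtain ⟨b1, b2⟩ := memLp_crossVar_mul_cutoff (s := s) hp0 hL hR hJt hU.memLp
  have hUc := aestronglyMeasurable_comp_crossVar hU.memLp.1
  set K := (4 * (p - 1)) ^ p * (β⁻¹ ^ (p - 2)) ^ p with hK
  have hK0 : 0 ≤ K := mul_nonneg (Real.rpow_nonneg (by linarith) _) (by positivity)
  -- An integrable majorant of the error in `phi_localized_monotone`: DU is cut to the pairs meeting
  -- the slab, and the mean of u − U times Dζ is split into its four terms.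
  set err : E (n + 1) × E (n + 1) → ℝ := fun z =>
    β ^ p * (2 ^ p * (|pairDiff u z| ^ p + |χb z| ^ p)) +
      K * (2 ^ p * (|u z.1 * pairDiff (axialCutoff R) z| ^ p +
        |u z.2 * pairDiff (axialCutoff R) z| ^ p +
        |U (crossVar z.1) * pairDiff (axialCutoff R) z| ^ p +
        |U (crossVar z.2) * pairDiff (axialCutoff R) z| ^ p)) with herr
  have ia := ha.integrable_abs_rpow hp0
  have ib := hb.integrable_abs_rpow hp0
  have ia1 := a1.integrable_abs_rpow hp0
  have ia2 := a2.integrable_abs_rpow hp0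
  have ib1 := b1.integrable_abs_rpow hp0
  have ib2 := b2.integrable_abs_rpow hp0
  have ierr : Integrable err (gagliardoMeasure (n + 1) s p) :=
    (((ia.add ib).const_mul _).const_mul _).add
      (((((ia1.add ia2).add ib1).add ib2).const_mul _).const_mul _)
  have hsplit : ∀ a b : ℝ, 0 ≤ a → ENNReal.ofReal (2 * (2 * L * a * b)) =
      2 * (ENNReal.ofReal (2 * L) * ENNReal.ofReal a * ENNReal.ofReal b) := by
    intro a b ha
    have h2L : 0 ≤ 2 * L := by positivity
    rw [← ENNReal.ofReal_mul h2L, ← ENNReal.ofReal_mul (mul_nonneg h2L ha),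
      ← ENNReal.ofReal_ofNat, ← ENNReal.ofReal_mul (by norm_num)]
  have hfst : ∫⁻ z, ENNReal.ofReal (|u z.1 * pairDiff (axialCutoff R) z| ^ p)
      ∂(gagliardoMeasure (n + 1) s p) ≤ ENNReal.ofReal (nu * j) := by
    rw [ENNReal.ofReal_mul hnu]
    exact (lintegral_fst_mul_cutoff_le hp0 hR hu.memLp.1).trans (mul_le_mul' hlu hJ)
  have hfstU : ∫⁻ z, ENNReal.ofReal (|U (crossVar z.1) * pairDiff (axialCutoff R) z| ^ p)
      ∂(gagliardoMeasure (n + 1) s p) ≤ ENNReal.ofReal (2 * (2 * L * nU * j)) := by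
    refine (lintegral_fst_crossVar_mul_cutoff_le hp0 hL hR hU.memLp.1).trans ?_
    rw [hsplit nU j hnU]
    gcongr
  have hB : ∫ z, err z ∂(gagliardoMeasure (n + 1) s p) ≤ B := by
    have e1 : ∫ z, err z ∂(gagliardoMeasure (n + 1) s p) =
        β ^ p * (2 ^ p * ((∫ z, |pairDiff u z| ^ p ∂(gagliardoMeasure (n + 1) s p)) +
          ∫ z, |χb z| ^ p ∂(gagliardoMeasure (n + 1) s p))) +
        K * (2 ^ p * ((∫ z, |u z.1 * pairDiff (axialCutoff R) z| ^ p
            ∂(gagliardoMeasure (n + 1) s p)) +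
          (∫ z, |u z.2 * pairDiff (axialCutoff R) z| ^ p ∂(gagliardoMeasure (n + 1) s p)) +
          (∫ z, |U (crossVar z.1) * pairDiff (axialCutoff R) z| ^ p
            ∂(gagliardoMeasure (n + 1) s p)) +
          ∫ z, |U (crossVar z.2) * pairDiff (axialCutoff R) z| ^ p
            ∂(gagliardoMeasure (n + 1) s p))) := by
      have j1 : Integrable (fun z => |u z.1 * pairDiff (axialCutoff R) z| ^ p +
          |u z.2 * pairDiff (axialCutoff R) z| ^ p) (gagliardoMeasure (n + 1) s p) := ia1.add ia2
      have j2 : Integrable (fun z => |u z.1 * pairDiff (axialCutoff R) z| ^ p +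
          |u z.2 * pairDiff (axialCutoff R) z| ^ p +
          |U (crossVar z.1) * pairDiff (axialCutoff R) z| ^ p)
          (gagliardoMeasure (n + 1) s p) := j1.add ib1
      have j4 : Integrable (fun z => |u z.1 * pairDiff (axialCutoff R) z| ^ p +
          |u z.2 * pairDiff (axialCutoff R) z| ^ p +
          |U (crossVar z.1) * pairDiff (axialCutoff R) z| ^ p +
          |U (crossVar z.2) * pairDiff (axialCutoff R) z| ^ p)
          (gagliardoMeasure (n + 1) s p) := j2.add ib2
      have j3 : Integrable (fun z => |pairDiff u z| ^ p + |χb z| ^ p)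
          (gagliardoMeasure (n + 1) s p) := ia.add ib
      rw [← integral_add ia ib, ← integral_add ia1 ia2, ← integral_add j1 ib1,
        ← integral_add j2 ib2, ← integral_const_mul, ← integral_const_mul,
        ← integral_const_mul, ← integral_const_mul,
        ← integral_add ((j3.const_mul _).const_mul _) ((j4.const_mul _).const_mul _)]
    rw [e1]
    have h1 : ∫ z, |pairDiff u z| ^ p ∂(gagliardoMeasure (n + 1) s p) ≤ eu :=
      integral_abs_rpow_le ha.1 heu (by rw [← gagliardoPow_eq]; exact hgu)
    have h2 : ∫ z, |χb z| ^ p ∂(gagliardoMeasure (n + 1) s p) ≤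
        2 * (2 * L * sliceConst n s p * eU) := by
      refine integral_abs_rpow_le hb.1 (by positivity)
        ((lintegral_slabPairs_crossVar_le hn hsp hp0 hU.memLp.1).trans ?_)
      rw [hsplit _ eU hκ]
      gcongr
    have h3 := integral_abs_rpow_le a1.1 (by positivity) hfst
    have h4 := integral_abs_rpow_le a2.1 (by positivity)
      ((lintegral_snd_mul_cutoff_eq hu.memLp.1).le.trans hfst)
    have h5 := integral_abs_rpow_le b1.1 (by positivity) hfstU
    have h6 := integral_abs_rpow_le b2.1 (by positivity)
      ((lintegral_snd_mul_cutoff_eq hUc).le.trans hfstU)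
    have h7 := mul_le_mul_of_nonneg_left (mul_le_mul_of_nonneg_left (add_le_add h1 h2)
      (by positivity : (0 : ℝ) ≤ 2 ^ p)) (by positivity : 0 ≤ β ^ p)
    have h8 := mul_le_mul_of_nonneg_left (mul_le_mul_of_nonneg_left
      (add_le_add (add_le_add (add_le_add h3 h4) h5) h6)
      (by positivity : (0 : ℝ) ≤ 2 ^ p)) hK0
    refine (add_le_add h7 h8).trans (le_of_eq ?_)
    simp only [B]
    ring
  have iΦ1 := integrable_phi_mul hp ha hvL
  have iΦ2 := integrable_phi_crossVar_mul_locDiff hn hp hs hL hR hJt hu hU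
  set Φ : E (n + 1) × E (n + 1) → ℝ := fun z => phi p (pairDiff u z) * pairDiff v z -
    phi p (pairDiff (fun x => U (crossVar x)) z) * pairDiff v z with hΦ
  have iΦ : Integrable Φ (gagliardoMeasure (n + 1) s p) := iΦ1.sub iΦ2
  have hI : ∫ z, Φ z ∂(gagliardoMeasure (n + 1) s p) = I := integral_sub iΦ1 iΦ2
  have hpt : ∀ z, 2⁻¹ ^ p * (meanCutoff R z *
      |pairDiff (fun x => u x - U (crossVar x)) z| ^ p) ≤ Φ z + err z := by
    intro z
    by_cases hz : z ∈ slabPairs n L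
    · have hkey := phi_localized_monotone hp hβ (pairDiff u z)
        (pairDiff (fun x => U (crossVar x)) z)
        ((u z.1 + u z.2 - U (crossVar z.1) - U (crossVar z.2)) / 2)
        (axialCutoff_mem R z.1) (axialCutoff_mem R z.2)
      have e1 : pairDiff (fun x => u x - U (crossVar x)) z =
          pairDiff u z - pairDiff (fun x => U (crossVar x)) z := by
        simp only [pairDiff]
        ring
      have e2 : (phi p (pairDiff u z) - phi p (pairDiff (fun x => U (crossVar x)) z)) *
          pairDiff v z = Φ z := by
        simp only [hΦ]
        ring
      rw [e1]
      change 2⁻¹ ^ p * (meanCutoff R z * _) ≤ _ * (meanCutoff R z * _ + _) + _ at hkey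
      rw [← pairDiff_locDiff, e2] at hkey
      refine hkey.trans (add_le_add le_rfl (add_le_add ?_ ?_))
      · rw [hχb, indicator_of_mem hz]
        exact mul_le_mul_of_nonneg_left
          (add_rpow_le_two_rpow hp0.le (abs_nonneg _) (abs_nonneg _)) (by positivity)
      · refine mul_le_mul_of_nonneg_left ?_ hK0
        have e3 : |(u z.1 + u z.2 - U (crossVar z.1) - U (crossVar z.2)) / 2| ^ p *
            |axialCutoff R z.1 - axialCutoff R z.2| ^ p =
            |(u z.1 * pairDiff (axialCutoff R) z + u z.2 * pairDiff (axialCutoff R) z -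
              U (crossVar z.1) * pairDiff (axialCutoff R) z -
              U (crossVar z.2) * pairDiff (axialCutoff R) z) / 2| ^ p := by
          rw [← Real.mul_rpow (abs_nonneg _) (abs_nonneg _), ← abs_mul]
          congr 2
          simp only [pairDiff]
          ring
        rw [e3]
        exact abs_half_sum_rpow_le hp0.le _ _ _ _
    · have h0 : 0 ≤ err z := by positivity
      simp only [hΦ, hv, meanCutoff_eq_zero hL hR hz, pairDiff_locDiff_eq_zero hL hR hz, zero_mul,
        mul_zero, sub_zero, zero_add]
      exact h0
  have hpt0 : ∀ z, 0 ≤ Φ z + err z := fun z =>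
    le_trans (mul_nonneg (by positivity) (mul_nonneg (meanCutoff_nonneg z) (by positivity))) (hpt z)
  have hint : ∫ z, (Φ z + err z) ∂(gagliardoMeasure (n + 1) s p) ≤ I + B := by
    rw [integral_add iΦ ierr, hI]
    linarith
  refine ⟨(integral_nonneg hpt0).trans hint, ?_⟩
  refine (lintegral_mono fun z => ENNReal.ofReal_le_ofReal (hpt z)).trans ?_
  have iΦe : Integrable (fun z => Φ z + err z) (gagliardoMeasure (n + 1) s p) := iΦ.add ierr
  rw [← ofReal_integral_eq_lintegral_ofReal iΦe (Eventually.of_forall hpt0)]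
  exact ENNReal.ofReal_le_ofReal hint

end localized

/-! ### Integration in time -/

/-- Integration in time of a differential inequality for the square of the norm of a curve starting
at `0`. -/
lemma norm_sq_le_and_lintegral_le {H : Type*} [NormedAddCommGroup H] [InnerProductSpace ℝ H]
    [CompleteSpace H] {T C D : ℝ} (hT : 0 < T) (hC : 0 < C) {W h : ℝ → H}
    (hW : ContinuousOn W (Icc 0 T)) (hW0 : W 0 = 0)
    (hint : ∀ a b, 0 < a → a ≤ b → b ≤ T → IntervalIntegrable h volume a b ∧
      W b = W a + ∫ r in a..b, h r)
    {bd : ℝ → ℝ} (hbd0 : ∀ᵐ t ∂(volume.restrict (Ioo 0 T)), 0 ≤ bd t)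
    (hbd : ∀ a, 0 < a → a ≤ T → IntervalIntegrable bd volume a T ∧ ∫ t in a..T, bd t ≤ D)
    {P : ℝ → ℝ≥0∞}
    (hP : ∀ᵐ t ∂(volume.restrict (Ioo 0 T)), 0 ≤ -C * inner ℝ (W t) (h t) + bd t ∧
      P t ≤ ENNReal.ofReal (-C * inner ℝ (W t) (h t) + bd t)) :
    (∀ t ∈ Icc 0 T, C / 2 * ‖W t‖ ^ 2 ≤ D) ∧ ∫⁻ t in Ioo 0 T, P t ≤ ENNReal.ofReal D := by
  have hD : 0 ≤ D := by
    have := (hbd T hT le_rfl).2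
    rwa [intervalIntegral.integral_same] at this
  set q : ℝ → ℝ := fun t => -C * inner ℝ (W t) (h t) + bd t with hq
  have hsub : ∀ a b, 0 ≤ a → b ≤ T →
      (ae (volume.restrict (Ioo a b))) ≤ ae (volume.restrict (Ioo 0 T)) := fun a b ha hb =>
    ae_mono (Measure.restrict_mono (Ioo_subset_Ioo ha hb) le_rfl)
  have hbdle : ∀ a b, 0 < a → a ≤ b → b ≤ T → IntervalIntegrable bd volume a b ∧
      ∫ t in a..b, bd t ≤ D := by
    intro a b ha hab hb
    have h1 := (hbd a ha (hab.trans hb)).1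
    have h2 : IntervalIntegrable bd volume a b :=
      h1.mono_set (by rw [uIcc_of_le hab, uIcc_of_le (hab.trans hb)]; exact Icc_subset_Icc_right hb)
    have h3 := (hbd b (ha.trans_le hab) hb).1
    refine ⟨h2, ?_⟩
    have h4 : 0 ≤ ∫ t in b..T, bd t := by
      rw [intervalIntegral.integral_of_le hb, integral_Ioc_eq_integral_Ioo]
      exact integral_nonneg_of_ae (hsub b T (ha.le.trans hab) le_rfl hbd0)
    have h5 := intervalIntegral.integral_add_adjacent_intervals h2 h3
    linarith [(hbd a ha (hab.trans hb)).2]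
  have hchain : ∀ a b, 0 < a → a ≤ b → b ≤ T → IntervalIntegrable q volume a b ∧
      ∫ t in a..b, q t ≤ C / 2 * ‖W a‖ ^ 2 - C / 2 * ‖W b‖ ^ 2 + D := by
    intro a b ha hab hb
    obtain ⟨h1, h2⟩ := norm_sq_sub_norm_sq_eq_integral hab (hint a b ha hab hb).1
      (fun t ht => (hint a t ha ht.1 (ht.2.trans hb)).2)
    obtain ⟨h3, h4⟩ := hbdle a b ha hab hb
    have h5 : IntervalIntegrable (fun t => inner ℝ (W t) (h t)) volume a b := by
      simpa using h1.const_mul (1 / 2)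
    have h6 : IntervalIntegrable (fun t => -C * inner ℝ (W t) (h t)) volume a b := h5.const_mul _
    refine ⟨h6.add h3, ?_⟩
    rw [intervalIntegral.integral_const_mul] at h2
    rw [intervalIntegral.integral_add h6 h3, intervalIntegral.integral_const_mul]
    have : -C * ∫ t in a..b, inner ℝ (W t) (h t) = -(C / 2) * (‖W b‖ ^ 2 - ‖W a‖ ^ 2) := by
      rw [h2]
      ring
    rw [this]
    linarith
  have hlim : Tendsto (fun a => C / 2 * ‖W a‖ ^ 2 + D) (𝓝[>] 0) (𝓝 D) := by
    have h1 := ((((tendsto_nhdsWithin_Ioi_of_continuousOn_Icc hT hW).norm.pow 2).const_mul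
      (C / 2)).add_const D)
    simpa [hW0] using h1
  constructor
  · intro t ht
    rcases ht.1.eq_or_lt with h0 | h0
    · rw [← h0, hW0]
      simpa using hD
    · refine ge_of_tendsto hlim ?_
      filter_upwards [Ioo_mem_nhdsGT h0] with a ha
      have h1 := (hchain a t ha.1 ha.2.le ht.2).2
      have h2 : 0 ≤ ∫ t in a..t, q t := by
        rw [intervalIntegral.integral_of_le ha.2.le, integral_Ioc_eq_integral_Ioo]
        refine integral_nonneg_of_ae ?_
        filter_upwards [hsub a t ha.1.le ht.2 hP] with r hr using hr.1
      linarith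
  -- Away from 0 the integrals make sense, with a bound tending to D because W(0) = 0; monotone
  -- exhaustion by the intervals (T/(k+2), T) then reaches (0, T).
  · have hpart : ∀ a ∈ Ioo 0 T, ∫⁻ t in Ioo a T, P t ≤
        ENNReal.ofReal (C / 2 * ‖W a‖ ^ 2 + D) := by
      intro a ha
      obtain ⟨h1, h2⟩ := hchain a T ha.1 ha.2.le le_rfl
      have hPa := hsub a T ha.1.le le_rfl hP
      calc ∫⁻ t in Ioo a T, P t ≤ ∫⁻ t in Ioo a T, ENNReal.ofReal (q t) := by
            refine lintegral_mono_ae ?_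
            filter_upwards [hPa] with t ht using ht.2
        _ = ENNReal.ofReal (∫ t in a..T, q t) := by
            rw [intervalIntegral.integral_of_le ha.2.le, integral_Ioc_eq_integral_Ioo,
              ofReal_integral_eq_lintegral_ofReal]
            · exact (intervalIntegrable_iff_integrableOn_Ioo_of_le ha.2.le).1 h1
            · filter_upwards [hPa] with t ht using ht.1
        _ ≤ _ := by
            apply ENNReal.ofReal_le_ofReal
            have : 0 ≤ C / 2 * ‖W T‖ ^ 2 := by positivity
            linarith
    have hlim' : Tendsto (fun a => ENNReal.ofReal (C / 2 * ‖W a‖ ^ 2 + D)) (𝓝[>] 0)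
        (𝓝 (ENNReal.ofReal D)) := (ENNReal.continuous_ofReal.tendsto D).comp hlim
    have hU : Ioo 0 T = ⋃ k : ℕ, Ioo (T / (k + 2)) T := by
      refine Subset.antisymm ?_ (iUnion_subset fun k => Ioo_subset_Ioo_left (by positivity))
      rintro t ⟨h0, h1⟩
      obtain ⟨k, hk⟩ := exists_nat_gt (T / t)
      refine mem_iUnion.2 ⟨k, ?_, h1⟩
      rw [div_lt_iff₀ h0] at hk
      rw [div_lt_iff₀ (by positivity)]
      nlinarith
    have hanti : Antitone fun k : ℕ => T / ((k : ℝ) + 2) := fun i j hij => by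
      have : (i : ℝ) ≤ j := by exact_mod_cast hij
      simp only
      gcongr
    rw [hU, setLIntegral_iUnion_of_directed _ (Monotone.directed_le fun i j hij =>
      Ioo_subset_Ioo_left (hanti hij))]
    refine iSup_le fun k => ge_of_tendsto hlim' ?_
    have hk : 0 < T / ((k : ℝ) + 2) := by positivity
    have hkT : T / ((k : ℝ) + 2) < T := by
      have : (0 : ℝ) ≤ k := k.cast_nonneg
      rw [div_lt_iff₀ (by positivity)]
      nlinarith
    filter_upwards [Ioo_mem_nhdsGT hk] with a ha
    exact (lintegral_mono_set (Ioo_subset_Ioo_left ha.2.le)).trans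
      (hpart a ⟨ha.1, ha.2.trans hkT⟩)

/-! ### Multiplication by the cutoff as an operator on L² -/

/-- A bounded weighted composition operator between `L²` spaces. -/
lemma exists_weightedComp {α β : Type*} {mα : MeasurableSpace α} {mβ : MeasurableSpace β}
    {μ : Measure α} {ν : Measure β} {φ : β → α} (hφ : Measure.QuasiMeasurePreserving φ ν μ)
    {m : β → ℝ} (hm : AEStronglyMeasurable m ν) (C : ℝ≥0)
    (hC : ∀ f : α → ℝ, MemLp f 2 μ → eLpNorm (fun y => m y * f (φ y)) 2 ν ≤ C * eLpNorm f 2 μ) :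
    ∃ A : Lp ℝ 2 μ →L[ℝ] Lp ℝ 2 ν, ∀ f, A f =ᵐ[ν] fun y => m y * f (φ y) := by
  have hmem : ∀ f : Lp ℝ 2 μ, MemLp (fun y => m y * f (φ y)) 2 ν := fun f =>
    ⟨hm.mul ((Lp.aestronglyMeasurable f).comp_quasiMeasurePreserving hφ),
      (hC f (Lp.memLp f)).trans_lt (ENNReal.mul_lt_top ENNReal.coe_lt_top (Lp.eLpNorm_lt_top f))⟩
  let A : Lp ℝ 2 μ →ₗ[ℝ] Lp ℝ 2 ν :=
    { toFun := fun f => (hmem f).toLp _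
      map_add' := fun f g => by
        ext1
        have h1 := hφ.ae_eq_comp (Lp.coeFn_add f g)
        filter_upwards [(hmem (f + g)).coeFn_toLp, (hmem f).coeFn_toLp, (hmem g).coeFn_toLp,
          Lp.coeFn_add ((hmem f).toLp _) ((hmem g).toLp _), h1] with y e1 e2 e3 e4 e5
        simp only [Function.comp_apply, Pi.add_apply] at e5
        rw [e1, e4, Pi.add_apply, e2, e3, e5, mul_add]
      map_smul' := fun c f => by
        ext1
        have h1 := hφ.ae_eq_comp (Lp.coeFn_smul c f)
        filter_upwards [(hmem (c • f)).coeFn_toLp, (hmem f).coeFn_toLp,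
          Lp.coeFn_smul c ((hmem f).toLp _), h1] with y e1 e2 e4 e5
        simp only [Function.comp_apply, Pi.smul_apply, smul_eq_mul] at e5
        simp only [RingHom.id_apply]
        rw [e1, e4, Pi.smul_apply, e2, e5, smul_eq_mul]
        ring }
  refine ⟨A.mkContinuous C fun f => ?_, fun f => (hmem f).coeFn_toLp⟩
  change ‖(hmem f).toLp _‖ ≤ _
  rw [Lp.norm_toLp, Lp.norm_def, ← ENNReal.coe_toReal C, ← ENNReal.toReal_mul]
  exact ENNReal.toReal_mono (ENNReal.mul_ne_top ENNReal.coe_ne_top (Lp.eLpNorm_ne_top f))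
    (hC f (Lp.memLp f))

section cutoffOperators

variable {n : ℕ} {R L : ℝ} {ω : Set (E n)}

lemma eLpNorm_two_eq {α : Type*} {m : MeasurableSpace α} {μ : Measure α} (f : α → ℝ) :
    eLpNorm f 2 μ = (∫⁻ x, ENNReal.ofReal (|f x| ^ (2 : ℝ)) ∂μ) ^ (1 / 2 : ℝ) := by
  rw [eLpNorm_eq_lintegral_rpow_enorm_toReal (by norm_num) (by norm_num)]
  simp_rw [Real.enorm_eq_ofReal_abs]
  congr 1
  refine lintegral_congr fun x => ?_
  rw [ENNReal.toReal_ofNat, ENNReal.ofReal_rpow_of_nonneg (abs_nonneg _) (by norm_num)]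

/-- The `L²` norm over the cylinder of a function of the cross-section. -/
lemma eLpNorm_comp_crossVar (hω : MeasurableSet ω) {k : E n → ℝ}
    (hk : AEStronglyMeasurable k (volume.restrict ω)) :
    eLpNorm (fun x => k (crossVar x)) 2 (volume.restrict (cylDomain ω L)) =
      ENNReal.ofReal (2 * L) ^ (1 / 2 : ℝ) * eLpNorm k 2 (volume.restrict ω) := by
  rw [eLpNorm_two_eq, eLpNorm_two_eq, ← ENNReal.mul_rpow_of_nonneg _ _ (by norm_num),
    ← lintegral_cylDomain_comp_crossVar hω L (aemeasurable_abs_rpow hk 2)]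

lemma memLp_comp_crossVar (hω : MeasurableSet ω) {k : E n → ℝ}
    (hk : MemLp k 2 (volume.restrict ω)) :
    MemLp (fun x => k (crossVar x)) 2 (volume.restrict (cylDomain ω L)) := by
  have hq : Measure.QuasiMeasurePreserving (crossVar : E (n + 1) → E n)
      (volume.restrict (cylDomain ω L)) (volume.restrict ω) :=
    quasiMeasurePreserving_crossVar.restrict fun x hx => hx.2
  refine ⟨hk.1.comp_quasiMeasurePreserving hq, ?_⟩
  rw [eLpNorm_comp_crossVar hω hk.1]
  exact ENNReal.mul_lt_top (ENNReal.rpow_lt_top_of_nonneg (by norm_num) ENNReal.ofReal_ne_top) hk.2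

lemma eLpNorm_cutoff_mul_comp_crossVar_le (hL : L = 2 * R) (hR : 0 < R) {k : E n → ℝ}
    (hk : MemLp k 2 volume) :
    eLpNorm (fun x : E (n + 1) => axialCutoff R x * k (crossVar x)) 2 volume ≤
      (ENNReal.ofReal (2 * L) ^ (1 / 2 : ℝ)).toNNReal * eLpNorm k 2 volume := by
  have hfin : ENNReal.ofReal (2 * L) ^ (1 / 2 : ℝ) ≠ ⊤ :=
    ENNReal.rpow_ne_top_of_nonneg (by norm_num) ENNReal.ofReal_ne_top
  have hm : MeasurableSet (cylDomain (univ : Set (E n)) L) :=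
    (measurableSet_slab L).inter (measurable_crossVar MeasurableSet.univ)
  have h := eLpNorm_comp_crossVar (L := L) (k := k) MeasurableSet.univ
    (by rw [Measure.restrict_univ]; exact hk.1)
  rw [Measure.restrict_univ] at h
  rw [ENNReal.coe_toNNReal hfin, ← h, ← eLpNorm_indicator_eq_eLpNorm_restrict hm]
  refine eLpNorm_mono fun x => ?_
  by_cases hx : x ∈ slab n L
  · have : x ∈ cylDomain (univ : Set (E n)) L := ⟨hx, mem_univ _⟩
    rw [indicator_of_mem this, norm_mul]
    refine mul_le_of_le_one_left (norm_nonneg _) ?_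
    rw [Real.norm_eq_abs, abs_of_nonneg (axialCutoff_mem R x).1]
    exact (axialCutoff_mem R x).2
  · rw [axialCutoff_eq_zero hL hR hx, zero_mul, norm_zero]
    exact norm_nonneg _

/-- Restriction to the slab of a function of the cross-section, by the cutoff. -/
lemma exists_cutoffExtension (hL : L = 2 * R) (hR : 0 < R) :
    ∃ A : L2 n →L[ℝ] L2 (n + 1), ∀ k, A k =ᵐ[volume] fun x => axialCutoff R x * k (crossVar x) :=
  exists_weightedComp quasiMeasurePreserving_crossVar
    (continuous_axialCutoff R).aestronglyMeasurable _
    fun _ hk => eLpNorm_cutoff_mul_comp_crossVar_le hL hR hk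

/-- Multiplication by the cutoff. -/
lemma exists_cutoffMul (R : ℝ) :
    ∃ A : L2 (n + 1) →L[ℝ] L2 (n + 1), ∀ k, A k =ᵐ[volume] fun x => axialCutoff R x * k x := by
  refine exists_weightedComp (φ := id) (Measure.QuasiMeasurePreserving.id _)
    (continuous_axialCutoff R).aestronglyMeasurable 1 fun f hf => ?_
  rw [ENNReal.coe_one, one_mul]
  refine eLpNorm_mono fun x => ?_
  rw [norm_mul]
  refine mul_le_of_le_one_left (norm_nonneg _) ?_
  rw [Real.norm_eq_abs, abs_of_nonneg (axialCutoff_mem R x).1]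
  exact (axialCutoff_mem R x).2

end cutoffOperators

/-! ### Comparison of the two solutions -/

section comparison

variable {n : ℕ} {s p T R L : ℝ} {ω : Set (E n)}

/-- Subtracting the two weak equations, tested with the localized difference and with its integral
along the axis, the sources cancel. -/
lemma inner_cutoff_sub_eq (hn : 1 ≤ n) (hp : 2 < p) (hs : 0 < s) (hs1 : s < 1)
    (hω : MeasurableSet ω) (hωfin : volume ω < ⊤) (hL : L = 2 * R) (hR : 0 < R)
    (hJ : truncMass (n + 1) s p R < ⊤) {u gu W h : L2 (n + 1)} {U gU : L2 n} {F : E n → ℝ}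
    (hF : MemLp F 2 (volume.restrict ω)) (hu : MemW0 s p (cylDomain ω L) u) (hU : MemW0 s p ω U)
    (hW : W =ᵐ[volume] fun x => axialCutoff R x * (u x - U (crossVar x)))
    (hh : h =ᵐ[volume] fun x => axialCutoff R x * (gu x - gU (crossVar x)))
    (hequ : ∀ v, MemW0 s p (cylDomain ω L) v → (∫ x, gu x * v x) + fracForm s p u v =
      ∫ x, (cylDomain ω L).indicator (fun x => F (crossVar x)) x * v x)
    (heqU : ∀ v, MemW0 s p ω v → (∫ X, gU X * v X) + fracForm s p U v =
      ∫ X, ω.indicator F X * v X) :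
    (∫ z, phi p (pairDiff u z) * pairDiff (locDiff R u U) z ∂(gagliardoMeasure (n + 1) s p)) -
      ∫ z, phi p (pairDiff (fun x => U (crossVar x)) z) * pairDiff (locDiff R u U) z
        ∂(gagliardoMeasure (n + 1) s p) = -(2 / fracConst (n + 1) s p) * inner ℝ W h := by
  have hp0 : 0 < p := by linarith
  have hsp : 0 < s * p := mul_pos hs hp0
  have hL0 : 0 < L := by linarith
  have hC : 0 < fracConst (n + 1) s p := fracConst_pos hs hs1 hp0
  have hcfin : volume (cylDomain ω L) < ⊤ := by
    rw [volume_cylDomain hω]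
    exact ENNReal.mul_lt_top ENNReal.ofReal_lt_top hωfin
  set v := locDiff R u U with hv
  have hvW : MemW0 s p (cylDomain ω L) v := memW0_locDiff hn hp hs hL hR hJ hu hU
  have hv0 : ∀ x, x ∉ slab n L → v x = 0 := fun x hx => locDiff_eq_zero hL hR hx
  have hvi := hvW.integrable (by linarith) hcfin
  have hVW : MemW0 s p ω (lineIntegral v) := hvW.lineIntegral hn hp hs hω hωfin hL0 hv0
  -- One power of ζ is kept aside: v = ζW with W in L², so v is in L² and the other ζ can make
  -- functions of X₂ square integrable.
  have hvζ : v =ᵐ[volume] fun x => axialCutoff R x * W x := by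
    filter_upwards [hW] with x hx
    rw [hx, hv, locDiff]
    ring
  have hWL := Lp.memLp W
  have hv2 : MemLp v 2 volume := by
    refine hWL.mono hvi.1 ?_
    filter_upwards [hvζ] with x hx
    rw [hx, norm_mul]
    refine mul_le_of_le_one_left (norm_nonneg _) ?_
    rw [Real.norm_eq_abs, abs_of_nonneg (axialCutoff_mem R x).1]
    exact (axialCutoff_mem R x).2
  have hprod : ∀ k : E n → ℝ, MemLp k 2 volume →
      Integrable (fun x : E (n + 1) => k (crossVar x) * v x) volume := by
    intro k hk
    have hζk : MemLp (fun x : E (n + 1) => axialCutoff R x * k (crossVar x)) 2 volume :=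
      ⟨(continuous_axialCutoff R).aestronglyMeasurable.mul (aestronglyMeasurable_comp_crossVar hk.1),
        (eLpNorm_cutoff_mul_comp_crossVar_le hL hR hk).trans_lt
          (ENNReal.mul_lt_top ENNReal.coe_lt_top hk.2)⟩
    refine (hζk.integrable_mul hWL).congr ?_
    filter_upwards [hvζ] with x hx
    rw [hx, Pi.mul_apply]
    ring
  have i1 : Integrable (fun x => gu x * v x) volume := (Lp.memLp gu).integrable_mul hv2
  have i2 := hprod gU (Lp.memLp gU)
  have i3 := hprod (ω.indicator F) ((memLp_indicator_iff_restrict hω).2 hF)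
  have hinner : inner ℝ W h = (∫ x, gu x * v x) - ∫ x, gU (crossVar x) * v x := by
    rw [inner_L2_eq_integral, ← integral_sub i1 i2]
    refine integral_congr_ae ?_
    filter_upwards [hvζ, hh] with x h1 h2
    rw [h1, h2]
    ring
  have e1 := hequ v hvW
  have e2 := heqU _ hVW
  have e3 : ∫ x, (cylDomain ω L).indicator (fun x => F (crossVar x)) x * v x =
      ∫ x, ω.indicator F (crossVar x) * v x := by
    refine integral_congr_ae (Eventually.of_forall fun x => ?_)
    by_cases hx : x ∈ slab n L
    · by_cases hxω : crossVar x ∈ ω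
      · have : x ∈ cylDomain ω L := ⟨hx, hxω⟩
        simp only [indicator_of_mem this, indicator_of_mem hxω]
      · have : x ∉ cylDomain ω L := fun h => hxω h.2
        simp only [indicator_of_notMem this, indicator_of_notMem hxω]
    · simp only [hv0 x hx, mul_zero]
  -- Both equations now contain the same source integral, and C_{n+1} times the slice constant
  -- replaces C_n, so the two forms share the factor C_{n+1}/2.
  rw [e3, fracForm_eq] at e1
  rw [integral_mul_lineIntegral i2, integral_mul_lineIntegral i3, fracForm_eq,
    ← fracConst_succ_mul_sliceConst hsp] at e2
  rw [integral_phi_crossVar_mul hn hsp hvi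
    (integrable_phi_crossVar_mul_locDiff hn hp hs hL hR hJ hu hU), hinner]
  field_simp
  linarith

end comparison

section comparison

variable {n : ℕ} {s p T R L : ℝ} {ω : Set (E n)}

/-- The energy estimate for the difference of the solutions in a cylinder and in its
cross-section. -/
lemma exists_cutoff_sub_le (hn : 1 ≤ n) (hp : 2 < p) (hs : 0 < s) (hs1 : s < 1) (hT : 0 < T)
    (hω : MeasurableSet ω) (hωfin : volume ω < ⊤) (hL : L = 2 * R) (hR : 0 < R)
    {β j c₁ c₂ : ℝ} (hβ : 0 < β) (hj : 0 ≤ j) (hc₁ : 0 ≤ c₁) (hc₂ : 0 ≤ c₂)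
    (hJ : truncMass (n + 1) s p R ≤ ENNReal.ofReal j)
    (hP₁ : ∀ w : E (n + 1) → ℝ, MemW0 s p (cylDomain ω L) w →
      ∫⁻ x, ENNReal.ofReal (|w x| ^ p) ≤ ENNReal.ofReal c₁ * gagliardoPow s p w)
    (hP₂ : ∀ w : E n → ℝ, MemW0 s p ω w →
      ∫⁻ X, ENNReal.ofReal (|w X| ^ p) ≤ ENNReal.ofReal c₂ * gagliardoPow s p w)
    {f : ℝ → E n → ℝ} {F : ℝ → ℝ} (hF0 : ∀ t, 0 ≤ F t) (hF : IntegrableOn F (Ioo 0 T))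
    (hf : ∀ᵐ t ∂(volume.restrict (Ioo 0 T)), MemLp (f t) 2 (volume.restrict ω) ∧
      eLpNorm (f t) 2 (volume.restrict ω) ≤ ENNReal.ofReal (F t))
    {u₀ : E n → ℝ} (hu₀m : AEStronglyMeasurable u₀ (volume.restrict ω)) {A : ℝ} (hA : 0 ≤ A)
    (hu₀ : eLpNorm u₀ 2 (volume.restrict ω) ≤ ENNReal.ofReal A)
    {uInf : ℝ → L2 n} (huInf : IsWeakSolution s p T ω f u₀ uInf) {u : ℝ → L2 (n + 1)}
    (hu : IsWeakSolution s p T (cylDomain ω L) (fun t x => f t (crossVar x))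
      (fun x => u₀ (crossVar x)) u) :
    let M := A + 2 * ∫ t in Ioo 0 T, F t
    let e₁ := 2 / fracConst (n + 1) s p * (2 * L * M ^ 2)
    let e₂ := 2 / fracConst n s p * M ^ 2
    let D := β ^ p * (2 ^ p * (e₁ + 2 * (2 * L * sliceConst n s p * e₂))) +
      (4 * (p - 1)) ^ p * (β⁻¹ ^ (p - 2)) ^ p *
        (2 ^ p * (2 * (c₁ * e₁ * j) + 2 * (2 * (2 * L * (c₂ * e₂) * j))))
    (∀ t ∈ Icc 0 T, MemLp (fun x => axialCutoff R x * (u t x - uInf t (crossVar x))) 2 volume ∧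
      eLpNorm (fun x => axialCutoff R x * (u t x - uInf t (crossVar x))) 2 volume ≤
        ENNReal.ofReal (√(fracConst (n + 1) s p * D))) ∧
    ∫⁻ t in Ioo 0 T, ∫⁻ z, ENNReal.ofReal (2⁻¹ ^ p * (meanCutoff R z *
      |pairDiff (fun x => u t x - uInf t (crossVar x)) z| ^ p)) ∂(gagliardoMeasure (n + 1) s p) ≤
      ENNReal.ofReal D := by
  intro M e₁ e₂ D
  have hp0 : 0 < p := by linarith
  have hL0 : 0 < L := by linarith
  have hC := fracConst_pos (d := n + 1) hs hs1 hp0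
  have hκ := (sliceConst_pos (n := n) (mul_pos hs hp0)).le
  have hcyl : MeasurableSet (cylDomain ω L) :=
    (measurableSet_slab L).inter (measurable_crossVar hω)
  have hcfin : volume (cylDomain ω L) < ⊤ := by
    rw [volume_cylDomain hω]
    exact ENNReal.mul_lt_top ENNReal.ofReal_lt_top hωfin
  have hJt : truncMass (n + 1) s p R < ⊤ := hJ.trans_lt ENNReal.ofReal_lt_top
  have hsqrt : ENNReal.ofReal (2 * L) ^ (1 / 2 : ℝ) = ENNReal.ofReal (√(2 * L)) := by
    rw [Real.sqrt_eq_rpow, ENNReal.ofReal_rpow_of_nonneg (by positivity) (by norm_num)]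
  have hscale : ∀ {k : E n → ℝ} {b : ℝ}, AEStronglyMeasurable k (volume.restrict ω) →
      eLpNorm k 2 (volume.restrict ω) ≤ ENNReal.ofReal b →
      eLpNorm (fun x => k (crossVar x)) 2 (volume.restrict (cylDomain ω L)) ≤
        ENNReal.ofReal (√(2 * L) * b) := by
    intro k b hk hb
    rw [eLpNorm_comp_crossVar hω hk, hsqrt, ENNReal.ofReal_mul (Real.sqrt_nonneg _)]
    gcongr
  have hfL : ∀ᵐ t ∂(volume.restrict (Ioo 0 T)),
      MemLp (fun x => f t (crossVar x)) 2 (volume.restrict (cylDomain ω L)) ∧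
      eLpNorm (fun x => f t (crossVar x)) 2 (volume.restrict (cylDomain ω L)) ≤
        ENNReal.ofReal (√(2 * L) * F t) := by
    filter_upwards [hf] with t ht
    exact ⟨memLp_comp_crossVar hω ht.1, hscale ht.1.1 ht.2⟩
  obtain ⟨gU, hgU, hgU'⟩ := huInf.exists_deriv hp hω hωfin hT (hf.mono fun t ht => ht.1)
  obtain ⟨gu, hgu, hgu'⟩ := hu.exists_deriv hp hcyl hcfin hT (hfL.mono fun t ht => ht.1)
  obtain ⟨eU, heU, heU'⟩ := huInf.exists_energy_bound hp hs hs1 hω hωfin hT hF0 hF hf hA hu₀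
  obtain ⟨eu, heu, heu'⟩ := hu.exists_energy_bound hp hs hs1 hcyl hcfin hT
    (fun t => mul_nonneg (Real.sqrt_nonneg _) (hF0 t)) (hF.const_mul (√(2 * L))) hfL
    (mul_nonneg (Real.sqrt_nonneg (2 * L)) hA) (hscale hu₀m hu₀)
  -- Source and initial datum both gain √(2L) on the cylinder, so the energy bound for u grows
  -- linearly in L.
  have hM : (√(2 * L) * A + 2 * ∫ t in Ioo 0 T, √(2 * L) * F t) ^ 2 = 2 * L * M ^ 2 := by
    rw [integral_const_mul]
    calc _ = √(2 * L) ^ 2 * M ^ 2 := by simp only [M]; ring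
      _ = _ := by rw [Real.sq_sqrt (by positivity)]
  rw [hM] at heu'
  -- Bounded linear operators carry continuity in time and the Bochner integral representation from
  -- u and U to ζ(u − U).
  obtain ⟨J, hJop⟩ := exists_cutoffExtension (n := n) hL hR
  obtain ⟨Z, hZ⟩ := exists_cutoffMul (n := n) R
  set W : ℝ → L2 (n + 1) := fun t => Z (u t) - J (uInf t) with hWdef
  set h : ℝ → L2 (n + 1) := fun t => Z (gu t) - J (gU t) with hhdef
  have hsub : ∀ (a : L2 (n + 1)) (b : L2 n), (Z a - J b : L2 (n + 1)) =ᵐ[volume]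
      fun x => axialCutoff R x * (a x - b (crossVar x)) := by
    intro a b
    filter_upwards [Lp.coeFn_sub (Z a) (J b), hZ a, hJop b] with x h1 h2 h3
    rw [h1, Pi.sub_apply, h2, h3]
    ring
  have hWc : ContinuousOn W (Icc 0 T) :=
    (Z.continuous.comp_continuousOn hu.1).sub (J.continuous.comp_continuousOn huInf.1)
  have hW0 : W 0 = 0 := by
    have z1 := hu.zero_outside hcyl hT (hgu'.mono fun t ht => ht.1) 0 (left_mem_Icc.2 hT.le)
    have z2 := quasiMeasurePreserving_crossVar.ae
      (huInf.zero_outside hω hT (hgU'.mono fun t ht => ht.1) 0 (left_mem_Icc.2 hT.le))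
    have i1 := (ae_restrict_iff' hcyl).1 hu.2.1
    have i2 := quasiMeasurePreserving_crossVar.ae ((ae_restrict_iff' hω).1 huInf.2.1)
    ext1
    filter_upwards [hsub (u 0) (uInf 0), z1, z2, i1, i2, Lp.coeFn_zero ℝ 2 volume]
      with x h1 h2 h3 h4 h5 h6
    rw [h6, Pi.zero_apply, hWdef]
    simp only
    rw [h1]
    by_cases hx : x ∈ slab n L
    · by_cases hxω : crossVar x ∈ ω
      · rw [h4 ⟨hx, hxω⟩, h5 hxω, sub_self, mul_zero]
      · rw [h2 fun h => hxω h.2, h3 hxω, sub_self, mul_zero]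
    · rw [axialCutoff_eq_zero hL hR hx, zero_mul]
  have hWint : ∀ a b, 0 < a → a ≤ b → b ≤ T → IntervalIntegrable h volume a b ∧
      W b = W a + ∫ r in a..b, h r := by
    intro a b ha hab hb
    obtain ⟨p1, p2⟩ := hgu a b ha hab hb
    obtain ⟨q1, q2⟩ := hgU a b ha hab hb
    have p3 : IntervalIntegrable (fun t => Z (gu t)) volume a b :=
      ⟨Z.integrable_comp p1.1, Z.integrable_comp p1.2⟩
    have q3 : IntervalIntegrable (fun t => J (gU t)) volume a b :=
      ⟨J.integrable_comp q1.1, J.integrable_comp q1.2⟩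
    refine ⟨p3.sub q3, ?_⟩
    simp only [hWdef, hhdef]
    rw [intervalIntegral.integral_sub p3 q3, Z.intervalIntegral_comp_comm p1,
      J.intervalIntegral_comp_comm q1, p2, q2, map_add, map_add]
    abel
  have hK0 : 0 ≤ (4 * (p - 1)) ^ p * (β⁻¹ ^ (p - 2)) ^ p :=
    mul_nonneg (Real.rpow_nonneg (by linarith) _) (by positivity)
  set K := (4 * (p - 1)) ^ p * (β⁻¹ ^ (p - 2)) ^ p with hK
  set b₁ := β ^ p * 2 ^ p + K * (2 ^ p * (2 * (c₁ * j))) with hb₁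
  set b₂ := β ^ p * (2 ^ p * (2 * (2 * L * sliceConst n s p))) +
    K * (2 ^ p * (2 * (2 * (2 * L * c₂ * j)))) with hb₂
  have hb₁0 : 0 ≤ b₁ := by positivity
  have hb₂0 : 0 ≤ b₂ := by positivity
  -- The pointwise error is linear in the two energy majorants, so only their time integrals matter.
  have hD : D = b₁ * e₁ + b₂ * e₂ := by
    simp only [D, hb₁, hb₂]
    ring
  have hCi : 0 < 2 / fracConst (n + 1) s p := by positivity
  obtain ⟨r1, r2⟩ := norm_sq_le_and_lintegral_le (C := 2 / fracConst (n + 1) s p) (D := D)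
    (bd := fun t => b₁ * eu t + b₂ * eU t)
    (P := fun t => ∫⁻ z, ENNReal.ofReal (2⁻¹ ^ p * (meanCutoff R z *
      |pairDiff (fun x => u t x - uInf t (crossVar x)) z| ^ p)) ∂(gagliardoMeasure (n + 1) s p))
    hT hCi hWc hW0 hWint
    (by
      filter_upwards [heu, heU] with t h1 h2
      have := h1.1
      have := h2.1
      positivity)
    (by
      intro a ha haT
      obtain ⟨p1, p2⟩ := heu' a ha haT
      obtain ⟨q1, q2⟩ := heU' a ha haT
      refine ⟨(p1.const_mul _).add (q1.const_mul _), ?_⟩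
      rw [intervalIntegral.integral_add (p1.const_mul _) (q1.const_mul _),
        intervalIntegral.integral_const_mul, intervalIntegral.integral_const_mul, hD]
      exact add_le_add (mul_le_mul_of_nonneg_left p2 hb₁0) (mul_le_mul_of_nonneg_left q2 hb₂0))
    (by
      filter_upwards [heu, heU, hgu', hgU', hf] with t h1 h2 h3 h4 h5
      have hI := inner_cutoff_sub_eq hn hp hs hs1 hω hωfin hL hR hJt h5.1 h3.1 h4.1
        (hsub (u t) (uInf t)) (hsub (gu t) (gU t)) h3.2 h4.2
      have hE := localized_energy_le hn hp hs hL hR h3.1 h4.1 (eu := eu t) (eU := eU t)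
        (nu := c₁ * eu t) (nU := c₂ * eU t) hβ hj h1.1 h2.1
        (mul_nonneg hc₁ h1.1) (mul_nonneg hc₂ h2.1) hJ h1.2 h2.2
        (by
          rw [ENNReal.ofReal_mul hc₁]
          exact (hP₁ _ h3.1).trans (mul_le_mul_right h1.2 _))
        (by
          rw [ENNReal.ofReal_mul hc₂]
          exact (hP₂ _ h4.1).trans (mul_le_mul_right h2.2 _))
      simp only [hI] at hE
      have e : β ^ p * (2 ^ p * (eu t + 2 * (2 * L * sliceConst n s p * eU t))) +
          (4 * (p - 1)) ^ p * (β⁻¹ ^ (p - 2)) ^ p *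
            (2 ^ p * (2 * (c₁ * eu t * j) + 2 * (2 * (2 * L * (c₂ * eU t) * j)))) =
          b₁ * eu t + b₂ * eU t := by
        simp only [hb₁, hb₂, hK]
        ring
      rwa [e] at hE)
  refine ⟨fun t ht => ?_, r2⟩
  have hae := hsub (u t) (uInf t)
  refine ⟨(memLp_congr_ae hae).1 (Lp.memLp _), ?_⟩
  rw [← eLpNorm_congr_ae hae, ← ENNReal.ofReal_toReal (Lp.eLpNorm_ne_top _), ← Lp.norm_def]
  refine ENNReal.ofReal_le_ofReal (Real.le_sqrt_of_sq_le ?_)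
  have h1 := r1 t ht
  have h2 : 2 / fracConst (n + 1) s p / 2 * ‖W t‖ ^ 2 = ‖W t‖ ^ 2 / fracConst (n + 1) s p := by
    ring
  rw [h2, div_le_iff₀ hC] at h1
  linarith

end comparison

/-! ### The rate and the conclusion -/

lemma mixedNorm_top_le {d : ℕ} {r b : ℝ≥0∞} {T : ℝ} {Ω : Set (E d)} {w : ℝ → E d → ℝ}
    (h : ∀ t ∈ Ioo 0 T, eLpNorm (w t) r (volume.restrict Ω) ≤ b) : mixedNorm ∞ r T Ω w ≤ b := by
  rw [mixedNorm, eLpNorm_exponent_top, eLpNormEssSup_eq_essSup_enorm]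
  refine essSup_le_of_ae_le _ ((ae_restrict_iff' measurableSet_Ioo).2 ?_)
  exact Eventually.of_forall fun t ht => by simpa using h t ht

lemma eLpNorm_ofReal_rpow {α : Type*} {m : MeasurableSpace α} {μ : Measure α} {p : ℝ} (hp : 0 < p)
    {ε : Type*} [TopologicalSpace ε] [ContinuousENorm ε] (f : α → ε) :
    eLpNorm f (ENNReal.ofReal p) μ ^ p = ∫⁻ x, ‖f x‖ₑ ^ p ∂μ := by
  rw [eLpNorm_eq_lintegral_rpow_enorm_toReal (by simpa using hp) ENNReal.ofReal_ne_top,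
    ENNReal.toReal_ofReal hp.le, ← ENNReal.rpow_mul, one_div_mul_cancel hp.ne', ENNReal.rpow_one]

lemma mixedNorm_rpow {d : ℕ} {p T : ℝ} (hp : 0 < p) (Ω : Set (E d)) (w : ℝ → E d → ℝ) :
    mixedNorm (ENNReal.ofReal p) (ENNReal.ofReal p) T Ω w ^ p =
      ∫⁻ t in Ioo 0 T, ∫⁻ x in Ω, ENNReal.ofReal (|w t x| ^ p) := by
  rw [mixedNorm, eLpNorm_ofReal_rpow hp]
  refine lintegral_congr fun t => ?_
  rw [enorm_eq_self, eLpNorm_ofReal_rpow hp]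
  refine lintegral_congr fun x => ?_
  rw [Real.enorm_eq_ofReal_abs, ENNReal.ofReal_rpow_of_nonneg (abs_nonneg _) hp.le]

lemma axialCutoff_eq_one {n : ℕ} {R l₀ : ℝ} {ω : Set (E n)} (hR : 0 < R) (h : l₀ ≤ R)
    {x : E (n + 1)} (hx : x ∈ cylDomain ω l₀) : axialCutoff R x = 1 :=
  cutoff_eq_one hR (abs_le.2 ⟨by linarith [hx.1.1], by linarith [hx.1.2]⟩)

/-- The powers of the length that occur in the energy estimate. -/
lemma rpow_scaling {s p l : ℝ} (hp : 2 < p) (hl : 0 < l) :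
    (l ^ (-(s / (p - 1)))) ^ p * l = 1 / l ^ (s * p / (p - 1) - 1) ∧
    ((l ^ (-(s / (p - 1))))⁻¹ ^ (p - 2)) ^ p * (1 / (l / 2) ^ (s * p)) =
      2 ^ (s * p) * (l ^ (-(s / (p - 1)))) ^ p := by
  have hp1 : p - 1 ≠ 0 := by linarith
  constructor
  · rw [one_div, ← Real.rpow_neg hl.le, ← Real.rpow_mul hl.le, ← Real.rpow_add_one hl.ne']
    congr 1
    ring
  · have h1 : 1 / (l / 2) ^ (s * p) = 2 ^ (s * p) * l ^ (-(s * p)) := by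
      rw [Real.div_rpow hl.le (by norm_num), one_div_div, Real.rpow_neg hl.le, div_eq_mul_inv]
    rw [h1, ← Real.rpow_neg hl.le, ← Real.rpow_mul hl.le, ← Real.rpow_mul hl.le,
      ← Real.rpow_mul hl.le, mul_left_comm, ← Real.rpow_add hl]
    congr 2
    field_simp
    ring

/-- The left side is the constant of `exists_cutoff_sub_le` for half-length l, cutoff scale l/2 and
truncated mass K (l/2)^{−sp}. The choice β = l^{−s/(p−1)} gives both error terms the order β^p, and
the factor l is the length of the slab. -/
lemma energy_constant_eq {s p l C₁ C₂ κ K c₁ c₂ M : ℝ} (hp : 2 < p) (hl : 0 < l) :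
    (l ^ (-(s / (p - 1)))) ^ p * (2 ^ p * (2 / C₁ * (2 * l * M ^ 2) +
      2 * (2 * l * κ * (2 / C₂ * M ^ 2)))) +
    (4 * (p - 1)) ^ p * ((l ^ (-(s / (p - 1))))⁻¹ ^ (p - 2)) ^ p *
      (2 ^ p * (2 * (c₁ * (2 / C₁ * (2 * l * M ^ 2)) * (K * (1 / (l / 2) ^ (s * p)))) +
        2 * (2 * (2 * l * (c₂ * (2 / C₂ * M ^ 2)) * (K * (1 / (l / 2) ^ (s * p))))))) =
    (2 ^ p * (2 / C₁ * (2 * M ^ 2) + 4 * κ * (2 / C₂ * M ^ 2)) +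
      (4 * (p - 1)) ^ p * 2 ^ p * K * 2 ^ (s * p) *
        (2 * c₁ * (2 / C₁ * (2 * M ^ 2)) + 8 * c₂ * (2 / C₂ * M ^ 2))) *
      (1 / l ^ (s * p / (p - 1) - 1)) := by
  obtain ⟨h1, h2⟩ := rpow_scaling (s := s) hp hl
  rw [← h1]
  generalize l ^ (-(s / (p - 1))) = β at *
  generalize 1 / (l / 2) ^ (s * p) = Y at *
  generalize (β⁻¹ ^ (p - 2)) ^ p = X at *
  have e : ∀ a b c d : ℝ, a * X * (2 ^ p * (2 * (b * (K * Y)) + 2 * (2 * (c * d * (K * Y))))) =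
      a * (X * Y) * (2 ^ p * (2 * b * K + 2 * (2 * (c * d * K)))) := fun a b c d => by ring
  rw [e, h2]
  ring

/-- The localized energy controls the `L^p` norm over a shorter cylinder. -/
lemma lintegral_cylDomain_le {n : ℕ} {s p R l₀ c : ℝ} {ω : Set (E n)} (hR : 0 < R) (h : l₀ ≤ R)
    (hc : 0 ≤ c) {w : E (n + 1) → ℝ}
    (hP : ∫⁻ x in cylDomain ω l₀, ENNReal.ofReal (|w x| ^ p) ≤ ENNReal.ofReal c *
      ∫⁻ z, (cylDomain ω l₀).indicator 1 z.1 * ENNReal.ofReal (|pairDiff w z| ^ p)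
        ∂(gagliardoMeasure (n + 1) s p)) :
    ∫⁻ x in cylDomain ω l₀, ENNReal.ofReal (|w x| ^ p) ≤ ENNReal.ofReal (c * (2 * 2 ^ p)) *
      ∫⁻ z, ENNReal.ofReal (2⁻¹ ^ p * (meanCutoff R z * |pairDiff w z| ^ p))
        ∂(gagliardoMeasure (n + 1) s p) := by
  refine hP.trans ?_
  rw [ENNReal.ofReal_mul hc, mul_assoc]
  refine mul_le_mul_right ?_ _
  rw [← lintegral_const_mul' _ _ ENNReal.ofReal_ne_top]
  refine lintegral_mono fun z => ?_
  by_cases hz : z.1 ∈ cylDomain ω l₀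
  · rw [indicator_of_mem hz, Pi.one_apply, one_mul, ← ENNReal.ofReal_mul (by positivity)]
    refine ENNReal.ofReal_le_ofReal ?_
    -- One point in the short cylinder already gives mean at least 1/2, whatever the position of the
    -- other.
    have h1 : 1 ≤ 2 * meanCutoff R z := by
      rw [meanCutoff, axialCutoff_eq_one hR h hz]
      linarith [sq_nonneg (axialCutoff R z.2)]
    have h2 : (2 : ℝ) ^ p * 2⁻¹ ^ p = 1 := by
      rw [← Real.mul_rpow (by norm_num) (by norm_num)]
      norm_num
    calc |pairDiff w z| ^ p ≤ 2 * meanCutoff R z * |pairDiff w z| ^ p :=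
          le_mul_of_one_le_left (by positivity) h1
      _ = 2 ^ p * 2⁻¹ ^ p * (2 * meanCutoff R z * |pairDiff w z| ^ p) := by rw [h2, one_mul]
      _ = _ := by ring
  · rw [indicator_of_notMem hz, zero_mul]
    exact zero_le

/-- The energy estimate with the cutoff adapted to the length of the cylinder. -/
lemma exists_localized_rate {n : ℕ} {s p T : ℝ} {ω : Set (E n)} (hn : 1 ≤ n) (hp : 2 < p)
    (hs : 0 < s) (hs1 : s < 1) (hT : 0 < T) (hω : MeasurableSet ω) (hωfin : volume ω < ⊤)
    {c₁ c₂ : ℝ} (hc₁ : 0 ≤ c₁) (hc₂ : 0 ≤ c₂)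
    (hP₁ : ∀ l : ℝ, ∀ w : E (n + 1) → ℝ, MemW0 s p (cylDomain ω l) w →
      ∫⁻ x, ENNReal.ofReal (|w x| ^ p) ≤ ENNReal.ofReal c₁ * gagliardoPow s p w)
    (hP₂ : ∀ w : E n → ℝ, MemW0 s p ω w →
      ∫⁻ X, ENNReal.ofReal (|w X| ^ p) ≤ ENNReal.ofReal c₂ * gagliardoPow s p w)
    {f : ℝ → E n → ℝ} {F : ℝ → ℝ} (hF0 : ∀ t, 0 ≤ F t) (hF : IntegrableOn F (Ioo 0 T))
    (hf : ∀ᵐ t ∂(volume.restrict (Ioo 0 T)), MemLp (f t) 2 (volume.restrict ω) ∧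
      eLpNorm (f t) 2 (volume.restrict ω) ≤ ENNReal.ofReal (F t))
    {u₀ : E n → ℝ} (hu₀ : MemLp u₀ 2 (volume.restrict ω))
    {uInf : ℝ → L2 n} (huInf : IsWeakSolution s p T ω f u₀ uInf) :
    ∃ D₀ : ℝ, 0 ≤ D₀ ∧ ∀ l : ℝ, 0 < l → ∀ u : ℝ → L2 (n + 1),
      IsWeakSolution s p T (cylDomain ω l) (fun t x => f t (crossVar x))
        (fun x => u₀ (crossVar x)) u →
      (∀ t ∈ Icc 0 T,
        eLpNorm (fun x => axialCutoff (l / 2) x * (u t x - uInf t (crossVar x))) 2 volume ≤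
          ENNReal.ofReal (√(fracConst (n + 1) s p * (D₀ * (1 / l ^ (s * p / (p - 1) - 1)))))) ∧
      ∫⁻ t in Ioo 0 T, ∫⁻ z, ENNReal.ofReal (2⁻¹ ^ p * (meanCutoff (l / 2) z *
        |pairDiff (fun x => u t x - uInf t (crossVar x)) z| ^ p)) ∂(gagliardoMeasure (n + 1) s p) ≤
        ENNReal.ofReal (D₀ * (1 / l ^ (s * p / (p - 1) - 1))) := by
  have hp0 : 0 < p := by linarith
  have hC₁ := fracConst_pos (d := n + 1) hs hs1 hp0
  have hC₂ := fracConst_pos (d := n) hs hs1 hp0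
  have hκ := sliceConst_pos (n := n) (mul_pos hs hp0)
  obtain ⟨K, hK, hKR⟩ := exists_lintegral_truncated_kernel_le (d := n + 1) (by omega) hp0 hs hs1
  set A := (eLpNorm u₀ 2 (volume.restrict ω)).toReal with hA
  have hA' : eLpNorm u₀ 2 (volume.restrict ω) ≤ ENNReal.ofReal A := by
    rw [hA, ENNReal.ofReal_toReal hu₀.2.ne]
  set M := A + 2 * ∫ t in Ioo 0 T, F t with hM
  have h4 : 0 ≤ (4 * (p - 1)) ^ p := Real.rpow_nonneg (by linarith) _
  refine ⟨2 ^ p * (2 / fracConst (n + 1) s p * (2 * M ^ 2) +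
      4 * sliceConst n s p * (2 / fracConst n s p * M ^ 2)) +
    (4 * (p - 1)) ^ p * 2 ^ p * K * 2 ^ (s * p) *
      (2 * c₁ * (2 / fracConst (n + 1) s p * (2 * M ^ 2)) +
        8 * c₂ * (2 / fracConst n s p * M ^ 2)), by positivity, fun l hl u hu => ?_⟩
  have hR : 0 < l / 2 := by linarith
  have hL : l = 2 * (l / 2) := by ring
  rw [← energy_constant_eq (κ := sliceConst n s p) (C₁ := fracConst (n + 1) s p)
    (C₂ := fracConst n s p) hp hl]
  have key := exists_cutoff_sub_le (β := l ^ (-(s / (p - 1))))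
    (j := K * (1 / (l / 2) ^ (s * p))) hn hp hs hs1 hT hω hωfin hL hR (by positivity)
    (by positivity) hc₁ hc₂ (hKR _ hR) (hP₁ l) hP₂ hF0 hF hf hu₀.1 ENNReal.toReal_nonneg hA'
    huInf hu
  exact ⟨fun t ht => (key.1 t ht).2, key.2⟩

theorem theorem1p2 (n : ℕ) (hn : 1 ≤ n) (s p T : ℝ) (hp : 2 < p)
    (hs : 1 / (p / (p - 1)) < s) (hs1 : s < 1) (hT : 0 < T)
    (ω : Set (E n)) (hω : IsOpen ω) (hωb : Bornology.IsBounded ω)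
    (f : ℝ → Lp ℝ 2 (volume.restrict ω)) (hf : MemLp f 2 (volume.restrict (Ioo 0 T)))
    (u₀ : Lp ℝ 2 (volume.restrict ω))
    (uInf : ℝ → L2 n)
    (huInf : IsWeakSolution s p T ω (fun t X => f t X) (fun X => u₀ X) uInf)
    (l₀ : ℝ) (hl₀ : 0 < l₀) :
    ∃ C : ℝ, 0 < C ∧ ∀ᶠ l : ℝ in atTop, ∀ u : ℝ → L2 (n + 1),
      IsWeakSolution s p T (cylDomain ω l)
        (fun t x => f t (crossVar x)) (fun x => u₀ (crossVar x)) u →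
      mixedNorm ∞ 2 T (cylDomain ω l₀) (fun t x => u t x - uInf t (crossVar x)) ^ 2 +
        mixedNorm (ENNReal.ofReal p) (ENNReal.ofReal p) T (cylDomain ω l₀)
          (fun t x => u t x - uInf t (crossVar x)) ^ p ≤
      ENNReal.ofReal (C * (1 / l ^ (s * p - 1) + 1 / l ^ (s * p / (p - 1) - 1))) := by
  have hp0 : 0 < p := by linarith
  have hs0 : 0 < s := lt_of_le_of_lt
    (div_nonneg zero_le_one (div_nonneg hp0.le (by linarith))) hs
  have hωm := hω.measurableSet
  have hC₁ := fracConst_pos (d := n + 1) hs0 hs1 hp0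
  obtain ⟨R₀, hR₀, hωR⟩ := hωb.exists_pos_norm_lt
  have hωi : ∀ X ∈ ω, |X ⟨0, hn⟩| < R₀ := fun X hX =>
    (by simpa using PiLp.norm_apply_le X ⟨0, hn⟩ : |X ⟨0, hn⟩| ≤ ‖X‖).trans_lt (hωR X hX)
  have hcω : ∀ x : E (n + 1), crossVar x ∈ ω → |x (Fin.succ ⟨0, hn⟩)| < R₀ := fun x hx =>
    hωi _ hx
  -- Poincaré is used along a cross-sectional coordinate, in which ω is bounded by R₀, so the
  -- constants do not depend on ℓ.
  obtain ⟨c₁, hc₁, hP₁⟩ :=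
    exists_poincare_memW0 (s := s) (p := p) (Fin.succ ⟨0, hn⟩ : Fin (n + 1)) hR₀ hp0 hs0
  obtain ⟨c₂, hc₂, hP₂⟩ := exists_poincare_memW0 (s := s) (p := p) (⟨0, hn⟩ : Fin n) hR₀ hp0 hs0
  obtain ⟨c₃, hc₃, hP₃⟩ :=
    exists_poincare (s := s) (p := p) (Fin.succ ⟨0, hn⟩ : Fin (n + 1)) hR₀ hp0 hs0
  have hLp : ∀ g : Lp ℝ 2 (volume.restrict ω),
      eLpNorm g 2 (volume.restrict ω) ≤ ENNReal.ofReal ‖g‖ := fun g => by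
    rw [Lp.norm_def, ENNReal.ofReal_toReal (Lp.eLpNorm_ne_top g)]
  have hcyl : ∀ l, MeasurableSet (cylDomain ω l) := fun l =>
    (measurableSet_slab l).inter (measurable_crossVar hωm)
  have hcfin : ∀ l, volume (cylDomain ω l) < ⊤ := fun l => by
    rw [volume_cylDomain hωm]
    exact ENNReal.mul_lt_top ENNReal.ofReal_lt_top hωb.measure_lt_top
  obtain ⟨D₀, hD₀, hD⟩ := exists_localized_rate hn hp hs0 hs1 hT hωm hωb.measure_lt_top hc₁.le
    hc₂.le (fun l w hw => hP₁ _ w (fun x hx => hcω x hx.2) (hcyl l) hw)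
    (fun w hw => hP₂ _ w hωi hωm hw) (fun t => norm_nonneg (f t))
    (hf.integrable (by norm_num)).norm
    (Eventually.of_forall fun t => ⟨Lp.memLp (f t), hLp (f t)⟩) (Lp.memLp u₀) huInf
  have hzInf := huInf.zero_outside hωm hT
    ((huInf.exists_deriv hp hωm hωb.measure_lt_top hT
      (Eventually.of_forall fun t => Lp.memLp (f t))).choose_spec.2.mono fun t ht => ht.1)
  -- The two summands come from the L² bound and from the local Poincaré inequality; the final 1
  -- ensures positivity when D₀ = 0.
  refine ⟨(fracConst (n + 1) s p + c₃ * (2 * 2 ^ p)) * D₀ + 1, by positivity, ?_⟩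
  filter_upwards [eventually_ge_atTop (2 * l₀)] with l hl u hu
  have hl0 : 0 < l := by linarith
  have hR : 0 < l / 2 := by linarith
  have hlR : l₀ ≤ l / 2 := by linarith
  obtain ⟨hmem, hP⟩ := hD l hl0 u hu
  have hE0 : 0 ≤ 1 / l ^ (s * p / (p - 1) - 1) := by positivity
  set D := D₀ * (1 / l ^ (s * p / (p - 1) - 1)) with hDdef
  have hDnn : 0 ≤ D := mul_nonneg hD₀ hE0
  have hzu := hu.zero_outside (hcyl l) hT
    ((hu.exists_deriv hp (hcyl l) (hcfin l) hT
      (Eventually.of_forall fun t => memLp_comp_crossVar hωm (Lp.memLp (f t)))).choose_spec.2.mono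
        fun t ht => ht.1)
  have h1 : mixedNorm ∞ 2 T (cylDomain ω l₀) (fun t x => u t x - uInf t (crossVar x)) ^ 2 ≤
      ENNReal.ofReal (fracConst (n + 1) s p * D) := by
    rw [← Real.sq_sqrt (mul_nonneg hC₁.le hDnn), ENNReal.ofReal_pow (Real.sqrt_nonneg _)]
    refine pow_le_pow_left' (mixedNorm_top_le fun t ht => ?_) 2
    refine le_trans ?_ (hmem t ⟨ht.1.le, ht.2.le⟩)
    refine le_trans (le_of_eq (eLpNorm_congr_ae ?_)) (eLpNorm_restrict_le _ _ _ (cylDomain ω l₀))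
    filter_upwards [ae_restrict_mem (hcyl l₀)] with x hx
    rw [axialCutoff_eq_one hR hlR hx, one_mul]
  have h2 : mixedNorm (ENNReal.ofReal p) (ENNReal.ofReal p) T (cylDomain ω l₀)
      (fun t x => u t x - uInf t (crossVar x)) ^ p ≤
      ENNReal.ofReal (c₃ * (2 * 2 ^ p) * D) := by
    rw [mixedNorm_rpow hp0, ENNReal.ofReal_mul (by positivity)]
    refine le_trans ?_ (mul_le_mul_right hP _)
    rw [← lintegral_const_mul' _ _ ENNReal.ofReal_ne_top]
    refine lintegral_mono_ae ((ae_restrict_iff' measurableSet_Ioo).2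
      (Eventually.of_forall fun t ht => ?_))
    -- The outer set is the infinite cylinder ℝ × ω: u − U vanishes for X₂ outside ω, but not
    -- necessarily for |x₁| ≥ ℓ, where it equals −U.
    refine lintegral_cylDomain_le hR hlR hc₃.le (hP₃ {x | crossVar x ∈ ω} _ _ hcω (hcyl l₀)
      (fun x hx => hx.2) ((Lp.aestronglyMeasurable (u t)).sub
        (aestronglyMeasurable_comp_crossVar (Lp.aestronglyMeasurable (uInf t)))) ?_)
    filter_upwards [hzu t ⟨ht.1.le, ht.2.le⟩,
      quasiMeasurePreserving_crossVar.ae (hzInf t ⟨ht.1.le, ht.2.le⟩)] with x hx1 hx2 hx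
    rw [hx1 fun h => hx h.2, hx2 hx, sub_self]
  refine (add_le_add h1 h2).trans ?_
  rw [← ENNReal.ofReal_add (by positivity) (by positivity)]
  refine ENNReal.ofReal_le_ofReal ?_
  -- The bound obtained involves only the exponent sp/(p − 1) − 1; the other rate enters through its
  -- nonnegativity.
  have hE1 : 0 ≤ 1 / l ^ (s * p - 1) := by positivity
  have hB : 0 ≤ (fracConst (n + 1) s p + c₃ * (2 * 2 ^ p)) * D₀ := by positivity
  rw [hDdef]
  calc _ = (fracConst (n + 1) s p + c₃ * (2 * 2 ^ p)) * D₀ *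
        (1 / l ^ (s * p / (p - 1) - 1)) := by ring
    _ ≤ _ := mul_le_mul (by linarith) (by linarith) hE0 (by linarith)
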